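/- **Lemma 4.2 (Removing the boundary from a hard-sphere configuration).** *Definitions.* Let $X\subset\mathbb R^2$ be a finite set of points ("particles"). The *bond graph* $(X,E)$ has the edges $E=\{\{x,y\}: x,y\in X,\ |x-y|=1\}$, drawn as straight segments. Let $\Gamma_X\subset\mathbb R^2$ be the union of $X$ and of all these segments. A *face* is a bounded connected component $f$ of $\mathbb R^2\setminus\Gamma_X$ whose boundary is traced out by a closed walk of the bond graph, i.e. $\partial f=\bigcup_{i=1}^k[x_{i-1},x_i]$ with $x_0,\dots,x_k=x_0\in X$ (repetitions allowed) and $\{x_{i-1},x_i\}\in E$. Call the complement of the union of the closures of all faces the *outer region*. An edge is a - *regular interior edge* if it lies on the boundary of two faces; - *regular boundary edge* if it lies on the boundary of precisely one face and on that of the outer region; - *outer wire edge* if it lies on the boundary of no face; - *inner wire edge* if it lies on the boundary of precisely one face but not on that of the outer region. Regular boundary edges and outer wire edges are called *boundary edges*. The set $\partial X$ of *boundary particles* consists of all $x\in X$ that are isolated in the bond graph or incident with a boundary edge. The *perimeter* is $$P(X)=\sharp\{\text{regular boundary edges}\}+2\,\sharp\{\text{outer wire edges}\}.$$ The *defect measure*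 $\mu(X)$ is the number of edges added when the bond graph is triangulated, that is, when for each face with $k>3$ edges (inner wire edges counted twice) $k-3$ non-crossing edges are added inside the face; so $\mu(X)$ is the sum of $k-3$ over all these faces. $X$ has *simply closed polygonal boundary* if its bond graph is connected and its boundary edges are precisely the edges of a cycle (a closed walk, with at least three edges, without repeated vertices). *Statement.* Let $X\subset\mathbb R^2$ be a finite set such that $|x-y|\ge 1$ for all distinct $x,y\in X$. Assume that $X$ has simply closed polygonal boundary and that $X'=X\setminus\partial X$ is nonempty. Then $$P(X)+\mu(X)\ \ge\ P(X')+\mu(X')+6,$$ where $P(X')$ and $\mu(X')$ refer to the bond graph of $X'$. Moreover, if equality holds, then $\mu(X)=\mu(X')$. -/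

import Mathlib

noncomputable section

namespace HardSphere

/-- The euclidean plane. -/
abbrev Plane : Type := EuclideanSpace ℝ (Fin 2)

/-- All interparticle distances are at least `1`. -/
def IsHardSphere (X : Finset Plane) : Prop :=
  ∀ x ∈ X, ∀ y ∈ X, x ≠ y → 1 ≤ dist x y

/-- The bond graph of the configuration `X`: particles of `X` at distance exactly `1` are linked.
(The vertex type is the whole plane; points outside `X` have no neighbours.) -/
def bondGraph (X : Finset Plane) : SimpleGraph Plane where
  Adj x y := x ∈ X ∧ y ∈ X ∧ dist x y = 1
  symm := ⟨fun x y h => ⟨h.2.1, h.1, by rw [dist_comm]; exact h.2.2⟩⟩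
  loopless := ⟨fun x h => by simpa using h.2.2⟩

/-- The closed line segment drawn for the pair `e`. -/
def edgeSegment (e : Sym2 Plane) : Set Plane :=
  Sym2.lift ⟨fun x y => segment ℝ x y, fun x y => segment_symm ℝ x y⟩ e

/-- The open line segment drawn for the pair `e`. -/
def openEdgeSegment (e : Sym2 Plane) : Set Plane :=
  Sym2.lift ⟨fun x y => openSegment ℝ x y, fun x y => openSegment_symm ℝ x y⟩ e

/-- The subset of the plane covered by the particles and the bonds. -/
def drawing (X : Finset Plane) : Set Plane :=
  (X : Set Plane) ∪ ⋃ e ∈ (bondGraph X).edgeSet, edgeSegment e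

/-- A face: a bounded connected component of the complement of the drawn bond graph whose boundary
is traced out by a closed walk of the bond graph. (The vertices of the walk may repeat; ring-shaped
regions with disconnected boundary are not faces.) -/
def IsFace (X : Finset Plane) (f : Set Plane) : Prop :=
  (∃ p ∈ (drawing X)ᶜ, f = connectedComponentIn (drawing X)ᶜ p) ∧
  Bornology.IsBounded f ∧
  ∃ (x : Plane) (w : (bondGraph X).Walk x x), frontier f = ⋃ e ∈ w.edges, edgeSegment e

/-- The faces on whose boundary the edge `e` lies. -/
def facesAt (X : Finset Plane) (e : Sym2 Plane) : Set (Set Plane) :=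
  {f | IsFace X f ∧ edgeSegment e ⊆ frontier f}

/-- The region outside all (closed) faces. -/
def outerRegion (X : Finset Plane) : Set Plane :=
  (⋃ f ∈ {f | IsFace X f}, closure f)ᶜ

/-- `e` lies on the boundary of two faces. -/
def IsRegularInteriorEdge (X : Finset Plane) (e : Sym2 Plane) : Prop :=
  e ∈ (bondGraph X).edgeSet ∧ (facesAt X e).ncard = 2

/-- `e` lies on the boundary of precisely one face and on that of the outer region. -/
def IsRegularBoundaryEdge (X : Finset Plane) (e : Sym2 Plane) : Prop :=
  e ∈ (bondGraph X).edgeSet ∧ (facesAt X e).ncard = 1 ∧ edgeSegment e ⊆ frontier (outerRegion X)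

/-- `e` does not lie on the boundary of any face. -/
def IsOuterWireEdge (X : Finset Plane) (e : Sym2 Plane) : Prop :=
  e ∈ (bondGraph X).edgeSet ∧ facesAt X e = ∅

/-- `e` lies on the boundary of precisely one face but not on that of the outer region. -/
def IsInnerWireEdge (X : Finset Plane) (e : Sym2 Plane) : Prop :=
  e ∈ (bondGraph X).edgeSet ∧ (facesAt X e).ncard = 1 ∧ ¬ edgeSegment e ⊆ frontier (outerRegion X)

/-- Boundary edges: regular boundary edges and outer wire edges. -/
def IsBoundaryEdge (X : Finset Plane) (e : Sym2 Plane) : Prop :=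
  IsRegularBoundaryEdge X e ∨ IsOuterWireEdge X e

/-- Boundary particles: those that are isolated or incident with a boundary edge. -/
def IsBoundaryParticle (X : Finset Plane) (x : Plane) : Prop :=
  x ∈ X ∧ ((∀ y, ¬ (bondGraph X).Adj x y) ∨ ∃ e, IsBoundaryEdge X e ∧ x ∈ e)

open scoped Classical in
/-- The set `∂X` of boundary particles. -/
def boundary (X : Finset Plane) : Finset Plane := {x ∈ X | IsBoundaryParticle X x}

open scoped Classical in
/-- The configuration `X' = X \ ∂X`. -/
def removeBoundary (X : Finset Plane) : Finset Plane := X \ boundary X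

/-- The combinatorial perimeter `P(X)`; outer wire edges count twice. -/
def perimeter (X : Finset Plane) : ℕ :=
  {e | IsRegularBoundaryEdge X e}.ncard + 2 * {e | IsOuterWireEdge X e}.ncard

/-- The number of edges of the face `f`, inner wire edges counted twice. -/
def faceLength (X : Finset Plane) (f : Set Plane) : ℕ :=
  {e | e ∈ (bondGraph X).edgeSet ∧ edgeSegment e ⊆ frontier f}.ncard +
    {e | IsInnerWireEdge X e ∧ edgeSegment e ⊆ frontier f}.ncard

/-- The defect measure `μ(X)`: the number of edges added when triangulating the bond graph, i.e.
`k - 3` edges for every face with `k > 3` edges, inner wire edges counted twice.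
See `IsTriangulation.ncard_edgeSet`. -/
def defect (X : Finset Plane) : ℕ :=
  ∑ᶠ f ∈ {f | IsFace X f}, (faceLength X f - 3)

/-- `T` is a triangulated bond graph of `X`: it arises by adding inside every face with `k > 3`
edges exactly `k - 3` non-crossing straight edges between particles. -/
structure IsTriangulation (X : Finset Plane) (T : SimpleGraph Plane) : Prop where
  le : bondGraph X ≤ T
  mem : ∀ x y, T.Adj x y → x ∈ X
  inside : ∀ e ∈ T.edgeSet \ (bondGraph X).edgeSet, ∃ f, IsFace X f ∧ openEdgeSegment e ⊆ f
  noncrossing : (T.edgeSet \ (bondGraph X).edgeSet).PairwiseDisjoint openEdgeSegment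
  count : ∀ f, IsFace X f →
    {e ∈ T.edgeSet \ (bondGraph X).edgeSet | openEdgeSegment e ⊆ f}.ncard = faceLength X f - 3

theorem IsFace.eq_of_mem {X : Finset Plane} {f g : Set Plane} (hf : IsFace X f) (hg : IsFace X g)
    {p : Plane} (hpf : p ∈ f) (hpg : p ∈ g) : f = g := by
  obtain ⟨⟨a, -, rfl⟩, -⟩ := hf
  obtain ⟨⟨b, -, rfl⟩, -⟩ := hg
  rw [connectedComponentIn_eq hpf, connectedComponentIn_eq hpg]

theorem openEdgeSegment_nonempty (e : Sym2 Plane) : (openEdgeSegment e).Nonempty := by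
  induction e with
  | h x y =>
    exact ⟨(1 / 2 : ℝ) • x + (1 / 2 : ℝ) • y,
      1 / 2, 1 / 2, by norm_num, by norm_num, by norm_num, rfl⟩

open scoped Classical in
/-- `μ(X)` is the number of additional edges of any triangulated bond graph. -/
theorem IsTriangulation.ncard_edgeSet {X : Finset Plane} {T : SimpleGraph Plane}
    (hT : IsTriangulation X T) :
    T.edgeSet.ncard = (bondGraph X).edgeSet.ncard + defect X := by
  have hfin : T.edgeSet.Finite := by
    refine (Finset.finite_toSet X.sym2).subset fun e he => ?_
    induction e with
    | h x y =>
      have h : T.Adj x y := he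
      exact Finset.mk_mem_sym2_iff.2 ⟨hT.mem _ _ h, hT.mem _ _ h.symm⟩
  have hsub : (bondGraph X).edgeSet ⊆ T.edgeSet := SimpleGraph.edgeSet_mono hT.le
  have hNfin : (T.edgeSet \ (bondGraph X).edgeSet).Finite := hfin.sdiff
  rw [← Set.ncard_sdiff_add_ncard_of_subset hsub hfin, add_comm]
  congr 1
  choose! φ hφ hφ' using hT.inside
  set N := hNfin.toFinset with hN
  have key : ∀ f, IsFace X f → faceLength X f - 3 = (N.filter fun e => φ e = f).card := by
    intro f hf
    rw [← hT.count f hf, ← Set.ncard_coe_finset]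
    congr 1
    ext e
    simp only [Set.mem_ofPred_eq, Finset.coe_filter, hN, Set.Finite.mem_toFinset]
    refine and_congr_right fun he => ⟨fun h => ?_, fun h => h ▸ hφ' e he⟩
    obtain ⟨p, hp⟩ := openEdgeSegment_nonempty e
    exact (hφ e he).eq_of_mem hf (hφ' e he hp) (h hp)
  have hmaps : ∀ e ∈ N, φ e ∈ N.image φ := fun e he => Finset.mem_image_of_mem _ he
  rw [Set.ncard_eq_toFinset_card _ hNfin, Finset.card_eq_sum_card_fiberwise hmaps, defect]
  symm
  rw [finsum_mem_congr (s := {f | IsFace X f}) rfl fun f hf => key f hf]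
  refine finsum_mem_eq_sum_of_inter_support_eq _ ?_
  ext f
  simp only [Set.mem_inter_iff, Set.mem_ofPred_eq, Function.mem_support, Finset.coe_image,
    Set.mem_image, ne_eq, Finset.card_eq_zero, ← Finset.nonempty_iff_ne_empty]
  refine and_congr_left fun hne => ?_
  obtain ⟨e, he⟩ := hne
  rw [Finset.mem_filter] at he
  refine ⟨fun _ => ⟨e, he.1, he.2⟩, fun _ => he.2 ▸ hφ e (hNfin.mem_toFinset.1 he.1)⟩

/-- `X` has simply closed polygonal boundary: its bond graph is connected, and its boundary edges
are precisely the edges of a cycle (closed walk without repeated vertices). -/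
def HasSimplyClosedBoundary (X : Finset Plane) : Prop :=
  (∀ x ∈ X, ∀ y ∈ X, (bondGraph X).Reachable x y) ∧
  ∃ (x : Plane) (w : (bondGraph X).Walk x x), w.IsCycle ∧ ∀ e, e ∈ w.edges ↔ IsBoundaryEdge X e

end HardSphere

end

/-! Write `e`, `F` for the numbers of bonds and faces of `X`, write `e'`, `F'` for those of `X'`,
and let `b` be the number of boundary particles. Call an ordered pair of neighbours a dart; its left
side lies in one component of the complement of the drawing. Every dart counts either for the
perimeter or for the length of one face, so `P + μ + 3 F = 2 e` (`perimeter_add_defect`), and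
likewise for `X'`. Subtracting, the claim becomes `2 (e - e') - 3 (F - F') ≥ 6`. Two estimates
suffice, since together they give `2 (e - e') - 3 (F - F') ≥ 3 b - (e - e') ≥ 6`.

The first is `F - F' ≤ e - e' - b` (`BoundaryCycle.ncard_lost_faces_le`). The faces lost with the
boundary lie in the unbounded component of the complement of the inner drawing. Reinsert the removed
bonds there: a path from an inner particle through all boundary particles uses `b` bonds and does
not separate, and each further bond creates at most one component.

The second is `e - e' ≤ 3 b - 6`, the discrete form of the angle sum of a polygon. Every removed
bond is charged to a dart that starts at a boundary particle and does not have the unbounded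
component `Ω` on a chosen side (`BoundaryCycle.card_bonds_le`). Fix six generic directions at mutual
angles of sixty degrees. Each such dart is assigned the direction less than sixty degrees away on
the chosen side. That direction does not point into `Ω`, and the assignment is injective because
bonds at one particle enclose at least sixty degrees. It remains to count pairs of a boundary
particle and a direction not pointing into `Ω`. For opposite directions `d`, `-d`, at least `b + 2`
of the `2 b` pairs do point into `Ω` (`OuterFrame.card_add_two_le`), so at most `3 (b - 2)` of all
pairs do not.

The bound `b + 2` replaces both the notion of interior angle and the Jordan curve theorem. Cut `Ω`
along the vertical slits issuing from the vertices. The number of pieces is at most the number of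
slits, since the slit from an extreme vertex does not disconnect. Conversely, each piece is
determined by the wall below it and by its left end. This bounds the number of pieces from below by
the walls with `Ω` above them, plus the wall at infinity, plus the downward slits. Adding the same
bound for the picture turned upside down gives the claim.

If equality holds, the assignment of directions is onto. Choosing a direction slightly more than
sixty degrees from a given bond then forces an equilateral triangle on every inner side of a bond at
a boundary particle. So all lost faces are triangles, which contribute nothing to the defect, while
surviving faces keep their lengths. -/

namespace HardSphere

/-! ### Components of plane sets and their number after a cut. -/

open Set Filter Topology Metric

/-- The set of connected components of `U`. -/
def comps (U : Set Plane) : Set (Set Plane) := {f | ∃ p ∈ U, f = connectedComponentIn U p}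

theorem comp_mem_comps {U : Set Plane} {p : Plane} (hp : p ∈ U) :
    connectedComponentIn U p ∈ comps U := ⟨p, hp, rfl⟩

theorem isOpen_of_mem_comps {U f : Set Plane} (hU : IsOpen U) (hf : f ∈ comps U) : IsOpen f := by
  obtain ⟨p, -, rfl⟩ := hf
  exact hU.connectedComponentIn

theorem isPreconnected_of_mem_comps {U f : Set Plane} (hf : f ∈ comps U) : IsPreconnected f := by
  obtain ⟨p, -, rfl⟩ := hf
  exact isPreconnected_connectedComponentIn

theorem nonempty_of_mem_comps {U f : Set Plane} (hf : f ∈ comps U) : f.Nonempty := by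
  obtain ⟨p, hp, rfl⟩ := hf
  exact ⟨p, mem_connectedComponentIn hp⟩

theorem subset_of_mem_comps {U f : Set Plane} (hf : f ∈ comps U) : f ⊆ U := by
  obtain ⟨p, -, rfl⟩ := hf
  exact connectedComponentIn_subset _ _

theorem eq_comp_of_mem {U f : Set Plane} (hf : f ∈ comps U) {p : Plane} (hp : p ∈ f) :
    f = connectedComponentIn U p := by
  obtain ⟨q, -, rfl⟩ := hf
  exact connectedComponentIn_eq hp

theorem comps_eq_of_mem {U f g : Set Plane} (hf : f ∈ comps U) (hg : g ∈ comps U) {p : Plane}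
    (hpf : p ∈ f) (hpg : p ∈ g) : f = g := by
  rw [eq_comp_of_mem hf hpf, ← eq_comp_of_mem hg hpg]

theorem subset_comp_of_isPreconnected {U f S : Set Plane} (hf : f ∈ comps U)
    (hS : IsPreconnected S) (hSU : S ⊆ U) (h : (S ∩ f).Nonempty) : S ⊆ f := by
  obtain ⟨p, hpS, hpf⟩ := h
  rw [eq_comp_of_mem hf hpf]
  exact hS.subset_connectedComponentIn hpS hSU

/-- Away from the frontier of `W` the plane is the union of two disjoint open sets, the interior and
the exterior of `W`; a connected set cannot meet both. This carries most of the topological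
arguments below. -/
theorem subset_of_disjoint_frontier {W S : Set Plane} (hS : IsPreconnected S)
    (h : (S ∩ W).Nonempty) (hd : Disjoint S (frontier W)) : S ⊆ W := by
  intro p hp
  by_contra hpW
  have hcov : S ⊆ interior W ∪ (closure W)ᶜ := by
    intro q hq
    by_cases hqi : q ∈ interior W
    · exact Or.inl hqi
    · exact Or.inr fun hqc => (Set.disjoint_left.1 hd) hq ⟨hqc, hqi⟩
  obtain ⟨q, hqS, hqW⟩ := h
  obtain ⟨r, -, hr1, hr2⟩ := hS _ _ isOpen_interior isClosed_closure.isOpen_compl hcov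
    ⟨q, hqS, (hcov hqS).resolve_right fun h => h (subset_closure hqW)⟩
    ⟨p, hp, (hcov hp).resolve_left fun h => hpW (interior_subset h)⟩
  exact hr2 (subset_closure (interior_subset hr1))

theorem disjoint_frontier_of_mem_comps {U f : Set Plane} (hU : IsOpen U) (hf : f ∈ comps U) :
    Disjoint (frontier f) U := by
  rw [Set.disjoint_left]
  intro p hp hpU
  have hg := comp_mem_comps hpU
  have hgo := isOpen_of_mem_comps hU hg
  have hpg := mem_connectedComponentIn hpU
  have hfo := isOpen_of_mem_comps hU hf
  rw [hfo.frontier_eq] at hp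
  obtain ⟨q, hqg, hqf⟩ := mem_closure_iff.1 hp.1 _ hgo hpg
  have := comps_eq_of_mem hf hg hqf hqg
  exact hp.2 (this ▸ hpg)

/-- The converse of `disjoint_frontier_of_mem_comps`. It is how a set given in another way, such as
a triangle or a component for a different drawing, is recognised as a component. -/
theorem mem_comps_of_disjoint_frontier {U W : Set Plane} (hW : IsPreconnected W)
    (hne : W.Nonempty) (hWU : W ⊆ U) (hd : Disjoint (frontier W) U) : W ∈ comps U := by
  obtain ⟨p, hp⟩ := hne
  refine ⟨p, hWU hp, Subset.antisymm (hW.subset_connectedComponentIn hp hWU) ?_⟩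
  refine subset_of_disjoint_frontier isPreconnected_connectedComponentIn
    ⟨p, mem_connectedComponentIn (hWU hp), hp⟩ ?_
  exact (hd.mono_right (connectedComponentIn_subset _ _)).symm

theorem mem_comps_of_subset {U U' f : Set Plane} (hf : f ∈ comps U) (h : f ⊆ U') (hU : U' ⊆ U) :
    f ∈ comps U' := by
  obtain ⟨p, hp⟩ := nonempty_of_mem_comps hf
  refine ⟨p, h hp, Subset.antisymm
    ((isPreconnected_of_mem_comps hf).subset_connectedComponentIn hp h) ?_⟩
  rw [eq_comp_of_mem hf hp]
  exact connectedComponentIn_mono _ hU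

theorem comps_of_isPreconnected {U : Set Plane} (hU : IsPreconnected U) : comps U ⊆ {U} := by
  rintro f ⟨p, hp, rfl⟩
  exact hU.connectedComponentIn hp

theorem comps_self {U f : Set Plane} (hf : f ∈ comps U) : comps f = {f} := by
  refine Subset.antisymm (comps_of_isPreconnected (isPreconnected_of_mem_comps hf)) ?_
  rintro _ rfl
  obtain ⟨p, hp⟩ := nonempty_of_mem_comps hf
  exact ⟨p, hp, ((isPreconnected_of_mem_comps hf).connectedComponentIn hp).symm⟩

/-- Removing a connected relatively closed set `σ` whose punctured neighbourhood is covered by two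
connected sets `L` and `R` splits at most one component into at most two. -/
theorem comps_diff_subset {U σ L R : Set Plane} {l r s : Plane}
    (hUσ : IsOpen (U \ σ)) (hσU : σ ⊆ U) (hs : s ∈ σ)
    (hL : IsPreconnected L) (hLU : L ⊆ U \ σ) (hl : l ∈ L)
    (hR : IsPreconnected R) (hRU : R ⊆ U \ σ) (hr : r ∈ R)
    (hnhds : ∀ p ∈ σ, σ ∪ (L ∪ R) ∈ 𝓝 p) :
    comps (U \ σ) ⊆ (comps U \ {connectedComponentIn U s}) ∪
      {connectedComponentIn (U \ σ) l, connectedComponentIn (U \ σ) r} := by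
  intro W hW
  by_cases hWL : W = connectedComponentIn (U \ σ) l
  · right; left; exact hWL
  by_cases hWR : W = connectedComponentIn (U \ σ) r
  · right; right; exact hWR
  left
  have hWo := isOpen_of_mem_comps hUσ hW
  have hWsub := subset_of_mem_comps hW
  have hdL : ∀ q ∈ L, q ∉ W := fun q hq hqW =>
    hWL (eq_comp_of_mem hW (subset_comp_of_isPreconnected hW hL hLU ⟨q, hq, hqW⟩ hl))
  have hdR : ∀ q ∈ R, q ∉ W := fun q hq hqW =>
    hWR (eq_comp_of_mem hW (subset_comp_of_isPreconnected hW hR hRU ⟨q, hq, hqW⟩ hr))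
  -- A piece that avoids `L` and `R` has no frontier point on `σ`, where `σ`, `L` and `R` fill a
  -- neighbourhood. So it is a component of `U` already.
  have hfr := disjoint_frontier_of_mem_comps hUσ hW
  have hfrU : Disjoint (frontier W) U := by
    rw [Set.disjoint_left] at hfr ⊢
    intro p hp hpU
    by_cases hpσ : p ∈ σ
    · have hcl : p ∈ closure W := frontier_subset_closure hp
      obtain ⟨q, hq, hqW⟩ := mem_closure_iff_nhds.1 hcl _ (hnhds p hpσ)
      rcases hq with hq | hq | hq
      · exact (hWsub hqW).2 hq
      · exact hdL q hq hqW
      · exact hdR q hq hqW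
    · exact hfr hp ⟨hpU, hpσ⟩
  refine ⟨mem_comps_of_disjoint_frontier (isPreconnected_of_mem_comps hW)
    (nonempty_of_mem_comps hW) (hWsub.trans sdiff_subset) hfrU, ?_⟩
  rintro rfl
  exact (hWsub (mem_connectedComponentIn (hσU hs))).2 hs

/-- The component containing `σ` is lost and at most two pieces, those of `L` and `R`, replace it.
-/
theorem comps_diff_ncard_le {U σ L R : Set Plane} {l r : Plane}
    (hUσ : IsOpen (U \ σ)) (hσU : σ ⊆ U) (hne : σ.Nonempty)
    (hL : IsPreconnected L) (hLU : L ⊆ U \ σ) (hl : l ∈ L)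
    (hR : IsPreconnected R) (hRU : R ⊆ U \ σ) (hr : r ∈ R)
    (hnhds : ∀ p ∈ σ, σ ∪ (L ∪ R) ∈ 𝓝 p) {n : ℕ} (hf : (comps U).Finite)
    (hn : (comps U).ncard ≤ n) :
    (comps (U \ σ)).Finite ∧ (comps (U \ σ)).ncard ≤ n + 1 := by
  obtain ⟨s, hs⟩ := hne
  have hsub := comps_diff_subset hUσ hσU hs hL hLU hl hR hRU hr hnhds
  have hfin : ((comps U \ {connectedComponentIn U s}) ∪
      {connectedComponentIn (U \ σ) l, connectedComponentIn (U \ σ) r}).Finite :=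
    (hf.subset sdiff_subset).union (by simp)
  refine ⟨hfin.subset hsub, (ncard_le_ncard hsub hfin).trans ((ncard_union_le _ _).trans ?_)⟩
  have h1 := ncard_sdiff_singleton_add_one (comp_mem_comps (hσU hs)) hf
  have h3 : ({connectedComponentIn (U \ σ) l, connectedComponentIn (U \ σ) r} :
    Set (Set Plane)).ncard ≤ 2 := by
    refine (ncard_insert_le _ _).trans ?_
    simp
  omega

/-- The same exchange with `L = R = N`: one component lost, at most one gained. -/
theorem comps_diff_ncard_le_of_connected {U σ N : Set Plane}
    (hUσ : IsOpen (U \ σ)) (hσU : σ ⊆ U) (hne : σ.Nonempty)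
    (hN : IsPreconnected N) (hNU : N ⊆ U \ σ) (hNne : N.Nonempty)
    (hnhds : ∀ p ∈ σ, σ ∪ N ∈ 𝓝 p) {n : ℕ} (hf : (comps U).Finite)
    (hn : (comps U).ncard ≤ n) :
    (comps (U \ σ)).Finite ∧ (comps (U \ σ)).ncard ≤ n := by
  obtain ⟨s, hs⟩ := hne
  obtain ⟨l, hl⟩ := hNne
  have hsub := comps_diff_subset hUσ hσU hs hN hNU hl hN hNU hl (by simpa using hnhds)
  have hfin : ((comps U \ {connectedComponentIn U s}) ∪
      {connectedComponentIn (U \ σ) l, connectedComponentIn (U \ σ) l}).Finite :=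
    (hf.subset sdiff_subset).union (by simp)
  refine ⟨hfin.subset hsub, (ncard_le_ncard hsub hfin).trans ((ncard_union_le _ _).trans ?_)⟩
  have h1 := ncard_sdiff_singleton_add_one (comp_mem_comps (hσU hs)) hf
  rw [pair_eq_singleton, ncard_singleton]
  omega

end HardSphere

/-! ### Vector algebra in the plane and the two sides of a line interval. -/

namespace HardSphere

open Set Filter Topology Metric

/-- The cross product of two plane vectors. -/
def cr (a b : Plane) : ℝ := a 0 * b 1 - a 1 * b 0

/-- The dot product of two plane vectors. -/
def dt (a b : Plane) : ℝ := a 0 * b 0 + a 1 * b 1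

/-- Rotation by a right angle. -/
def pp (a : Plane) : Plane := !₂[-a 1, a 0]

@[simp] theorem pp_apply_zero (a : Plane) : pp a 0 = -a 1 := rfl
@[simp] theorem pp_apply_one (a : Plane) : pp a 1 = a 0 := rfl

theorem plane_ext {a b : Plane} (h0 : a 0 = b 0) (h1 : a 1 = b 1) : a = b := by
  ext i
  fin_cases i
  · exact h0
  · exact h1

theorem norm_sq_eq_dt (a : Plane) : ‖a‖ ^ 2 = dt a a := by
  rw [EuclideanSpace.norm_sq_eq, Fin.sum_univ_two]
  simp [dt, sq]

theorem norm_eq_one_iff {a : Plane} : ‖a‖ = 1 ↔ dt a a = 1 := by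
  rw [← norm_sq_eq_dt]
  constructor
  · intro h; rw [h]; norm_num
  · intro h
    have := norm_nonneg a
    nlinarith

theorem one_le_norm_iff {a : Plane} : 1 ≤ ‖a‖ ↔ 1 ≤ dt a a := by
  rw [← norm_sq_eq_dt]
  have := norm_nonneg a
  constructor <;> intro h <;> nlinarith

theorem cr_add_right (a b c : Plane) : cr a (b + c) = cr a b + cr a c := by simp [cr]; ring
theorem cr_sub_right (a b c : Plane) : cr a (b - c) = cr a b - cr a c := by simp [cr]; ring
theorem cr_smul_right (a : Plane) (t : ℝ) (b : Plane) : cr a (t • b) = t * cr a b := by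
  simp [cr]; ring
theorem cr_neg_right (a b : Plane) : cr a (-b) = -cr a b := by simp [cr]; ring
theorem cr_neg_left (a b : Plane) : cr (-a) b = -cr a b := by simp [cr]; ring
@[simp] theorem cr_self (a : Plane) : cr a a = 0 := by simp [cr]; ring
@[simp] theorem cr_zero_right (a : Plane) : cr a 0 = 0 := by simp [cr]
theorem cr_comm (a b : Plane) : cr a b = -cr b a := by simp [cr]; ring
theorem dt_add_right (a b c : Plane) : dt a (b + c) = dt a b + dt a c := by simp [dt]; ring
theorem dt_sub_right (a b c : Plane) : dt a (b - c) = dt a b - dt a c := by simp [dt]; ring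
theorem dt_smul_right (a : Plane) (t : ℝ) (b : Plane) : dt a (t • b) = t * dt a b := by
  simp [dt]; ring
theorem dt_neg_right (a b : Plane) : dt a (-b) = -dt a b := by simp [dt]; ring
theorem dt_neg_left (a b : Plane) : dt (-a) b = -dt a b := by simp [dt]; ring
@[simp] theorem dt_zero_right (a : Plane) : dt a 0 = 0 := by simp [dt]
theorem dt_comm (a b : Plane) : dt a b = dt b a := by simp [dt]; ring
@[simp] theorem dt_pp (a : Plane) : dt a (pp a) = 0 := by simp [dt]; ring
@[simp] theorem cr_pp (a : Plane) : cr a (pp a) = dt a a := by simp [dt, cr]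

theorem norm_pp (a : Plane) : ‖pp a‖ = ‖a‖ := by
  have h : ‖pp a‖ ^ 2 = ‖a‖ ^ 2 := by
    rw [norm_sq_eq_dt, norm_sq_eq_dt]; simp [dt]; ring
  exact (sq_eq_sq₀ (norm_nonneg _) (norm_nonneg _)).1 h

@[fun_prop] theorem continuous_cr (a : Plane) : Continuous (cr a) := by
  unfold cr; fun_prop

@[fun_prop] theorem continuous_dt (a : Plane) : Continuous (dt a) := by
  unfold dt; fun_prop

theorem isLinearMap_cr (a : Plane) : IsLinearMap ℝ (cr a) :=
  ⟨cr_add_right a, fun t b => by rw [cr_smul_right, smul_eq_mul]⟩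

theorem isLinearMap_dt (a : Plane) : IsLinearMap ℝ (dt a) :=
  ⟨dt_add_right a, fun t b => by rw [dt_smul_right, smul_eq_mul]⟩

theorem decomp {u : Plane} (hu : ‖u‖ = 1) (w : Plane) : w = dt u w • u + cr u w • pp u := by
  rw [norm_eq_one_iff] at hu
  simp only [dt] at hu
  apply plane_ext
  · simp [dt, cr]; linear_combination -(w 0) * hu
  · simp [dt, cr]; linear_combination -(w 1) * hu

theorem eq_of_cr_eq_zero {u : Plane} (hu : ‖u‖ = 1) {w : Plane} (h : cr u w = 0) :
    w = dt u w • u := by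
  conv_lhs => rw [decomp hu w, h]
  simp

/-- The points `x + t u` with `t ∈ I`. -/
def lineSet (x u : Plane) (I : Set ℝ) : Set Plane := (fun t : ℝ => x + t • u) '' I

/-- The points of `U` close to the points `x + t u`, `t ∈ I`, on the side of the line given by the
sign `c`. -/
def sleeve (U : Set Plane) (x u : Plane) (c : ℝ) (I : Set ℝ) : Set Plane :=
  {p | dt u (p - x) ∈ I ∧ 0 < c * cr u (p - x) ∧
    c * cr u (p - x) < infDist (x + dt u (p - x) • u) Uᶜ}

theorem mem_lineSet_iff {x u : Plane} (hu : ‖u‖ = 1) {I : Set ℝ} {p : Plane} :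
    p ∈ lineSet x u I ↔ dt u (p - x) ∈ I ∧ cr u (p - x) = 0 := by
  constructor
  · rintro ⟨t, ht, rfl⟩
    have : dt u u = 1 := norm_eq_one_iff.1 hu
    simp [dt_smul_right, cr_smul_right, this, ht]
  · rintro ⟨h1, h2⟩
    refine ⟨_, h1, ?_⟩
    have := eq_of_cr_eq_zero hu h2
    simp only
    rw [← this]; abel

theorem isPreconnected_lineSet {x u : Plane} {I : Set ℝ} (hI : IsPreconnected I) :
    IsPreconnected (lineSet x u I) :=
  hI.image _ (by fun_prop)

theorem infDist_pos_of_mem {U : Set Plane} (hU : IsOpen U) (hne : Uᶜ.Nonempty) {p : Plane}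
    (hp : p ∈ U) : 0 < infDist p Uᶜ := by
  have := (hU.isClosed_compl.notMem_iff_infDist_pos hne (x := p)).1 (by simpa using hp)
  exact this

/-- The height of `p` over the line is smaller than the distance of its foot to the complement of
`U`, so `p` lies in a ball about the foot that is contained in `U`. -/
theorem sleeve_subset {U : Set Plane} {x u : Plane} (hu : ‖u‖ = 1) {c : ℝ} (hc : |c| = 1)
    {I : Set ℝ} : sleeve U x u c I ⊆ U := by
  rintro p ⟨-, h2, h3⟩
  by_contra hp
  have hd : dist (x + dt u (p - x) • u) p < infDist (x + dt u (p - x) • u) Uᶜ := by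
    refine lt_of_eq_of_lt ?_ h3
    have h := decomp hu (p - x)
    rw [dist_comm, dist_eq_norm]
    have h4 : p - (x + dt u (p - x) • u) = cr u (p - x) • pp u := by
      rw [← sub_sub]; conv_lhs => rw [h]
      simp [dt_add_right, dt_smul_right, norm_eq_one_iff.1 hu]
    rw [h4, norm_smul, norm_pp, hu, mul_one, Real.norm_eq_abs, ← abs_of_pos h2, abs_mul, hc,
      one_mul]
  exact notMem_of_dist_lt_infDist hd hp

theorem sleeve_disjoint_lineSet {U : Set Plane} {x u : Plane} (hu : ‖u‖ = 1) {c : ℝ}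
    {I J : Set ℝ} : Disjoint (sleeve U x u c I) (lineSet x u J) := by
  rw [Set.disjoint_left]
  rintro p ⟨-, h2, -⟩ hp
  rw [((mem_lineSet_iff hu).1 hp).2] at h2
  simp at h2

theorem mem_sleeve_of_coord {U : Set Plane} {x u : Plane} (hu : ‖u‖ = 1) {c : ℝ} (hc : |c| = 1)
    {I : Set ℝ} {t s : ℝ} (ht : t ∈ I) (hs : 0 < s) (hs' : s < infDist (x + t • u) Uᶜ) :
    x + t • u + (c * s) • pp u ∈ sleeve U x u c I := by
  have h1 : dt u u = 1 := norm_eq_one_iff.1 hu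
  have hcc : c * c = 1 := by rw [← abs_mul_abs_self, hc]; norm_num
  have e1 : x + t • u + (c * s) • pp u - x = t • u + (c * s) • pp u := by abel
  have e2 : dt u (x + t • u + (c * s) • pp u - x) = t := by
    rw [e1]; simp [dt_add_right, dt_smul_right, h1]
  have e3 : c * cr u (x + t • u + (c * s) • pp u - x) = s := by
    rw [e1]; simp [cr_add_right, cr_smul_right, h1, ← mul_assoc, hcc]
  refine ⟨?_, ?_, ?_⟩
  · rw [e2]; exact ht
  · rw [e3]; exact hs
  · rw [e3, e2]; exact hs'

/-- Measuring heights as fractions of the distance of the foot to the complement presents the sleeve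
as a continuous image of `I ×ˢ Ioo 0 1`. -/
theorem isPreconnected_sleeve {U : Set Plane} (hU : IsOpen U) (hne : Uᶜ.Nonempty) {x u : Plane}
    (hu : ‖u‖ = 1) {c : ℝ} (hc : |c| = 1) {I : Set ℝ} (hI : IsPreconnected I)
    (hσ : lineSet x u I ⊆ U) : IsPreconnected (sleeve U x u c I) := by
  have hpc : IsPreconnected (I ×ˢ Ioo (0 : ℝ) 1) := hI.prod isPreconnected_Ioo
  have hcc : c * c = 1 := by rw [← abs_mul_abs_self, hc]; norm_num
  have himg := hpc.image (fun q : ℝ × ℝ =>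
    x + q.1 • u + (c * (q.2 * infDist (x + q.1 • u) Uᶜ)) • pp u) (by
      have : Continuous fun q : ℝ × ℝ => infDist (x + q.1 • u) Uᶜ :=
        (continuous_infDist_pt _).comp (by fun_prop)
      fun_prop)
  convert himg using 1
  ext p
  constructor
  · rintro ⟨h1, h2, h3⟩
    have hpos : 0 < infDist (x + dt u (p - x) • u) Uᶜ := h2.trans h3
    refine ⟨(dt u (p - x), c * cr u (p - x) / infDist (x + dt u (p - x) • u) Uᶜ),
      ⟨h1, div_pos h2 hpos, (div_lt_one hpos).2 h3⟩, ?_⟩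
    simp only
    rw [div_mul_cancel₀ _ hpos.ne', ← mul_assoc, hcc, one_mul, add_assoc, ← decomp hu]
    abel
  · rintro ⟨⟨t, s⟩, ⟨ht, hs0, hs1⟩, rfl⟩
    have hpos := infDist_pos_of_mem hU hne (hσ ⟨t, ht, rfl⟩)
    simp only at ht hs0 hs1 hpos ⊢
    exact mem_sleeve_of_coord hu hc ht (by positivity) (by nlinarith)

/-- The sign of the cross product splits an open tube around the interval into the interval and its
two sleeves. -/
theorem lineSet_union_sleeve_mem_nhds {U : Set Plane} (hU : IsOpen U) (hne : Uᶜ.Nonempty)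
    {x u : Plane} (hu : ‖u‖ = 1) {I : Set ℝ} (hI : IsOpen I) {p : Plane}
    (hσ : lineSet x u I ⊆ U) (hp : p ∈ lineSet x u I) :
    lineSet x u I ∪ (sleeve U x u 1 I ∪ sleeve U x u (-1) I) ∈ 𝓝 p := by
  have hcont : Continuous fun p : Plane => infDist (x + dt u (p - x) • u) Uᶜ :=
    (continuous_infDist_pt _).comp (by fun_prop)
  have hO : IsOpen {p : Plane | dt u (p - x) ∈ I ∧
      |cr u (p - x)| < infDist (x + dt u (p - x) • u) Uᶜ} :=
    (hI.preimage (by fun_prop : Continuous fun p : Plane => dt u (p - x))).inter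
      (isOpen_lt (by fun_prop) hcont)
  have hpm := (mem_lineSet_iff hu).1 hp
  refine mem_of_superset (hO.mem_nhds ⟨hpm.1, ?_⟩) ?_
  · rw [hpm.2, abs_zero]
    exact infDist_pos_of_mem hU hne (hσ ⟨_, hpm.1, rfl⟩)
  · rintro q ⟨hq1, hq2⟩
    rcases lt_trichotomy (cr u (q - x)) 0 with h | h | h
    · right; right
      exact ⟨hq1, by linarith, by rw [abs_of_neg h] at hq2; linarith⟩
    · left; exact (mem_lineSet_iff hu).2 ⟨hq1, h⟩
    · right; left
      exact ⟨hq1, by linarith, by rw [abs_of_pos h] at hq2; linarith⟩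

theorem eventually_mem_sleeve {U : Set Plane} (hU : IsOpen U) (hne : Uᶜ.Nonempty)
    {x u : Plane} (hu : ‖u‖ = 1) {I : Set ℝ} (hI : IsOpen I) {p w : Plane}
    (hσ : lineSet x u I ⊆ U) (hp : p ∈ lineSet x u I) {c : ℝ} (hc : c = 1 ∨ c = -1)
    (hw : 0 < c * cr u w) : ∀ᶠ t : ℝ in 𝓝[>] 0, p + t • w ∈ sleeve U x u c I := by
  have hlim : Tendsto (fun t : ℝ => p + t • w) (𝓝[>] 0) (𝓝 p) := by
    have : Tendsto (fun t : ℝ => p + t • w) (𝓝 0) (𝓝 (p + (0 : ℝ) • w)) :=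
      Continuous.tendsto (by fun_prop) 0
    simp only [zero_smul, add_zero] at this
    exact this.mono_left nhdsWithin_le_nhds
  have hpm := (mem_lineSet_iff hu).1 hp
  filter_upwards [hlim (lineSet_union_sleeve_mem_nhds hU hne hu hI hσ hp), self_mem_nhdsWithin]
    with t ht ht0
  have ht0 : 0 < t := ht0
  have key : cr u (p + t • w - x) = t * cr u w := by
    rw [add_sub_right_comm, cr_add_right, hpm.2, cr_smul_right, zero_add]
  have hpos : 0 < c * cr u (p + t • w - x) := by
    rw [key, mul_left_comm]; positivity
  rcases ht with ht | ht | ht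
  · rw [((mem_lineSet_iff hu).1 ht).2] at hpos; simp at hpos
  · rcases hc with rfl | rfl
    · exact ht
    · have := ht.2.1; linarith
  · rcases hc with rfl | rfl
    · have := ht.2.1; linarith
    · exact ht

theorem sleeve_nonempty {U : Set Plane} (hU : IsOpen U) (hne : Uᶜ.Nonempty)
    {x u : Plane} (hu : ‖u‖ = 1) {I : Set ℝ} (hIne : I.Nonempty)
    (hσ : lineSet x u I ⊆ U) {c : ℝ} (hc : |c| = 1) :
    (sleeve U x u c I).Nonempty := by
  obtain ⟨t, ht⟩ := hIne
  have hpos := infDist_pos_of_mem hU hne (hσ ⟨t, ht, rfl⟩)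
  exact ⟨_, mem_sleeve_of_coord hu hc ht (half_pos hpos) (half_lt_self hpos)⟩

/-- Cutting an open set along a relatively closed open line interval creates at most one new
component. -/
theorem comps_diff_lineSet_ncard_le {U : Set Plane} (hU : IsOpen U) (hne : Uᶜ.Nonempty)
    {x u : Plane} (hu : ‖u‖ = 1) {I : Set ℝ} (hI : IsOpen I) (hIne : I.Nonempty)
    (hIc : IsPreconnected I) (hσ : lineSet x u I ⊆ U) (hUσ : IsOpen (U \ lineSet x u I)) {n : ℕ}
    (hf : (comps U).Finite) (hn : (comps U).ncard ≤ n) :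
    (comps (U \ lineSet x u I)).Finite ∧ (comps (U \ lineSet x u I)).ncard ≤ n + 1 := by
  obtain ⟨l, hl⟩ := sleeve_nonempty hU hne hu hIne hσ (c := 1) (by simp)
  obtain ⟨r, hr⟩ := sleeve_nonempty hU hne hu hIne hσ (c := -1) (by simp)
  exact comps_diff_ncard_le hUσ hσ (hIne.image _)
    (isPreconnected_sleeve hU hne hu (by simp) hIc hσ)
    (subset_sdiff.2 ⟨sleeve_subset hu (by simp), sleeve_disjoint_lineSet hu⟩) hl
    (isPreconnected_sleeve hU hne hu (by simp) hIc hσ)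
    (subset_sdiff.2 ⟨sleeve_subset hu (by simp), sleeve_disjoint_lineSet hu⟩) hr
    (fun p hp => lineSet_union_sleeve_mem_nhds hU hne hu hI hσ hp) hf hn

end HardSphere

/-! ### Cuts that do not separate, and the region near infinity. -/

namespace HardSphere

open Set Filter Topology Metric

theorem convex_lt_cr (u x : Plane) : Convex ℝ {p | 0 < cr u (p - x)} := by
  simp only [cr_sub_right, sub_pos]
  exact convex_halfSpace_gt (isLinearMap_cr u) _

theorem convex_cr_lt (u x : Plane) : Convex ℝ {p | cr u (p - x) < 0} := by
  simp only [cr_sub_right, sub_neg]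
  exact convex_halfSpace_lt (isLinearMap_cr u) _

theorem convex_lt_dt (u x : Plane) : Convex ℝ {p | 0 < dt u (p - x)} := by
  simp only [dt_sub_right, sub_pos]
  exact convex_halfSpace_gt (isLinearMap_dt u) _

theorem convex_dt_lt (u x : Plane) : Convex ℝ {p | dt u (p - x) < 0} := by
  simp only [dt_sub_right, sub_neg]
  exact convex_halfSpace_lt (isLinearMap_dt u) _

theorem lineSet_Icc_eq_segment (x y : Plane) : lineSet x (y - x) (Icc 0 1) = segment ℝ x y :=
  (segment_eq_image' ℝ x y).symm

theorem lineSet_Ioo_eq_openSegment (x y : Plane) :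
    lineSet x (y - x) (Ioo 0 1) = openSegment ℝ x y :=
  (openSegment_eq_image' ℝ x y).symm

theorem lineSet_mono {x u : Plane} {I J : Set ℝ} (h : I ⊆ J) : lineSet x u I ⊆ lineSet x u J :=
  image_mono h

theorem segment_eq_insert_Ioc (x y : Plane) :
    segment ℝ x y = insert x (lineSet x (y - x) (Ioc 0 1)) := by
  rw [← lineSet_Icc_eq_segment, ← Ioc_insert_left (zero_le_one' ℝ), lineSet, image_insert_eq]
  simp [lineSet]

theorem Ioc_eq_insert_openSegment (x y : Plane) :
    lineSet x (y - x) (Ioc 0 1) = insert y (openSegment ℝ x y) := by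
  rw [← lineSet_Ioo_eq_openSegment, ← Ioo_insert_right (zero_lt_one' ℝ), lineSet, image_insert_eq]
  simp [lineSet]

theorem isClosed_segment (x y : Plane) : IsClosed (segment ℝ x y) := by
  rw [← lineSet_Icc_eq_segment]
  exact (isCompact_Icc.image (by fun_prop)).isClosed

theorem isCompact_segment (x y : Plane) : IsCompact (segment ℝ x y) := by
  rw [← lineSet_Icc_eq_segment]
  exact isCompact_Icc.image (by fun_prop)

/-- The half-open segment fails to be closed only at `x`, which is not in `U`. -/
theorem isOpen_diff_Ioc {U : Set Plane} (hU : IsOpen U) {x y : Plane} (hx : x ∉ U) :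
    IsOpen (U \ lineSet x (y - x) (Ioc 0 1)) := by
  have : U \ lineSet x (y - x) (Ioc 0 1) = U \ segment ℝ x y := by
    rw [segment_eq_insert_Ioc]
    ext p
    simp only [Set.mem_sdiff, Set.mem_insert_iff, not_or]
    refine and_congr_right fun hp => ⟨fun h => ⟨?_, h⟩, fun h => h.2⟩
    rintro rfl
    exact hx hp
  rw [this]
  exact hU.sdiff (isClosed_segment x y)

/-- Removing a half-open unit segment whose missing endpoint lies outside the open set creates no
new component. -/
theorem comps_diff_pendant_ncard_le {U : Set Plane} (hU : IsOpen U) {x y : Plane} (hx : x ∉ U)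
    (hxy : ‖y - x‖ = 1) (hσ : lineSet x (y - x) (Ioc 0 1) ⊆ U) {n : ℕ}
    (hf : (comps U).Finite) (hn : (comps U).ncard ≤ n) :
    (comps (U \ lineSet x (y - x) (Ioc 0 1))).Finite ∧
      (comps (U \ lineSet x (y - x) (Ioc 0 1))).ncard ≤ n := by
  set u := y - x with hu
  have hne : Uᶜ.Nonempty := ⟨x, hx⟩
  have huu : dt u u = 1 := norm_eq_one_iff.1 hxy
  have hσo : lineSet x u (Ioo 0 1) ⊆ U := (lineSet_mono Ioo_subset_Ioc_self).trans hσ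
  have hyσ : y ∈ lineSet x u (Ioc 0 1) := ⟨1, by simp, by simp [hu]⟩
  have hyU : y ∈ U := hσ hyσ
  obtain ⟨r, hr0, hr⟩ : ∃ r > 0, ball y r ⊆ U := Metric.isOpen_iff.1 hU y hyU
  obtain ⟨r, hr0, hr1, hr⟩ : ∃ r > 0, r ≤ 1 ∧ ball y r ⊆ U :=
    ⟨min r 1, lt_min hr0 one_pos, min_le_right _ _, (ball_subset_ball (min_le_left _ _)).trans hr⟩
  -- Three half discs lead around the free end `y`, so that the left sleeve, the half discs and the
  -- right sleeve form one connected set.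
  set B1 := ball y r ∩ {p | 0 < cr u (p - y)}
  set B2 := ball y r ∩ {p | 0 < dt u (p - y)}
  set B3 := ball y r ∩ {p | cr u (p - y) < 0}
  set L := sleeve U x u 1 (Ioo 0 1)
  set R := sleeve U x u (-1) (Ioo 0 1)
  have hL : IsPreconnected L := isPreconnected_sleeve hU hne hxy (by simp) isPreconnected_Ioo hσo
  have hR : IsPreconnected R := isPreconnected_sleeve hU hne hxy (by simp) isPreconnected_Ioo hσo
  have hB1 : IsPreconnected B1 := ((convex_ball y r).inter (convex_lt_cr u y)).isPreconnected
  have hB2 : IsPreconnected B2 := ((convex_ball y r).inter (convex_lt_dt u y)).isPreconnected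
  have hB3 : IsPreconnected B3 := ((convex_ball y r).inter (convex_cr_lt u y)).isPreconnected
  have hppn : ‖pp u‖ = 1 := by rw [norm_pp, hxy]
  have hball : ∀ a b : ℝ, |a| ≤ r / 3 → |b| ≤ r / 3 → y + a • u + b • pp u ∈ ball y r := by
    intro a b ha hb
    rw [mem_ball, dist_eq_norm, add_assoc, add_sub_cancel_left]
    refine (norm_add_le _ _).trans_lt ?_
    rw [norm_smul, norm_smul, hxy, hppn, mul_one, mul_one, Real.norm_eq_abs, Real.norm_eq_abs]
    linarith
  have hcr : ∀ a b : ℝ, cr u (y + a • u + b • pp u - y) = b := by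
    intro a b
    rw [add_assoc, add_sub_cancel_left]; simp [cr_add_right, cr_smul_right, huu]
  have hdt : ∀ a b : ℝ, dt u (y + a • u + b • pp u - y) = a := by
    intro a b
    rw [add_assoc, add_sub_cancel_left]; simp [dt_add_right, dt_smul_right, huu]
  have hr3 : |r / 3| ≤ r / 3 := (abs_of_pos (by positivity)).le
  have hr3' : |-(r / 3)| ≤ r / 3 := by rw [abs_neg]; exact hr3
  have h12 : (B1 ∩ B2).Nonempty :=
    ⟨y + (r / 3) • u + (r / 3) • pp u, ⟨hball _ _ hr3 hr3, by
      simp only [mem_ofPred_eq]; rw [hcr]; positivity⟩, ⟨hball _ _ hr3 hr3, by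
      simp only [mem_ofPred_eq]; rw [hdt]; positivity⟩⟩
  have h23 : (B2 ∩ B3).Nonempty :=
    ⟨y + (r / 3) • u + (-(r / 3)) • pp u, ⟨hball _ _ hr3 hr3', by
      simp only [mem_ofPred_eq]; rw [hdt]; positivity⟩, ⟨hball _ _ hr3 hr3', by
      simp only [mem_ofPred_eq]; rw [hcr]; linarith⟩⟩
  have hz : x + (1 - r / 3) • u = y + (-(r / 3)) • u := by
    rw [sub_smul, one_smul, neg_smul, hu]; abel
  have hzm : (1 - r / 3) ∈ Ioo (0 : ℝ) 1 := ⟨by linarith, by linarith⟩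
  have hpos := infDist_pos_of_mem hU hne (hσo ⟨_, hzm, rfl⟩)
  simp only at hpos
  -- A height small enough for the point over `y - (r / 3) • u` to lie both in the disc and in the
  -- sleeve.
  set δ := min (r / 3) (infDist (x + (1 - r / 3) • u) Uᶜ / 2) with hδ
  have hδ0 : 0 < δ := lt_min (by positivity) (by positivity)
  have hδr : δ ≤ r / 3 := min_le_left _ _
  have hδi : δ < infDist (x + (1 - r / 3) • u) Uᶜ :=
    (min_le_right _ _).trans_lt (half_lt_self hpos)
  have hL1 : (L ∩ B1).Nonempty := by
    refine ⟨y + (-(r / 3)) • u + (1 * δ) • pp u, ?_,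
      hball _ _ hr3' (by rw [one_mul, abs_of_pos hδ0]; exact hδr), ?_⟩
    · rw [← hz]; exact mem_sleeve_of_coord hxy (by simp) hzm hδ0 hδi
    · simp only [mem_ofPred_eq]; rw [hcr, one_mul]; exact hδ0
  have h3R : (B3 ∩ R).Nonempty := by
    refine ⟨y + (-(r / 3)) • u + (-1 * δ) • pp u,
      ⟨hball _ _ hr3' (by rw [neg_one_mul, abs_neg, abs_of_pos hδ0]; exact hδr), ?_⟩, ?_⟩
    · simp only [mem_ofPred_eq]; rw [hcr]; linarith
    · rw [← hz]; exact mem_sleeve_of_coord hxy (by simp) hzm hδ0 hδi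
  have hN : IsPreconnected (L ∪ B1 ∪ B2 ∪ B3 ∪ R) := by
    obtain ⟨p1, hp1⟩ := hL1
    obtain ⟨p2, hp2⟩ := h12
    obtain ⟨p3, hp3⟩ := h23
    obtain ⟨p4, hp4⟩ := h3R
    refine IsPreconnected.union p4 (Or.inr hp4.1) hp4.2 ?_ hR
    refine IsPreconnected.union p3 (Or.inr hp3.1) hp3.2 ?_ hB3
    refine IsPreconnected.union p2 (Or.inr hp2.1) hp2.2 ?_ hB2
    exact IsPreconnected.union p1 hp1.1 hp1.2 hL hB1
  have hyx : ∀ p : Plane, p - x = (p - y) + u := fun p => by rw [hu]; abel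
  have hcry : ∀ p, cr u (p - x) = cr u (p - y) := fun p => by
    rw [hyx, cr_add_right, cr_self, add_zero]
  have hdty : ∀ p, dt u (p - x) = dt u (p - y) + 1 := fun p => by
    rw [hyx, dt_add_right, huu]
  have hdis : ∀ p, cr u (p - y) ≠ 0 ∨ 0 < dt u (p - y) → p ∉ lineSet x u (Ioc 0 1) := by
    intro p hp h
    obtain ⟨h1, h2⟩ := (mem_lineSet_iff hxy).1 h
    rw [hcry] at h2
    rw [hdty] at h1
    rcases hp with hp | hp
    · exact hp h2
    · linarith [h1.2]
  refine comps_diff_ncard_le_of_connected (N := L ∪ B1 ∪ B2 ∪ B3 ∪ R) (isOpen_diff_Ioc hU hx) hσ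
    ⟨y, hyσ⟩ hN ?_ (hL1.mono (by intro p hp; exact Or.inl (Or.inl (Or.inl (Or.inl hp.1))))) ?_ hf hn
  · rintro p ((((hp | hp) | hp) | hp) | hp)
    · exact ⟨sleeve_subset hxy (by simp) hp,
        fun h => Set.disjoint_left.1 (sleeve_disjoint_lineSet hxy) hp h⟩
    · exact ⟨hr hp.1, hdis p (Or.inl hp.2.ne')⟩
    · exact ⟨hr hp.1, hdis p (Or.inr hp.2)⟩
    · exact ⟨hr hp.1, hdis p (Or.inl (ne_of_lt hp.2))⟩
    · exact ⟨sleeve_subset hxy (by simp) hp,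
        fun h => Set.disjoint_left.1 (sleeve_disjoint_lineSet hxy) hp h⟩
  · rintro p ⟨t, ht, rfl⟩
    rcases eq_or_lt_of_le ht.2 with h1 | h1
    · subst h1
      have hy1 : x + (1 : ℝ) • u = y := by rw [one_smul, hu]; abel
      have hgoal : (fun t : ℝ => x + t • u) 1 = y := hy1
      rw [hgoal]
      refine mem_of_superset (ball_mem_nhds y hr0) fun q hq => ?_
      rcases lt_trichotomy (cr u (q - y)) 0 with h | h | h
      · right; left; right; exact ⟨hq, h⟩
      · by_cases hd : 0 < dt u (q - y)
        · right; left; left; right; exact ⟨hq, hd⟩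
        · left
          rw [mem_lineSet_iff hxy, hcry, hdty]
          refine ⟨⟨?_, by linarith⟩, h⟩
          have hq' : q - y = dt u (q - y) • u := eq_of_cr_eq_zero hxy h
          have : ‖q - y‖ < r := by rw [← dist_eq_norm]; exact hq
          rw [hq', norm_smul, hxy, mul_one, Real.norm_eq_abs, abs_lt] at this
          linarith [this.1]
      · right; left; left; left; right; exact ⟨hq, h⟩
    · refine mem_of_superset (lineSet_union_sleeve_mem_nhds hU hne hxy isOpen_Ioo hσo
        ⟨t, ⟨ht.1, h1⟩, rfl⟩) ?_
      rintro q (hq | hq | hq)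
      · exact Or.inl (lineSet_mono Ioo_subset_Ioc_self hq)
      · exact Or.inr (Or.inl (Or.inl (Or.inl (Or.inl hq))))
      · exact Or.inr (Or.inr hq)

/-- Removing a path of unit segments hanging off the complement creates no new component. -/
theorem comps_diff_path_ncard_le {U : Set Plane} (hU : IsOpen U) {v : ℕ → Plane} (hv : v 0 ∉ U)
    {k : ℕ} (hunit : ∀ i < k, ‖v (i + 1) - v i‖ = 1)
    (hsub : ∀ i < k, lineSet (v i) (v (i + 1) - v i) (Ioc 0 1) ⊆ U)
    (hdis : ∀ i < k, ∀ j < i, Disjoint (lineSet (v i) (v (i + 1) - v i) (Ioc 0 1))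
      (lineSet (v j) (v (j + 1) - v j) (Ioc 0 1))) {n : ℕ}
    (hf : (comps U).Finite) (hn : (comps U).ncard ≤ n) :
    IsOpen (U \ ⋃ i < k, lineSet (v i) (v (i + 1) - v i) (Ioc 0 1)) ∧
    (comps (U \ ⋃ i < k, lineSet (v i) (v (i + 1) - v i) (Ioc 0 1))).Finite ∧
    (comps (U \ ⋃ i < k, lineSet (v i) (v (i + 1) - v i) (Ioc 0 1))).ncard ≤ n := by
  induction k with
  | zero => simpa using ⟨hU, hf, hn⟩
  | succ k ih =>
    obtain ⟨h1, h2, h3⟩ := ih (fun i hi => hunit i (by omega)) (fun i hi => hsub i (by omega))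
      (fun i hi => hdis i (by omega))
    have heq : (U \ ⋃ i < k + 1, lineSet (v i) (v (i + 1) - v i) (Ioc 0 1)) =
        (U \ ⋃ i < k, lineSet (v i) (v (i + 1) - v i) (Ioc 0 1)) \
          lineSet (v k) (v (k + 1) - v k) (Ioc 0 1) := by
      rw [Set.biUnion_lt_succ, sdiff_sdiff]
    rw [heq]
    -- The next segment hangs off the part already removed: `v k` is the end of the previous
    -- half-open segment, or `v 0` itself.
    have hk : v k ∉ U \ ⋃ i < k, lineSet (v i) (v (i + 1) - v i) (Ioc 0 1) := by
      rintro ⟨hkU, hk⟩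
      rcases Nat.eq_zero_or_pos k with rfl | hk0
      · exact hv hkU
      · refine hk (mem_iUnion₂.2 ⟨k - 1, by omega, 1, by simp, ?_⟩)
        simp only [one_smul, Nat.sub_add_cancel hk0]
        exact add_sub_cancel _ _
    refine ⟨isOpen_diff_Ioc h1 hk, comps_diff_pendant_ncard_le h1 hk (hunit k (by omega))
      (subset_sdiff.2 ⟨hsub k (by omega), ?_⟩) h2 h3⟩
    rw [disjoint_iUnion₂_right]
    exact fun j hj => hdis k (by omega) j hj

/-- Four half discs, each of which meets the next one, cover the punctured disc. -/
theorem isPreconnected_ball_diff_singleton (x : Plane) {r : ℝ} (hr : 0 < r) :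
    IsPreconnected (ball x r \ {x}) := by
  have e0 : ‖(!₂[1, 0] : Plane)‖ = 1 := norm_eq_one_iff.2 (by simp [dt])
  set e : Plane := !₂[1, 0] with he
  have hee : dt e e = 1 := norm_eq_one_iff.1 e0
  have hball : ∀ a b : ℝ, |a| ≤ r / 3 → |b| ≤ r / 3 → x + a • e + b • pp e ∈ ball x r := by
    intro a b ha hb
    rw [mem_ball, dist_eq_norm, add_assoc, add_sub_cancel_left]
    refine (norm_add_le _ _).trans_lt ?_
    rw [norm_smul, norm_smul, norm_pp, e0, mul_one, mul_one, Real.norm_eq_abs, Real.norm_eq_abs]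
    linarith
  have hcr : ∀ a b : ℝ, cr e (x + a • e + b • pp e - x) = b := by
    intro a b
    rw [add_assoc, add_sub_cancel_left]; simp [cr_add_right, cr_smul_right, hee]
  have hdt : ∀ a b : ℝ, dt e (x + a • e + b • pp e - x) = a := by
    intro a b
    rw [add_assoc, add_sub_cancel_left]; simp [dt_add_right, dt_smul_right, hee]
  have hr3 : |r / 3| ≤ r / 3 := (abs_of_pos (by positivity)).le
  have hr3' : |-(r / 3)| ≤ r / 3 := by rw [abs_neg]; exact hr3
  have h1 := ((convex_ball x r).inter (convex_lt_cr e x)).isPreconnected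
  have h2 := ((convex_ball x r).inter (convex_lt_dt e x)).isPreconnected
  have h3 := ((convex_ball x r).inter (convex_cr_lt e x)).isPreconnected
  have h4 := ((convex_ball x r).inter (convex_dt_lt e x)).isPreconnected
  have m1 : x + (r / 3) • e + (r / 3) • pp e ∈ {p | 0 < cr e (p - x)} := by
    simp only [mem_ofPred_eq]; rw [hcr]; positivity
  have m2 : x + (r / 3) • e + (r / 3) • pp e ∈ {p | 0 < dt e (p - x)} := by
    simp only [mem_ofPred_eq]; rw [hdt]; positivity
  have m2' : x + (r / 3) • e + (-(r / 3)) • pp e ∈ {p | 0 < dt e (p - x)} := by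
    simp only [mem_ofPred_eq]; rw [hdt]; positivity
  have m3 : x + (r / 3) • e + (-(r / 3)) • pp e ∈ {p | cr e (p - x) < 0} := by
    simp only [mem_ofPred_eq]; rw [hcr]; linarith
  have m3' : x + (-(r / 3)) • e + (-(r / 3)) • pp e ∈ {p | cr e (p - x) < 0} := by
    simp only [mem_ofPred_eq]; rw [hcr]; linarith
  have m4 : x + (-(r / 3)) • e + (-(r / 3)) • pp e ∈ {p | dt e (p - x) < 0} := by
    simp only [mem_ofPred_eq]; rw [hdt]; linarith
  have h12 := h1.union _ (mem_inter (hball _ _ hr3 hr3) m1) (mem_inter (hball _ _ hr3 hr3) m2) h2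
  have h123 := h12.union _ (mem_union_right _ (mem_inter (hball _ _ hr3 hr3') m2'))
    (mem_inter (hball _ _ hr3 hr3') m3) h3
  have h1234 := h123.union _ (mem_union_right _ (mem_inter (hball _ _ hr3' hr3') m3'))
    (mem_inter (hball _ _ hr3' hr3') m4) h4
  convert h1234 using 1
  ext p
  simp only [Set.mem_sdiff, Set.mem_union, Set.mem_inter_iff, mem_ofPred_eq, mem_singleton_iff]
  constructor
  · rintro ⟨hp, hpx⟩
    by_contra hcon
    have hc : cr e (p - x) = 0 := le_antisymm (not_lt.1 (by tauto)) (not_lt.1 (by tauto))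
    have hd : dt e (p - x) = 0 := le_antisymm (not_lt.1 (by tauto)) (not_lt.1 (by tauto))
    have := eq_of_cr_eq_zero e0 hc
    rw [hd, zero_smul, sub_eq_zero] at this
    exact hpx this
  · intro h
    refine ⟨by tauto, ?_⟩
    rintro rfl
    simp at h

/-- The exterior of a square is a chain of four half planes. -/
theorem isPreconnected_far (d : Plane) (hd : ‖d‖ = 1) (R : ℝ) :
    IsPreconnected {p : Plane | R < |cr d p| ∨ R < |dt d p|} := by
  have hdd : dt d d = 1 := norm_eq_one_iff.1 hd
  have hcr : ∀ a b : ℝ, cr d (a • d + b • pp d) = b := by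
    intro a b; simp [cr_add_right, cr_smul_right, hdd]
  have hdt : ∀ a b : ℝ, dt d (a • d + b • pp d) = a := by
    intro a b; simp [dt_add_right, dt_smul_right, hdd]
  have h1 := (convex_halfSpace_gt (isLinearMap_cr d) R).isPreconnected
  have h2 := (convex_halfSpace_gt (isLinearMap_dt d) R).isPreconnected
  have h3 := (convex_halfSpace_lt (isLinearMap_cr d) (-R)).isPreconnected
  have h4 := (convex_halfSpace_lt (isLinearMap_dt d) (-R)).isPreconnected
  have h12 := IsPreconnected.union ((R + 1) • d + (R + 1) • pp d)
    (by simp only [mem_ofPred_eq]; rw [hcr]; linarith)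
    (by simp only [mem_ofPred_eq]; rw [hdt]; linarith) h1 h2
  have h123 := IsPreconnected.union ((R + 1) • d + (-R - 1) • pp d)
    (Or.inr (by simp only [mem_ofPred_eq]; rw [hdt]; linarith))
    (by simp only [mem_ofPred_eq]; rw [hcr]; linarith) h12 h3
  have h1234 := IsPreconnected.union ((-R - 1) • d + (-R - 1) • pp d)
    (Or.inr (by simp only [mem_ofPred_eq]; rw [hcr]; linarith))
    (by simp only [mem_ofPred_eq]; rw [hdt]; linarith) h123 h4
  convert h1234 using 1
  ext p
  simp only [Set.mem_union, mem_ofPred_eq, lt_abs]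
  constructor
  · rintro ((h | h) | (h | h))
    · tauto
    · exact Or.inl (Or.inr (by linarith))
    · tauto
    · exact Or.inr (by linarith)
  · rintro (((h | h) | h) | h)
    · tauto
    · tauto
    · exact Or.inl (Or.inr (by linarith))
    · exact Or.inr (Or.inr (by linarith))

theorem abs_cr_le {d : Plane} (hd : ‖d‖ = 1) (p : Plane) : |cr d p| ≤ ‖p‖ := by
  refine abs_le_of_sq_le_sq ?_ (norm_nonneg _)
  have h := norm_eq_one_iff.1 hd
  rw [norm_sq_eq_dt]
  have : dt p p = dt d p ^ 2 + cr d p ^ 2 := by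
    have : dt p p = dt d d * dt p p := by rw [h, one_mul]
    rw [this]; simp only [dt, cr]; ring
  rw [this]; nlinarith [sq_nonneg (dt d p)]

theorem abs_dt_le {d : Plane} (hd : ‖d‖ = 1) (p : Plane) : |dt d p| ≤ ‖p‖ := by
  refine abs_le_of_sq_le_sq ?_ (norm_nonneg _)
  have h := norm_eq_one_iff.1 hd
  rw [norm_sq_eq_dt]
  have : dt p p = dt d p ^ 2 + cr d p ^ 2 := by
    have : dt p p = dt d d * dt p p := by rw [h, one_mul]
    rw [this]; simp only [dt, cr]; ring
  rw [this]; nlinarith [sq_nonneg (cr d p)]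

theorem norm_le_abs_add {d : Plane} (hd : ‖d‖ = 1) (p : Plane) : ‖p‖ ≤ |dt d p| + |cr d p| := by
  conv_lhs => rw [decomp hd p]
  refine (norm_add_le _ _).trans ?_
  rw [norm_smul, norm_smul, norm_pp, hd, mul_one, mul_one, Real.norm_eq_abs, Real.norm_eq_abs]

/-- The exterior of the square is connected and avoids `K`, and an unbounded component has to meet
it. This yields the uniqueness of the unbounded component as well as explicit points in it. -/
theorem far_subset_of_unbounded {K f : Set Plane} {R : ℝ} (hK : ∀ p ∈ K, ‖p‖ ≤ R)
    (hf : f ∈ comps Kᶜ) (hb : ¬ Bornology.IsBounded f) {d : Plane} (hd : ‖d‖ = 1) {p : Plane}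
    (hp : R < |cr d p| ∨ R < |dt d p|) : p ∈ f := by
  refine subset_comp_of_isPreconnected hf (isPreconnected_far d hd R) ?_ ?_ hp
  · intro q hq hqK
    have := hK q hqK
    rcases hq with hq | hq
    · linarith [abs_cr_le hd q]
    · linarith [abs_dt_le hd q]
  · by_contra hcon
    refine hb ?_
    rw [isBounded_iff_forall_norm_le]
    refine ⟨R + R, fun q hq => ?_⟩
    have hq' : ¬ (R < |cr d q| ∨ R < |dt d q|) := fun h => hcon ⟨q, h, hq⟩
    push Not at hq'
    linarith [norm_le_abs_add hd q, hq'.1, hq'.2]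

theorem exists_unit : ∃ d : Plane, ‖d‖ = 1 :=
  ⟨!₂[1, 0], norm_eq_one_iff.2 (by simp [dt])⟩

theorem unbounded_comps_eq {K f g : Set Plane} (hK : Bornology.IsBounded K)
    (hf : f ∈ comps Kᶜ) (hfb : ¬ Bornology.IsBounded f)
    (hg : g ∈ comps Kᶜ) (hgb : ¬ Bornology.IsBounded g) : f = g := by
  obtain ⟨R, hR⟩ := isBounded_iff_forall_norm_le.1 hK
  obtain ⟨d, hd⟩ := exists_unit
  have hp : R < |cr d ((|R| + 1) • pp d)| ∨ R < |dt d ((|R| + 1) • pp d)| := by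
    left
    rw [cr_smul_right, cr_pp, norm_eq_one_iff.1 hd, mul_one, abs_of_pos (by positivity)]
    linarith [le_abs_self R]
  exact comps_eq_of_mem hf hg (far_subset_of_unbounded hR hf hfb hd hp)
    (far_subset_of_unbounded hR hg hgb hd hp)

theorem exists_unbounded_comp {K : Set Plane} (hK : Bornology.IsBounded K) :
    ∃ f ∈ comps Kᶜ, ¬ Bornology.IsBounded f := by
  obtain ⟨R, hR⟩ := isBounded_iff_forall_norm_le.1 hK
  obtain ⟨d, hd⟩ := exists_unit
  have hdd := norm_eq_one_iff.1 hd
  have hsub : {p : Plane | R < |cr d p| ∨ R < |dt d p|} ⊆ Kᶜ := by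
    intro q hq hqK
    have := hR q hqK
    rcases hq with hq | hq
    · linarith [abs_cr_le hd q]
    · linarith [abs_dt_le hd q]
  have hmem : ∀ t : ℝ, |R| < t → t • d ∈ {p : Plane | R < |cr d p| ∨ R < |dt d p|} := by
    intro t ht
    right
    rw [dt_smul_right, hdd, mul_one]
    exact (le_abs_self R).trans_lt (ht.trans_le (le_abs_self t))
  have h1 := hmem (|R| + 1) (by linarith)
  refine ⟨_, comp_mem_comps (hsub h1), fun hb => ?_⟩
  obtain ⟨M, hM⟩ := isBounded_iff_forall_norm_le.1 hb
  have h2 := hmem (|R| + 1 + |M|) (by linarith [abs_nonneg M])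
  have h3 := hM _ ((isPreconnected_far d hd R).subset_connectedComponentIn h1 hsub h2)
  rw [norm_smul, hd, mul_one, Real.norm_eq_abs] at h3
  linarith [le_abs_self (|R| + 1 + |M|), abs_nonneg R, le_abs_self M]

end HardSphere

namespace HardSphere

open Set Filter Topology Metric

/-! ### The two sides of an edge -/

/-- The points close to the open unit segment from `x` to `y`, on its left, where "close" is
measured by the distance to `K`. -/
def edgeSide (K : Set Plane) (x y : Plane) : Set Plane := sleeve Kᶜ x (y - x) 1 (Ioo 0 1)

/-- Reversing an edge exchanges its sides, so ordered pairs of endpoints name both sides by a single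
definition. -/
theorem edgeSide_swap (K : Set Plane) {x y : Plane} (hxy : ‖y - x‖ = 1) :
    edgeSide K y x = sleeve Kᶜ x (y - x) (-1) (Ioo 0 1) := by
  have huu := norm_eq_one_iff.1 hxy
  ext p
  have e1 : dt (x - y) (p - y) = 1 - dt (y - x) (p - x) := by
    have : p - y = (p - x) - (y - x) := by abel
    rw [this, ← neg_sub y x, dt_neg_left, dt_sub_right, huu]; ring
  have e2 : cr (x - y) (p - y) = -cr (y - x) (p - x) := by
    have : p - y = (p - x) - (y - x) := by abel
    rw [this, ← neg_sub y x, cr_neg_left, cr_sub_right, cr_self, sub_zero]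
  have e3 : y + dt (x - y) (p - y) • (x - y) = x + dt (y - x) (p - x) • (y - x) := by
    rw [e1, sub_smul, one_smul, ← neg_sub y x, smul_neg]; abel
  simp only [edgeSide, sleeve, mem_ofPred_eq, e3]
  rw [e1, e2]
  simp only [mem_Ioo, one_mul, mul_neg, neg_mul]
  constructor <;> rintro ⟨⟨h1, h2⟩, h3, h4⟩ <;> exact ⟨⟨by linarith, by linarith⟩, h3, h4⟩

section Edge

variable {K : Set Plane} {x y : Plane}

theorem lineSet_subset_compl (hd : Disjoint (openSegment ℝ x y) K) :
    lineSet x (y - x) (Ioo 0 1) ⊆ Kᶜ := by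
  rw [lineSet_Ioo_eq_openSegment]
  exact hd.subset_compl_right

theorem norm_sub_comm_eq_one (hxy : ‖y - x‖ = 1) : ‖x - y‖ = 1 := by rw [norm_sub_rev, hxy]

theorem isPreconnected_edgeSide (hK : IsClosed K) (hx : K.Nonempty) (hxy : ‖y - x‖ = 1)
    (hd : Disjoint (openSegment ℝ x y) K) : IsPreconnected (edgeSide K x y) :=
  isPreconnected_sleeve hK.isOpen_compl (by rwa [compl_compl]) hxy (by simp) isPreconnected_Ioo
    (lineSet_subset_compl hd)

theorem edgeSide_nonempty (hK : IsClosed K) (hx : K.Nonempty) (hxy : ‖y - x‖ = 1)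
    (hd : Disjoint (openSegment ℝ x y) K) : (edgeSide K x y).Nonempty :=
  sleeve_nonempty hK.isOpen_compl (by rwa [compl_compl]) hxy ⟨1 / 2, by norm_num⟩
    (lineSet_subset_compl hd) (by simp)

theorem edgeSide_subset (hxy : ‖y - x‖ = 1) : edgeSide K x y ⊆ (K ∪ openSegment ℝ x y)ᶜ := by
  rw [compl_union]
  refine subset_inter (sleeve_subset hxy (by simp)) ?_
  rw [← lineSet_Ioo_eq_openSegment]
  exact (sleeve_disjoint_lineSet hxy).subset_compl_right

theorem edgeSide_mem_nhds (hK : IsClosed K) (hx : K.Nonempty) (hxy : ‖y - x‖ = 1)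
    (hd : Disjoint (openSegment ℝ x y) K) {p : Plane} (hp : p ∈ openSegment ℝ x y) :
    openSegment ℝ x y ∪ (edgeSide K x y ∪ edgeSide K y x) ∈ 𝓝 p := by
  rw [edgeSide_swap K hxy, ← lineSet_Ioo_eq_openSegment]
  refine lineSet_union_sleeve_mem_nhds hK.isOpen_compl (by rwa [compl_compl]) hxy isOpen_Ioo
    (lineSet_subset_compl hd) ?_
  rwa [lineSet_Ioo_eq_openSegment]

theorem eventually_mem_edgeSide (hK : IsClosed K) (hx : K.Nonempty) (hxy : ‖y - x‖ = 1)
    (hd : Disjoint (openSegment ℝ x y) K) {p w : Plane} (hp : p ∈ openSegment ℝ x y)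
    (hw : 0 < cr (y - x) w) : ∀ᶠ t : ℝ in 𝓝[>] 0, p + t • w ∈ edgeSide K x y := by
  refine eventually_mem_sleeve hK.isOpen_compl (by rwa [compl_compl]) hxy isOpen_Ioo
    (lineSet_subset_compl hd) ?_ (Or.inl rfl) (by rwa [one_mul])
  rwa [lineSet_Ioo_eq_openSegment]

theorem subset_closure_edgeSide (hK : IsClosed K) (hx : K.Nonempty) (hxy : ‖y - x‖ = 1)
    (hd : Disjoint (openSegment ℝ x y) K) : openSegment ℝ x y ⊆ closure (edgeSide K x y) := by
  intro p hp
  have h := eventually_mem_edgeSide hK hx hxy hd hp (w := pp (y - x))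
    (by rw [cr_pp, norm_eq_one_iff.1 hxy]; norm_num)
  have hlim : Tendsto (fun t : ℝ => p + t • pp (y - x)) (𝓝[>] 0) (𝓝 p) := by
    have : Tendsto (fun t : ℝ => p + t • pp (y - x)) (𝓝 0) (𝓝 (p + (0 : ℝ) • pp (y - x))) :=
      Continuous.tendsto (by fun_prop) 0
    simp only [zero_smul, add_zero] at this
    exact this.mono_left nhdsWithin_le_nhds
  exact mem_closure_of_tendsto hlim h

/-- A component of the complement which accumulates at an open edge contains one of its sides. -/
theorem edgeSide_subset_of_mem_closure (hK : IsClosed K) (hx : K.Nonempty) (hxy : ‖y - x‖ = 1)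
    (hd : Disjoint (openSegment ℝ x y) K) {f : Set Plane}
    (hf : f ∈ comps (K ∪ openSegment ℝ x y)ᶜ) {p : Plane} (hp : p ∈ openSegment ℝ x y)
    (hpf : p ∈ closure f) : edgeSide K x y ⊆ f ∨ edgeSide K y x ⊆ f := by
  obtain ⟨q, hq, hqf⟩ := mem_closure_iff_nhds.1 hpf _ (edgeSide_mem_nhds hK hx hxy hd hp)
  rcases hq with hq | hq | hq
  · exact absurd (Or.inr hq) (subset_of_mem_comps hf hqf)
  · exact Or.inl (subset_comp_of_isPreconnected hf (isPreconnected_edgeSide hK hx hxy hd)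
      (edgeSide_subset hxy) ⟨q, hq, hqf⟩)
  · have hyx := norm_sub_comm_eq_one hxy
    rw [openSegment_symm] at hd hf
    exact Or.inr (subset_comp_of_isPreconnected hf (isPreconnected_edgeSide hK hx hyx hd)
      (edgeSide_subset hyx) ⟨q, hq, hqf⟩)

end Edge

/-- The direction `d` at `v` points into `Ω`. -/
def PointsInto (Ω : Set Plane) (v d : Plane) : Prop := ∀ᶠ t : ℝ in 𝓝[>] 0, v + t • d ∈ Ω

theorem PointsInto.exists_pos {Ω : Set Plane} {v d : Plane} (h : PointsInto Ω v d) :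
    ∃ t > 0, ∀ s ∈ Ioc (0 : ℝ) t, v + s • d ∈ Ω := by
  obtain ⟨t, ht, hs⟩ := (nhdsGT_basis (0 : ℝ)).eventually_iff.1 h
  exact ⟨t / 2, half_pos ht, fun s hs' => hs ⟨hs'.1, by linarith [hs'.2]⟩⟩

section Edge

variable {K : Set Plane} {x y : Plane} {Ω : Set Plane}

theorem pointsInto_of_edgeSide_subset (hK : IsClosed K) (hx : K.Nonempty) (hxy : ‖y - x‖ = 1)
    (hd : Disjoint (openSegment ℝ x y) K) (h : edgeSide K x y ⊆ Ω) {q d : Plane}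
    (hq : q ∈ openSegment ℝ x y) (hdir : 0 < cr (y - x) d) : PointsInto Ω q d :=
  (eventually_mem_edgeSide hK hx hxy hd hq hdir).mono fun _ ht => h ht

theorem edgeSide_subset_of_pointsInto (hK : IsClosed K) (hx : K.Nonempty) (hxy : ‖y - x‖ = 1)
    (hd : Disjoint (openSegment ℝ x y) K) (hΩ : Ω ∈ comps (K ∪ openSegment ℝ x y)ᶜ) {q d : Plane}
    (hq : q ∈ openSegment ℝ x y) (hdir : 0 < cr (y - x) d) (h : PointsInto Ω q d) :
    edgeSide K x y ⊆ Ω := by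
  obtain ⟨t, ht1, ht2⟩ := (h.and (eventually_mem_edgeSide hK hx hxy hd hq hdir)).exists
  exact subset_comp_of_isPreconnected hΩ (isPreconnected_edgeSide hK hx hxy hd)
      (edgeSide_subset hxy) ⟨_, ht2, ht1⟩

/-- The side of the edge towards which `d` points is connected, so it lies in `Ω` as soon as one of
its points does; the choice of the point on the edge is immaterial. -/
theorem PointsInto.of_edge (hK : IsClosed K) (hx : K.Nonempty) (hxy : ‖y - x‖ = 1)
    (hd : Disjoint (openSegment ℝ x y) K) (hΩ : Ω ∈ comps (K ∪ openSegment ℝ x y)ᶜ) {q q' d : Plane}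
    (hq : q ∈ openSegment ℝ x y) (hdir : cr (y - x) d ≠ 0) (h : PointsInto Ω q d)
    (hq' : q' ∈ openSegment ℝ x y) : PointsInto Ω q' d := by
  rcases lt_or_gt_of_ne hdir with h1 | h1
  · have hyx := norm_sub_comm_eq_one hxy
    have h2 : 0 < cr (x - y) d := by
      have : cr (x - y) d = - cr (y - x) d := by simp [cr]; ring
      linarith
    rw [openSegment_symm] at hd hΩ hq hq'
    exact pointsInto_of_edgeSide_subset hK hx hyx hd
      (edgeSide_subset_of_pointsInto hK hx hyx hd hΩ hq h2 h) hq' h2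
  · exact pointsInto_of_edgeSide_subset hK hx hxy hd
      (edgeSide_subset_of_pointsInto hK hx hxy hd hΩ hq h1 h) hq' h1

theorem pointsInto_or_of_mem_closure (hK : IsClosed K) (hx : K.Nonempty) (hxy : ‖y - x‖ = 1)
    (hd : Disjoint (openSegment ℝ x y) K) (hΩ : Ω ∈ comps (K ∪ openSegment ℝ x y)ᶜ) {q d : Plane}
    (hq : q ∈ openSegment ℝ x y) (hdir : cr (y - x) d ≠ 0) (hqΩ : q ∈ closure Ω) :
    PointsInto Ω q d ∨ PointsInto Ω q (-d) := by
  have hyx := norm_sub_comm_eq_one hxy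
  have hneg : cr (x - y) d = - cr (y - x) d := by simp [cr]; ring
  have hneg' : cr (x - y) (-d) = cr (y - x) d := by rw [cr_neg_right, hneg, neg_neg]
  have hd' := hd
  rw [openSegment_symm] at hd'
  have hq' := hq
  rw [openSegment_symm] at hq'
  rcases edgeSide_subset_of_mem_closure hK hx hxy hd hΩ hq hqΩ with h | h <;>
    rcases lt_or_gt_of_ne hdir with h1 | h1
  · exact Or.inr (pointsInto_of_edgeSide_subset hK hx hxy hd h hq (by rw [cr_neg_right]; linarith))
  · exact Or.inl (pointsInto_of_edgeSide_subset hK hx hxy hd h hq h1)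
  · exact Or.inl (pointsInto_of_edgeSide_subset hK hx hyx hd' h hq' (by linarith))
  · exact Or.inr (pointsInto_of_edgeSide_subset hK hx hyx hd' h hq' (by linarith))

end Edge

/-! ### Shadows -/

/-- The points that one reaches from `q` in direction `d` before meeting `C` again. -/
def shadow (C : Set Plane) (d q : Plane) : Set Plane :=
  lineSet q d {t | 0 < t ∧ ∀ s ∈ Ioc (0 : ℝ) t, q + s • d ∉ C}

/-- The points below which one first meets the open segment from `x` to `y`. -/
def above (C : Set Plane) (d x y : Plane) : Set Plane := {p | ∃ q ∈ openSegment ℝ x y, p ∈ shadow C d q}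

/-- The points below which there is no point of `C`. -/
def unblocked (C : Set Plane) (d : Plane) : Set Plane := {p | ∀ s : ℝ, 0 ≤ s → p - s • d ∉ C}

section Shadow

variable {C : Set Plane} {d q q' p : Plane}

theorem shadow_subset_compl : shadow C d q ⊆ Cᶜ := by
  rintro _ ⟨t, ⟨ht, h⟩, rfl⟩
  exact h t ⟨ht, le_rfl⟩

theorem isPreconnected_shadow_param :
    IsPreconnected {t : ℝ | 0 < t ∧ ∀ s ∈ Ioc (0 : ℝ) t, q + s • d ∉ C} := by
  refine OrdConnected.isPreconnected ⟨?_⟩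
  rintro a ⟨ha, -⟩ b ⟨-, hb⟩ t ht
  exact ⟨ha.trans_le ht.1, fun s hs => hb s ⟨hs.1, hs.2.trans ht.2⟩⟩

theorem isOpen_shadow_param (hC : IsClosed C) :
    IsOpen {t : ℝ | 0 < t ∧ ∀ s ∈ Ioc (0 : ℝ) t, q + s • d ∉ C} := by
  rw [Metric.isOpen_iff]
  rintro t ⟨ht, h⟩
  have hop : IsOpen {s : ℝ | q + s • d ∉ C} := hC.isOpen_compl.preimage (by fun_prop :
    Continuous fun s : ℝ => q + s • d)
  obtain ⟨ε, hε, hb⟩ := Metric.isOpen_iff.1 hop t (h t ⟨ht, le_rfl⟩)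
  refine ⟨min ε t, lt_min hε ht, fun t' ht' => ?_⟩
  rw [mem_ball, Real.dist_eq, lt_min_iff, abs_lt, abs_lt] at ht'
  refine ⟨by linarith [ht'.2.1], fun s hs => ?_⟩
  rcases le_or_gt s t with hst | hst
  · exact h s ⟨hs.1, hst⟩
  · refine hb ?_
    rw [mem_ball, Real.dist_eq, abs_lt]
    constructor <;> linarith [hs.2, ht'.1.2]

theorem isPreconnected_shadow : IsPreconnected (shadow C d q) :=
  isPreconnected_lineSet isPreconnected_shadow_param

theorem cr_of_mem_shadow (h : p ∈ shadow C d q) : cr d p = cr d q := by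
  obtain ⟨t, -, rfl⟩ := h
  simp [cr_add_right, cr_smul_right]

/-- Otherwise the starting point that is nearer to `p` would be a point of `C` on the free part of
the ray from the other one. -/
theorem shadow_unique (hq : q ∈ C) (hq' : q' ∈ C) (h : p ∈ shadow C d q)
    (h' : p ∈ shadow C d q') : q = q' := by
  obtain ⟨t, ⟨ht, h1⟩, rfl⟩ := h
  obtain ⟨t', ⟨ht', h2⟩, he⟩ := h'
  simp only at he
  rcases lt_trichotomy t t' with hlt | rfl | hlt
  · refine absurd hq ?_
    have : q = q' + (t' - t) • d := by
      rw [sub_smul, ← add_sub_assoc, he]; abel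
    rw [this]
    exact h2 _ ⟨by linarith, by linarith⟩
  · exact (add_right_cancel he).symm
  · refine absurd hq' ?_
    have : q' = q + (t - t') • d := by
      rw [sub_smul, ← add_sub_assoc, ← he]; abel
    rw [this]
    exact h1 _ ⟨by linarith, by linarith⟩

/-- The shadow is relatively closed off `C`: a limit point outside `C` lies on the ray from `q`,
differs from `q`, and the ray is free up to it. -/
theorem isOpen_diff_shadow (hd : ‖d‖ = 1) (hq : q ∈ C) {W : Set Plane} (hW : IsOpen W)
    (hWC : W ⊆ Cᶜ) : IsOpen (W \ shadow C d q) := by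
  have hdd := norm_eq_one_iff.1 hd
  have key : ∀ p ∈ closure (shadow C d q), p ∉ C → p ∈ shadow C d q := by
    intro p hp hpC
    have hcl : IsClosed {p : Plane | cr d (p - q) = 0 ∧ 0 ≤ dt d (p - q)} :=
      (isClosed_eq (f := fun p : Plane => cr d (p - q)) (by fun_prop) continuous_const).inter
        (isClosed_le (g := fun p : Plane => dt d (p - q)) continuous_const (by fun_prop))
    have hsub : shadow C d q ⊆ {p : Plane | cr d (p - q) = 0 ∧ 0 ≤ dt d (p - q)} := by
      rintro _ ⟨t, ⟨ht, -⟩, rfl⟩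
      simp [cr_smul_right, dt_smul_right, hdd, ht.le]
    obtain ⟨h1, h2⟩ := closure_minimal hsub hcl hp
    have hpe : p = q + dt d (p - q) • d := by
      have := eq_of_cr_eq_zero hd h1
      rw [← this]; abel
    refine ⟨dt d (p - q), ⟨lt_of_le_of_ne h2 ?_, fun s hs => ?_⟩, hpe.symm⟩
    · intro h0
      rw [← h0, zero_smul, add_zero] at hpe
      exact hpC (hpe ▸ hq)
    · rcases eq_or_lt_of_le hs.2 with h3 | h3
      · rw [h3, ← hpe]; exact hpC
      · have hop : IsOpen {p : Plane | s < dt d (p - q)} := isOpen_lt continuous_const (by fun_prop)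
        obtain ⟨_, hr, ⟨t, ⟨-, ht⟩, rfl⟩⟩ := mem_closure_iff.1 hp _ hop h3
        refine ht s ⟨hs.1, ?_⟩
        simp only [mem_ofPred_eq, add_sub_cancel_left, dt_smul_right, hdd, mul_one] at hr
        exact hr.le
  have : W \ shadow C d q = W \ closure (shadow C d q) := by
    ext p
    refine and_congr_right fun hp => not_congr ⟨fun h => subset_closure h, fun h => key p h (hWC hp)⟩
  rw [this]
  exact hW.sdiff isClosed_closure

/-- Going down from `p`, there is a first point of the closed set `C` unless `C` is never met. -/
theorem mem_unblocked_or_mem_shadow (hC : IsClosed C) (hp : p ∉ C) :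
    p ∈ unblocked C d ∨ ∃ q ∈ C, p ∈ shadow C d q := by
  by_cases h : p ∈ unblocked C d
  · exact Or.inl h
  right
  simp only [unblocked, mem_ofPred_eq, not_forall, not_not] at h
  obtain ⟨s₁, hs₁, hs₁C⟩ := h
  set A : Set ℝ := {s | 0 ≤ s ∧ p - s • d ∈ C} with hA
  have hAc : IsClosed A := (isClosed_le continuous_const continuous_id).inter
    (hC.preimage (by fun_prop : Continuous fun s : ℝ => p - s • d))
  have hbb : BddBelow A := ⟨0, fun s hs => hs.1⟩
  have hmem : sInf A ∈ A := hAc.csInf_mem ⟨s₁, hs₁, hs₁C⟩ hbb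
  have h0 : 0 < sInf A := by
    refine lt_of_le_of_ne hmem.1 fun h0 => hp ?_
    have := hmem.2
    rwa [← h0, zero_smul, sub_zero] at this
  refine ⟨_, hmem.2, sInf A, ⟨h0, fun s hs hsC => ?_⟩, by simp⟩
  have : sInf A ≤ sInf A - s := csInf_le hbb ⟨by linarith [hs.2], by
    rw [sub_smul, ← sub_add]; exact hsC⟩
  linarith [hs.1]

open scoped Pointwise in
-- The complement is the sum of the compact set `C` and a closed ray, hence closed.
theorem isOpen_unblocked (hC : IsCompact C) : IsOpen (unblocked C d) := by
  have hray : IsClosed ((fun s : ℝ => s • d) '' Ici 0) := by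
    rcases eq_or_ne d 0 with rfl | hd0
    · have : ((fun s : ℝ => s • (0 : Plane)) '' Ici 0) = {0} := by
        ext p; simp only [smul_zero, mem_image, mem_singleton_iff]
        exact ⟨fun ⟨_, _, h⟩ => h.symm, fun h => ⟨0, by simp, h.symm⟩⟩
      rw [this]; exact isClosed_singleton
    · exact (isClosedEmbedding_smul_left hd0).isClosedMap _ isClosed_Ici
  have hcl := hray.add_left_of_isCompact hC
  convert hcl.isOpen_compl using 1
  ext p
  simp only [unblocked, mem_ofPred_eq, mem_compl_iff, Set.mem_add, mem_image, mem_Ici]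
  constructor
  · rintro h ⟨c, hc, _, ⟨s, hs, rfl⟩, rfl⟩
    exact h s hs (by simpa using hc)
  · intro h s hs hps
    exact h ⟨_, hps, _, ⟨s, hs, rfl⟩, by abel⟩

/-- The foot of `p` on the line of the edge and the height of `p` over it depend continuously on
`p`. The points for which `K` meets the segment from the foot to `p` form the projection of a closed
set along the compact interval of `r`, hence a closed set. -/
theorem isOpen_above {K : Set Plane} {x y : Plane} (hK : IsClosed K) (hd : ‖d‖ = 1)
    (hdis : Disjoint (openSegment ℝ x y) K) (hC : C = K ∪ openSegment ℝ x y)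
    (hdir : cr d (y - x) ≠ 0) : IsOpen (above C d x y) := by
  have hdd := norm_eq_one_iff.1 hd
  set lam : Plane → ℝ := fun p => cr d (p - x) / cr d (y - x) with hlam
  set foot : Plane → Plane := fun p => x + lam p • (y - x) with hfoot
  set tau : Plane → ℝ := fun p => dt d (p - foot p) with htau
  have clam : Continuous lam := by
    simp only [hlam]
    exact Continuous.div_const (by fun_prop) _
  have cfoot : Continuous foot := by simp only [hfoot]; fun_prop
  have ctau : Continuous tau := by simp only [htau]; fun_prop
  have hcl : IsClosed {p : Plane | ∃ r ∈ Icc (0 : ℝ) 1, foot p + (r * tau p) • d ∈ K} := by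
    have h1 : IsClosed {z : Icc (0 : ℝ) 1 × Plane | foot z.2 + ((z.1 : ℝ) * tau z.2) • d ∈ K} :=
      hK.preimage (by fun_prop)
    have h2 := isClosedMap_snd_of_compactSpace _ h1
    convert h2 using 1
    ext p
    simp only [mem_ofPred_eq, mem_image, Prod.exists, exists_eq_right, Subtype.exists]
    constructor
    · rintro ⟨r, hr, h⟩; exact ⟨r, hr, h⟩
    · rintro ⟨r, hr, h⟩; exact ⟨r, hr, h⟩
  have hset : above C d x y = {p | lam p ∈ Ioo (0 : ℝ) 1} ∩ {p | 0 < tau p} ∩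
      {p : Plane | ∃ r ∈ Icc (0 : ℝ) 1, foot p + (r * tau p) • d ∈ K}ᶜ := by
    ext p
    constructor
    · rintro ⟨q, hq, t, ⟨ht, hfree⟩, rfl⟩
      rw [← lineSet_Ioo_eq_openSegment] at hq
      obtain ⟨l, hl, rfl⟩ := hq
      simp only at hfree ⊢
      have e1 : lam (x + l • (y - x) + t • d) = l := by
        simp only [hlam]
        rw [add_assoc, add_sub_cancel_left, cr_add_right, cr_smul_right, cr_smul_right, cr_self,
          mul_zero, add_zero, mul_div_cancel_right₀ _ hdir]
      have e2 : foot (x + l • (y - x) + t • d) = x + l • (y - x) := by simp only [hfoot, e1]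
      have e3 : tau (x + l • (y - x) + t • d) = t := by
        simp only [htau, e2, add_sub_cancel_left, dt_smul_right, hdd, mul_one]
      refine ⟨⟨by simpa only [mem_ofPred_eq, e1] using hl, by simpa only [mem_ofPred_eq, e3] using ht⟩, ?_⟩
      rintro ⟨r, hr, hrK⟩
      rw [e2, e3] at hrK
      rcases eq_or_lt_of_le hr.1 with h0 | h0
      · rw [← h0, zero_mul, zero_smul, add_zero] at hrK
        refine Set.disjoint_left.1 hdis ?_ hrK
        rw [← lineSet_Ioo_eq_openSegment]
        exact ⟨l, hl, rfl⟩
      · refine hfree (r * t) ⟨by positivity, by nlinarith [hr.2]⟩ ?_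
        rw [hC]; exact Or.inl hrK
    · rintro ⟨⟨h1, h2⟩, h3⟩
      have h1 : lam p ∈ Ioo (0 : ℝ) 1 := h1
      have h2 : 0 < tau p := h2
      have hfm : foot p ∈ openSegment ℝ x y := by
        rw [← lineSet_Ioo_eq_openSegment]; exact ⟨lam p, h1, rfl⟩
      have hc0 : cr d (p - foot p) = 0 := by
        have : p - foot p = (p - x) - lam p • (y - x) := by simp only [hfoot]; abel
        rw [this, cr_sub_right, cr_smul_right]
        simp only [hlam]
        rw [div_mul_cancel₀ _ hdir, sub_self]
      have hpe : p = foot p + tau p • d := by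
        have := eq_of_cr_eq_zero hd hc0
        simp only [htau]
        rw [← this]; abel
      refine ⟨foot p, hfm, tau p, ⟨h2, fun s hs hsC => ?_⟩, hpe.symm⟩
      rw [hC] at hsC
      rcases hsC with hsC | hsC
      · refine h3 ⟨s / tau p, ⟨by have := hs.1; positivity, (div_le_one h2).2 hs.2⟩, ?_⟩
        rwa [div_mul_cancel₀ _ h2.ne']
      · rw [← lineSet_Ioo_eq_openSegment] at hsC
        obtain ⟨l, hl, he⟩ := hsC
        simp only at he
        have h4 : (l - lam p) • (y - x) = s • d := by
          have : s • d = (x + l • (y - x)) - foot p := by rw [he]; abel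
          rw [this, sub_smul]; simp only [hfoot]; abel
        have h5 : (l - lam p) * cr d (y - x) = 0 := by
          rw [← cr_smul_right, h4, cr_smul_right, cr_self, mul_zero]
        have h6 : l - lam p = 0 := (mul_eq_zero.1 h5).resolve_right hdir
        rw [h6, zero_smul] at h4
        have h7 : dt d (s • d) = 0 := by rw [← h4, dt_zero_right]
        rw [dt_smul_right, hdd, mul_one] at h7
        exact hs.1.ne' h7
  rw [hset]
  exact ((isOpen_Ioo.preimage clam).inter (isOpen_lt continuous_const ctau)).inter hcl.isOpen_compl

end Shadow

end HardSphere

/-! ### Cutting the unbounded component into vertical slabs over walls. -/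

namespace HardSphere

open Set Filter Topology Metric

/-- The set drawn by finitely many vertices and open segments between them. -/
def frameSet {ι : Type*} (P Q : ι → Plane) (V : Finset Plane) : Set Plane :=
  (V : Set Plane) ∪ ⋃ i, openSegment ℝ (P i) (Q i)

/-- The drawn set without the open segment `i`. -/
def frameRest {ι : Type*} (P Q : ι → Plane) (V : Finset Plane) (i : ι) : Set Plane :=
  (V : Set Plane) ∪ ⋃ j : {j // j ≠ i}, openSegment ℝ (P j) (Q j)

/-- Finitely many non-crossing unit segments, all of which lie on the boundary of the unbounded
component `Ω` of the complement. -/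
structure OuterFrame {ι : Type*} (P Q : ι → Plane) (V : Finset Plane) (Ω : Set Plane) : Prop where
  nonempty : V.Nonempty
  left_mem : ∀ i, P i ∈ V
  right_mem : ∀ i, Q i ∈ V
  unit : ∀ i, ‖Q i - P i‖ = 1
  vert : ∀ i, ∀ v ∈ V, v ∉ openSegment ℝ (P i) (Q i)
  disj : ∀ i j, i ≠ j → Disjoint (openSegment ℝ (P i) (Q i)) (openSegment ℝ (P j) (Q j))
  comp : Ω ∈ comps (frameSet P Q V)ᶜ
  unbounded : ¬ Bornology.IsBounded Ω
  side : ∀ i, (openSegment ℝ (P i) (Q i) ∩ closure Ω).Nonempty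

/-- A unit vector which is not parallel to the line through two points of `V`. -/
def IsGenericDir (V : Finset Plane) (d : Plane) : Prop :=
  ‖d‖ = 1 ∧ ∀ v ∈ V, ∀ w ∈ V, v ≠ w → cr d (v - w) ≠ 0

theorem IsGenericDir.neg {V : Finset Plane} {d : Plane} (h : IsGenericDir V d) :
    IsGenericDir V (-d) :=
  ⟨by rw [norm_neg, h.1], fun v hv w hw hvw => by
    rw [cr_neg_left]; exact neg_ne_zero.2 (h.2 v hv w hw hvw)⟩

theorem IsGenericDir.eq_of_cr_eq {V : Finset Plane} {d : Plane} (h : IsGenericDir V d)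
    {v w : Plane} (hv : v ∈ V) (hw : w ∈ V) (he : cr d v = cr d w) : v = w := by
  by_contra hne
  exact h.2 v hv w hw hne (by rw [cr_sub_right, he, sub_self])

/-- `Ω` cut along the lines in direction `d` that emanate from the vertices. -/
def cutRegion (Ω C : Set Plane) (V : Finset Plane) (d : Plane) : Set Plane :=
  {p | p ∈ Ω ∧ ∀ v ∈ V, p ∉ shadow C d v ∧ p ∉ shadow C (-d) v}

theorem cutRegion_neg (Ω C : Set Plane) (V : Finset Plane) (d : Plane) :
    cutRegion Ω C V (-d) = cutRegion Ω C V d := by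
  ext p
  simp only [cutRegion, mem_ofPred_eq, neg_neg, and_comm (a := p ∉ shadow C (-d) _)]

theorem isCompact_union_openSegments {κ : Type*} [Finite κ] (P Q : κ → Plane) (V : Finset Plane)
    (hP : ∀ i, P i ∈ V) (hQ : ∀ i, Q i ∈ V) :
    IsCompact ((V : Set Plane) ∪ ⋃ i, openSegment ℝ (P i) (Q i)) := by
  have : (V : Set Plane) ∪ ⋃ i, openSegment ℝ (P i) (Q i) =
      (V : Set Plane) ∪ ⋃ i, segment ℝ (P i) (Q i) := by
    refine Subset.antisymm (union_subset_union_right _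
      (iUnion_mono fun i => openSegment_subset_segment ℝ _ _)) ?_
    refine union_subset subset_union_left (iUnion_subset fun i => ?_)
    rw [← insert_endpoints_openSegment]
    rintro p (rfl | rfl | hp)
    · exact Or.inl (hP i)
    · exact Or.inl (hQ i)
    · exact Or.inr (mem_iUnion.2 ⟨i, hp⟩)
  rw [this]
  exact V.finite_toSet.isCompact.union (isCompact_iUnion fun i => isCompact_segment _ _)

namespace OuterFrame

variable {ι : Type*} {P Q : ι → Plane} {V : Finset Plane} {Ω : Set Plane} {d : Plane}

theorem isCompact [Finite ι] (F : OuterFrame P Q V Ω) : IsCompact (frameSet P Q V) :=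
  isCompact_union_openSegments P Q V F.left_mem F.right_mem

theorem isClosed_rest [Finite ι] (F : OuterFrame P Q V Ω) (i : ι) : IsClosed (frameRest P Q V i) :=
  (isCompact_union_openSegments (fun j : {j // j ≠ i} => P j) (fun j : {j // j ≠ i} => Q j) V
    (fun j => F.left_mem j) (fun j => F.right_mem j)).isClosed

theorem rest_nonempty (F : OuterFrame P Q V Ω) (i : ι) : (frameRest P Q V i).Nonempty :=
  (Finset.coe_nonempty.2 F.nonempty).mono subset_union_left

theorem frameSet_eq (i : ι) :
    frameSet P Q V = frameRest P Q V i ∪ openSegment ℝ (P i) (Q i) := by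
  ext p
  simp only [frameSet, frameRest, Set.mem_union, mem_iUnion, Subtype.exists]
  constructor
  · rintro (h | ⟨j, hj⟩)
    · exact Or.inl (Or.inl h)
    · by_cases hji : j = i
      · subst hji; exact Or.inr hj
      · exact Or.inl (Or.inr ⟨j, hji, hj⟩)
  · rintro ((h | ⟨j, -, hj⟩) | h)
    · exact Or.inl h
    · exact Or.inr ⟨j, hj⟩
    · exact Or.inr ⟨i, h⟩

theorem disjoint_rest (F : OuterFrame P Q V Ω) (i : ι) :
    Disjoint (openSegment ℝ (P i) (Q i)) (frameRest P Q V i) := by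
  refine disjoint_union_right.2 ⟨?_, disjoint_iUnion_right.2 fun j => F.disj i j j.2.symm⟩
  rw [Set.disjoint_left]
  exact fun p hp hpV => F.vert i p hpV hp

theorem comp_rest (F : OuterFrame P Q V Ω) (i : ι) :
    Ω ∈ comps (frameRest P Q V i ∪ openSegment ℝ (P i) (Q i))ᶜ := frameSet_eq i ▸ F.comp

theorem isOpen [Finite ι] (F : OuterFrame P Q V Ω) : IsOpen Ω :=
  isOpen_of_mem_comps F.isCompact.isClosed.isOpen_compl F.comp

theorem subset_compl (F : OuterFrame P Q V Ω) : Ω ⊆ (frameSet P Q V)ᶜ := subset_of_mem_comps F.comp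

theorem mem_frameSet_of_vert {v : Plane} (hv : v ∈ V) :
    v ∈ frameSet P Q V := Or.inl hv

theorem mem_frameSet_of_edge {i : ι} {q : Plane}
    (hq : q ∈ openSegment ℝ (P i) (Q i)) : q ∈ frameSet P Q V := Or.inr (mem_iUnion.2 ⟨i, hq⟩)

theorem cr_edge_ne (F : OuterFrame P Q V Ω) (hd : IsGenericDir V d) (i : ι) :
    cr d (Q i - P i) ≠ 0 := by
  refine hd.2 _ (F.right_mem i) _ (F.left_mem i) fun h => ?_
  have := F.unit i
  rw [h, sub_self, norm_zero] at this
  norm_num at this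

theorem cr_edge_ne' (F : OuterFrame P Q V Ω) (hd : IsGenericDir V d) (i : ι) :
    cr (Q i - P i) d ≠ 0 := by
  rw [cr_comm]; exact neg_ne_zero.2 (F.cr_edge_ne hd i)

/-- The regions above a given wall; `none` stands for the wall at infinity. -/
def wallRegion (P Q : ι → Plane) (V : Finset Plane) (d : Plane) : Option ι → Set Plane
  | none => unblocked (frameSet P Q V) d
  | some i => above (frameSet P Q V) d (P i) (Q i)

theorem isOpen_wallRegion [Finite ι] (F : OuterFrame P Q V Ω) (hd : IsGenericDir V d) (W : Option ι) :
    IsOpen (wallRegion P Q V d W) := by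
  cases W with
  | none => exact isOpen_unblocked F.isCompact
  | some i =>
    exact isOpen_above (F.isClosed_rest i) hd.1 (F.disjoint_rest i) (frameSet_eq i)
      (F.cr_edge_ne hd i)

theorem wallRegion_unique (F : OuterFrame P Q V Ω) {W W' : Option ι} {p : Plane}
    (h : p ∈ wallRegion P Q V d W) (h' : p ∈ wallRegion P Q V d W') : W = W' := by
  have hno : ∀ i, p ∈ unblocked (frameSet P Q V) d → p ∈ above (frameSet P Q V) d (P i) (Q i) →
      False := by
    rintro i h1 ⟨q, hq, t, ⟨ht, -⟩, rfl⟩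
    refine h1 t ht.le ?_
    simpa using mem_frameSet_of_edge hq
  cases W with
  | none =>
    cases W' with
    | none => rfl
    | some i => exact (hno i h h').elim
  | some i =>
    cases W' with
    | none => exact (hno i h' h).elim
    | some j =>
      obtain ⟨q, hq, h⟩ := h
      obtain ⟨q', hq', h'⟩ := h'
      obtain rfl := shadow_unique (mem_frameSet_of_edge hq) (mem_frameSet_of_edge hq') h h'
      by_contra hij
      exact Set.disjoint_left.1 (F.disj i j fun h => hij (h ▸ rfl)) hq hq'

theorem exists_wallRegion [Finite ι] (F : OuterFrame P Q V Ω) {p : Plane} (hp : p ∉ frameSet P Q V)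
    (hv : ∀ v ∈ V, p ∉ shadow (frameSet P Q V) d v) : ∃ W, p ∈ wallRegion P Q V d W := by
  rcases mem_unblocked_or_mem_shadow F.isCompact.isClosed hp with h | ⟨q, hq, h⟩
  · exact ⟨none, h⟩
  · rcases hq with hq | hq
    · exact absurd h (hv q hq)
    · obtain ⟨i, hi⟩ := mem_iUnion.1 hq
      exact ⟨some i, q, hi, h⟩

/-- The wall regions are open and pairwise disjoint, and they cover the cut region because the slits
above the vertices have been removed. A connected piece therefore lies over a single wall. -/
theorem subset_wallRegion [Finite ι] (F : OuterFrame P Q V Ω) (hd : IsGenericDir V d) {T : Set Plane}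
    (hT : T ∈ comps (cutRegion Ω (frameSet P Q V) V d)) {W : Option ι} {z : Plane} (hz : z ∈ T)
    (hzW : z ∈ wallRegion P Q V d W) : T ⊆ wallRegion P Q V d W := by
  have hsub := subset_of_mem_comps hT
  have hcov : T ⊆ wallRegion P Q V d W ∪ ⋃ W' : {W' // W' ≠ W}, wallRegion P Q V d W' := by
    intro p hp
    have hp' := hsub hp
    obtain ⟨W', hW'⟩ := F.exists_wallRegion (d := d) (F.subset_compl hp'.1)
      fun v hv => (hp'.2 v hv).1
    by_cases h : W' = W
    · exact Or.inl (h ▸ hW')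
    · exact Or.inr (mem_iUnion.2 ⟨⟨W', h⟩, hW'⟩)
  refine (isPreconnected_of_mem_comps hT).subset_left_of_subset_union (F.isOpen_wallRegion hd W)
    (v := ⋃ W' : {W' // W' ≠ W}, wallRegion P Q V d W')
    (isOpen_iUnion fun W' => F.isOpen_wallRegion hd _) ?_ hcov ⟨z, hz, hzW⟩
  rw [disjoint_iUnion_right]
  rintro ⟨W', hW'⟩
  rw [Set.disjoint_left]
  exact fun p h1 h2 => hW' (F.wallRegion_unique h2 h1)

theorem eq_of_cr_eq_on_edge (F : OuterFrame P Q V Ω) (hd : IsGenericDir V d) {i : ι} {q q' : Plane}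
    (hq : q ∈ openSegment ℝ (P i) (Q i)) (hq' : q' ∈ openSegment ℝ (P i) (Q i))
    (h : cr d q = cr d q') : q = q' := by
  rw [← lineSet_Ioo_eq_openSegment] at hq hq'
  obtain ⟨s, -, rfl⟩ := hq
  obtain ⟨t, -, rfl⟩ := hq'
  simp only [cr_add_right, cr_smul_right, add_right_inj] at h
  have := mul_right_cancel₀ (F.cr_edge_ne hd i) h
  rw [this]

/-- A component above the wall on which the line downwards from `v` lands does not meet the level
of `v`. -/
theorem cr_ne_of_lands (F : OuterFrame P Q V Ω) (hd : IsGenericDir V d) {T : Set Plane}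
    (hT : T ⊆ cutRegion Ω (frameSet P Q V) V d) {W : Option ι} (hTW : T ⊆ wallRegion P Q V d W)
    {v z : Plane} (hv : v ∈ V) (hz : z ∈ shadow (frameSet P Q V) (-d) v)
    (hzW : z ∈ wallRegion P Q V d W) {r : Plane} (hr : r ∈ T) : cr d r ≠ cr d v := by
  intro hcr
  have hrs := ((hT hr).2 v hv).2
  have hrW := hTW hr
  have hvC := mem_frameSet_of_vert (P := P) (Q := Q) hv
  obtain ⟨s, ⟨hs, hsf⟩, rfl⟩ := hz
  -- At the level of `v`, a point over the wall `W` lies on the vertical line through `v`. Between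
  -- `W` and `v` this line is the removed slit, and from `v` upwards the vertex blocks the view of
  -- the wall.
  cases W with
  | none =>
    simp only [wallRegion, unblocked, mem_ofPred_eq, smul_neg, ← sub_eq_add_neg] at hzW hrW hsf
    have hrv : r = v + dt d (r - v) • d := by
      have := eq_of_cr_eq_zero hd.1 (w := r - v) (by rw [cr_sub_right, hcr, sub_self])
      rw [← this]; abel
    rcases lt_or_ge (dt d (r - v)) 0 with h | h
    · refine hrs ⟨-dt d (r - v), ⟨by linarith, fun t ht => ?_⟩, by simpa using hrv.symm⟩
      rw [smul_neg, ← sub_eq_add_neg]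
      rcases le_or_gt t s with hts | hts
      · exact hsf t ⟨ht.1, hts⟩
      · have := hzW (t - s) (by linarith)
        rwa [sub_sub, ← add_smul, add_sub_cancel] at this
    · refine hrW (dt d (r - v)) h ?_
      rw [sub_eq_iff_eq_add.2 hrv]
      exact hvC
  | some i =>
    obtain ⟨q, hq, t, ⟨ht, htf⟩, hqt⟩ := hzW
    obtain ⟨q', hq', t', ⟨ht', htf'⟩, rfl⟩ := hrW
    simp only [smul_neg, ← sub_eq_add_neg] at hqt hsf hcr
    have hvq : v = q + (t + s) • d := by rw [add_smul, ← add_assoc, hqt]; abel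
    have : q' = q := by
      refine F.eq_of_cr_eq_on_edge hd hq' hq ?_
      rw [hvq] at hcr
      simpa [cr_add_right, cr_smul_right] using hcr
    subst this
    have hfree : ∀ σ, 0 < σ → σ < t + s → q' + σ • d ∉ frameSet P Q V := by
      intro σ h1 h2
      rcases le_or_gt σ t with h | h
      · exact htf σ ⟨h1, h⟩
      · have := hsf (t + s - σ) ⟨by linarith, by linarith⟩
        rw [hvq, sub_smul, add_sub_assoc, sub_sub_cancel] at this
        exact this
    rcases lt_or_ge t' (t + s) with h | h
    · refine hrs ⟨t + s - t', ⟨by linarith, fun σ hσ => ?_⟩, ?_⟩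
      · rw [smul_neg, ← sub_eq_add_neg, hvq, add_sub_assoc, ← sub_smul]
        exact hfree _ (by linarith [hσ.2]) (by linarith [hσ.1])
      · simp only [smul_neg, ← sub_eq_add_neg]
        rw [hvq, add_sub_assoc, ← sub_smul, sub_sub_cancel]
    · exact htf' (t + s) ⟨by linarith, h⟩ (hvq ▸ hvC)

theorem mem_cutRegion_of_level (hp : p ∈ Ω) {C : Set Plane} (h : ∀ v ∈ V, cr d p ≠ cr d v) :
    p ∈ cutRegion Ω C V d := by
  refine ⟨hp, fun v hv => ⟨fun hs => h v hv (cr_of_mem_shadow hs), fun hs => h v hv ?_⟩⟩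
  have := cr_of_mem_shadow hs
  rw [cr_neg_left, cr_neg_left] at this
  linarith

theorem exists_mem_cutRegion_edge [Finite ι] (F : OuterFrame P Q V Ω) (hd : IsGenericDir V d) {i : ι}
    {q₀ q : Plane} (hq₀ : q₀ ∈ openSegment ℝ (P i) (Q i)) (h : PointsInto Ω q₀ d)
    (hq : q ∈ openSegment ℝ (P i) (Q i)) (hlev : ∀ v ∈ V, cr d q ≠ cr d v) :
    ∃ z ∈ cutRegion Ω (frameSet P Q V) V d, z ∈ wallRegion P Q V d (some i) ∧ cr d z = cr d q := by
  have hpt : PointsInto Ω q d := PointsInto.of_edge (F.isClosed_rest i) (F.rest_nonempty i)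
    (F.unit i) (F.disjoint_rest i) (F.comp_rest i) hq₀ (F.cr_edge_ne' hd i) h hq
  obtain ⟨t, ht, htΩ⟩ := hpt.exists_pos
  have hcr : cr d (q + t • d) = cr d q := by simp [cr_add_right, cr_smul_right]
  exact ⟨q + t • d, mem_cutRegion_of_level (htΩ t ⟨ht, le_rfl⟩) (by rwa [hcr]),
    ⟨q, hq, t, ⟨ht, fun s hs => F.subset_compl (htΩ s hs)⟩, rfl⟩, hcr⟩

/-- The witness is taken at level `a` so far in direction `-d` that it and everything below it is
beyond a norm bound for the frame. -/
theorem exists_mem_cutRegion_none [Finite ι] (F : OuterFrame P Q V Ω) (hd : IsGenericDir V d) {a : ℝ}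
    (hlev : ∀ v ∈ V, a ≠ cr d v) :
    ∃ z ∈ cutRegion Ω (frameSet P Q V) V d, z ∈ wallRegion P Q V d none ∧ cr d z = a := by
  have hdd := norm_eq_one_iff.1 hd.1
  obtain ⟨R, hR⟩ := isBounded_iff_forall_norm_le.1 F.isCompact.isBounded
  have hdt : ∀ s, dt d (a • pp d + (-(|R| + 1)) • d - s • d) = -(|R| + 1) - s := by
    intro s
    simp [dt_add_right, dt_sub_right, dt_smul_right, hdd]
  have hcr : cr d (a • pp d + (-(|R| + 1)) • d) = a := by
    simp [cr_add_right, cr_smul_right, hdd]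
  have habs : ∀ s, 0 ≤ s → R < |-(|R| + 1) - s| := by
    intro s hs
    rw [abs_of_neg (by linarith [abs_nonneg R])]
    linarith [le_abs_self R]
  refine ⟨a • pp d + (-(|R| + 1)) • d, mem_cutRegion_of_level ?_ (by rwa [hcr]), ?_, hcr⟩
  · refine far_subset_of_unbounded hR F.comp F.unbounded hd.1 (Or.inr ?_)
    have := hdt 0
    rw [zero_smul, sub_zero, sub_zero] at this
    rw [this]
    simpa using habs 0 le_rfl
  · intro s hs hsC
    have h1 := abs_dt_le hd.1 (a • pp d + (-(|R| + 1)) • d - s • d)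
    rw [hdt] at h1
    linarith [hR _ hsC, habs s hs]

end OuterFrame

end HardSphere

/-! ### Upper bound for the number of pieces of the cut region. -/

namespace HardSphere

open Set Filter Topology Metric

namespace OuterFrame

variable {ι : Type*} {P Q : ι → Plane} {V : Finset Plane} {Ω : Set Plane} {d : Plane}

/-- One of the two directions `d` and `-d`. -/
def signedDir (d : Plane) (b : Bool) : Plane := if b then d else -d

theorem norm_signedDir (hd : ‖d‖ = 1) (b : Bool) : ‖signedDir d b‖ = 1 := by
  cases b <;> simp [signedDir, hd]

theorem cr_signedDir_eq_iff {b : Bool} {p q : Plane} :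
    cr (signedDir d b) p = cr (signedDir d b) q ↔ cr d p = cr d q := by
  cases b <;> simp [signedDir, cr_neg_left]

theorem shadow_subset (F : OuterFrame P Q V Ω) {v e : Plane} {p : Plane}
    (hp : p ∈ shadow (frameSet P Q V) e v) (hpΩ : p ∈ Ω) : shadow (frameSet P Q V) e v ⊆ Ω :=
  subset_comp_of_isPreconnected F.comp isPreconnected_shadow shadow_subset_compl ⟨p, hp, hpΩ⟩

theorem shadow_of_pointsInto (F : OuterFrame P Q V Ω) {v e : Plane} (h : PointsInto Ω v e) :
    (shadow (frameSet P Q V) e v).Nonempty ∧ shadow (frameSet P Q V) e v ⊆ Ω := by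
  obtain ⟨t, ht, hs⟩ := h.exists_pos
  have hmem : v + t • e ∈ shadow (frameSet P Q V) e v :=
    ⟨t, ⟨ht, fun s hs' => F.subset_compl (hs s hs')⟩, rfl⟩
  exact ⟨⟨_, hmem⟩, F.shadow_subset hmem (hs t ⟨ht, le_rfl⟩)⟩

theorem pointsInto_of_mem_shadow (F : OuterFrame P Q V Ω) {v e p : Plane}
    (hp : p ∈ shadow (frameSet P Q V) e v) (hpΩ : p ∈ Ω) : PointsInto Ω v e := by
  have hsub := F.shadow_subset hp hpΩ
  obtain ⟨t, ⟨ht, hf⟩, rfl⟩ := hp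
  filter_upwards [Ioo_mem_nhdsGT ht] with s hs
  exact hsub ⟨s, ⟨hs.1, fun r hr => hf r ⟨hr.1, hr.2.trans hs.2.le⟩⟩, rfl⟩

theorem disjoint_shadow (hd : IsGenericDir V d) {C : Set Plane} {v w : Plane} (hv : v ∈ V)
    (hw : w ∈ V) {a b : Bool} (hne : (v, a) ≠ (w, b)) :
    Disjoint (shadow C (signedDir d a) v) (shadow C (signedDir d b) w) := by
  rw [Set.disjoint_left]
  intro p h1 h2
  have e1 := cr_signedDir_eq_iff.1 (cr_of_mem_shadow h1)
  have e2 := cr_signedDir_eq_iff.1 (cr_of_mem_shadow h2)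
  have hvw := hd.eq_of_cr_eq hv hw (e1.symm.trans e2)
  subst hvw
  have hab : a ≠ b := fun h => hne (by rw [h])
  have hdd := norm_eq_one_iff.1 hd.1
  obtain ⟨s, ⟨hs, -⟩, rfl⟩ := h1
  obtain ⟨t, ⟨ht, -⟩, he⟩ := h2
  have he' := congrArg (dt d) (add_left_cancel he)
  simp only [dt_smul_right] at he'
  cases a <;> cases b <;> simp_all [signedDir, dt_neg_right] <;> linarith

/-- Cutting along the line upwards from the leftmost vertex does not disconnect. -/
theorem exists_free_slit [Finite ι] (F : OuterFrame P Q V Ω) (hd : IsGenericDir V d) :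
    ∃ v ∈ V, PointsInto Ω v d ∧ (comps (Ω \ shadow (frameSet P Q V) d v)).Finite ∧
      (comps (Ω \ shadow (frameSet P Q V) d v)).ncard ≤ 1 := by
  have hdd := norm_eq_one_iff.1 hd.1
  obtain ⟨v, hv, hmin⟩ := V.exists_min_image (cr d) F.nonempty
  obtain ⟨R, hR⟩ := isBounded_iff_forall_norm_le.1 F.isCompact.isBounded
  have hlev : ∀ p ∈ frameSet P Q V, cr d p ≤ cr d v → p = v := by
    rintro p (hp | hp) hpv
    · exact hd.eq_of_cr_eq hp hv (le_antisymm hpv (hmin p hp))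
    · obtain ⟨i, hi⟩ := mem_iUnion.1 hp
      obtain ⟨a, b, ha, hb, hab, rfl⟩ := hi
      have h1 := hmin _ (F.left_mem i)
      have h2 := hmin _ (F.right_mem i)
      rw [cr_add_right, cr_smul_right, cr_smul_right] at hpv
      have h3 : a * cr d v + b * cr d v = cr d v := by rw [← add_mul, hab, one_mul]
      have h4 : cr d (P i) = cr d v := by
        by_contra hne
        have := lt_of_le_of_ne h1 (Ne.symm hne)
        nlinarith
      have h5 : cr d (Q i) = cr d v := by
        by_contra hne
        have := lt_of_le_of_ne h2 (Ne.symm hne)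
        nlinarith
      exact absurd (by rw [cr_sub_right, h4, h5, sub_self]) (F.cr_edge_ne hd i)
  have hvC : v ∈ frameSet P Q V := mem_frameSet_of_vert hv
  have hRv := hR v hvC
  have hcv := (abs_le.1 (abs_cr_le hd.1 v))
  have hdv := (abs_le.1 (abs_dt_le hd.1 v))
  have hparam : {t : ℝ | 0 < t ∧ ∀ s ∈ Ioc (0 : ℝ) t, v + s • d ∉ frameSet P Q V} = Ioi 0 := by
    ext t
    refine ⟨fun h => h.1, fun h => ⟨h, fun s hs hsC => ?_⟩⟩
    have := hlev _ hsC (by simp [cr_add_right, cr_smul_right])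
    have h2 := congrArg (dt d) this
    rw [dt_add_right, dt_smul_right, hdd] at h2
    linarith [hs.1]
  have hshadow : shadow (frameSet P Q V) d v = lineSet v d (Ioi 0) := by rw [shadow, hparam]
  have hrayfar : v + (2 * |R| + 1) • d ∈ Ω := by
    refine far_subset_of_unbounded hR F.comp F.unbounded hd.1 (Or.inr ?_)
    rw [dt_add_right, dt_smul_right, hdd, mul_one]
    refine lt_of_lt_of_le ?_ (le_abs_self _)
    have := le_abs_self R
    linarith [abs_nonneg R]
  have hrayΩ : lineSet v d (Ioi 0) ⊆ Ω := by
    rw [← hshadow]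
    refine F.shadow_subset ?_ hrayfar
    rw [hshadow]
    exact ⟨_, by simp only [mem_Ioi]; positivity, rfl⟩
  have hpt : PointsInto Ω v d := by
    filter_upwards [self_mem_nhdsWithin] with t ht
    exact hrayΩ ⟨t, ht, rfl⟩
  refine ⟨v, hv, hpt, ?_⟩
  have hopen := isOpen_diff_shadow hd.1 hvC F.isOpen F.subset_compl
  rw [hshadow] at hopen ⊢
  have hne : Ωᶜ.Nonempty := ⟨v, fun h => F.subset_compl h hvC⟩
  -- The region before the level of `v`, then far below, far beyond and far above the frame: these
  -- four convex sets lead around the frame from one side of the ray to the other.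
  set A1 : Set Plane := {p | cr d p < cr d v}
  set A2 : Set Plane := {p | dt d p < -R}
  set A3 : Set Plane := {p | R < cr d p}
  set A4 : Set Plane := {p | R < dt d p} ∩ {p | cr d v < cr d p}
  set L := sleeve Ω v d 1 (Ioi 0)
  set N := sleeve Ω v d (-1) (Ioi 0)
  have hL : IsPreconnected L :=
    isPreconnected_sleeve F.isOpen hne hd.1 (by simp) isPreconnected_Ioi hrayΩ
  have hN : IsPreconnected N :=
    isPreconnected_sleeve F.isOpen hne hd.1 (by simp) isPreconnected_Ioi hrayΩ
  have c1 : IsPreconnected A1 := (convex_halfSpace_lt (isLinearMap_cr d) _).isPreconnected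
  have c2 : IsPreconnected A2 := (convex_halfSpace_lt (isLinearMap_dt d) _).isPreconnected
  have c3 : IsPreconnected A3 := (convex_halfSpace_gt (isLinearMap_cr d) _).isPreconnected
  have c4 : IsPreconnected A4 := ((convex_halfSpace_gt (isLinearMap_dt d) _).inter
    (convex_halfSpace_gt (isLinearMap_cr d) _)).isPreconnected
  have hcr : ∀ a b : ℝ, cr d (a • d + b • pp d) = b := by
    intro a b; simp [cr_add_right, cr_smul_right, hdd]
  have hdt : ∀ a b : ℝ, dt d (a • d + b • pp d) = a := by
    intro a b; simp [dt_add_right, dt_smul_right, hdd]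
  have hmem : ∀ p ∈ A1 ∪ A2 ∪ A3 ∪ A4, p ∉ frameSet P Q V := by
    rintro p (((hp | hp) | hp) | hp) hpC
    · have hp : cr d p < cr d v := hp
      have := hlev p hpC hp.le
      rw [this] at hp
      exact lt_irrefl _ hp
    · have hp : dt d p < -R := hp
      linarith [hR p hpC, (abs_le.1 (abs_dt_le hd.1 p)).1]
    · have hp : R < cr d p := hp
      linarith [hR p hpC, (abs_le.1 (abs_cr_le hd.1 p)).2]
    · have hp : R < dt d p := hp.1
      linarith [hR p hpC, (abs_le.1 (abs_dt_le hd.1 p)).2]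
  have hM : IsPreconnected (A1 ∪ A2 ∪ A3 ∪ A4) := by
    have e1 : (-R - 1) • d + (cr d v - 1) • pp d ∈ A1 := by
      change cr d _ < _; rw [hcr]; linarith
    have e2 : (-R - 1) • d + (cr d v - 1) • pp d ∈ A2 := by
      change dt d _ < _; rw [hdt]; linarith
    have e2' : (-R - 1) • d + (R + 1) • pp d ∈ A2 := by
      change dt d _ < _; rw [hdt]; linarith
    have e3 : (-R - 1) • d + (R + 1) • pp d ∈ A3 := by
      change _ < cr d _; rw [hcr]; linarith
    have e3' : (R + 1) • d + (R + 1) • pp d ∈ A3 := by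
      change _ < cr d _; rw [hcr]; linarith
    have e4 : (R + 1) • d + (R + 1) • pp d ∈ A4 := by
      constructor
      · change _ < dt d _; rw [hdt]; linarith
      · change _ < cr d _; rw [hcr]; linarith
    have m1 := c1.union _ e1 e2 c2
    have m2 := m1.union _ (mem_union_right _ e2') e3 c3
    exact m2.union _ (mem_union_right _ e3') e4 c4
  have hMΩ : A1 ∪ A2 ∪ A3 ∪ A4 ⊆ Ω := by
    refine subset_comp_of_isPreconnected F.comp hM (fun p hp => hmem p hp)
      ⟨(|R| + 1) • pp d, Or.inl (Or.inr ?_), ?_⟩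
    · change R < cr d _
      rw [cr_smul_right, cr_pp, hdd]
      linarith [le_abs_self R]
    · refine far_subset_of_unbounded hR F.comp F.unbounded hd.1 (Or.inl ?_)
      rw [cr_smul_right, cr_pp, hdd, mul_one, abs_of_pos (by positivity)]
      linarith [le_abs_self R]
  have hMray : ∀ p ∈ A1 ∪ A2 ∪ A3 ∪ A4, p ∉ lineSet v d (Ioi 0) := by
    rintro p hp ⟨t, ht, rfl⟩
    have ht : 0 < t := ht
    have h1 : cr d (v + t • d) = cr d v := by simp [cr_add_right, cr_smul_right]
    have h2 : dt d (v + t • d) = dt d v + t := by simp [dt_add_right, dt_smul_right, hdd]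
    simp only at hp
    rcases hp with ((hp | hp) | hp) | hp
    · have hp : cr d (v + t • d) < cr d v := hp
      linarith
    · have hp : dt d (v + t • d) < -R := hp
      linarith
    · have hp : R < cr d (v + t • d) := hp
      linarith
    · have hp : cr d v < cr d (v + t • d) := hp.2
      linarith
  have hNA : (N ∩ A1).Nonempty := by
    obtain ⟨p, hp⟩ := sleeve_nonempty F.isOpen hne hd.1 ⟨1, by simp⟩ hrayΩ (c := -1) (by simp)
    refine ⟨p, hp, ?_⟩
    have := hp.2.1
    rw [cr_sub_right] at this
    change cr d p < cr d v
    linarith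
  have hLA : (L ∩ A4).Nonempty := by
    have ht : (2 * |R| + 1) ∈ Ioi (0 : ℝ) := by simp only [mem_Ioi]; positivity
    have hpos := infDist_pos_of_mem F.isOpen hne (hrayΩ ⟨_, ht, rfl⟩)
    have hm := mem_sleeve_of_coord hd.1 (c := 1) (by simp) ht (half_pos hpos) (half_lt_self hpos)
    refine ⟨_, hm, ?_, ?_⟩
    · change R < dt d _
      simp only [dt_add_right, dt_smul_right, hdd, dt_pp, mul_zero, add_zero, mul_one]
      linarith [le_abs_self R, abs_nonneg R]
    · change cr d v < cr d _
      simp only [cr_add_right, cr_smul_right, hdd, cr_pp, cr_self]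
      linarith
  have hall : IsPreconnected (L ∪ (A1 ∪ A2 ∪ A3 ∪ A4) ∪ N) := by
    obtain ⟨p, hpL, hp4⟩ := hLA
    obtain ⟨q, hqN, hq1⟩ := hNA
    have m1 := hL.union _ hpL (mem_union_right (A1 ∪ A2 ∪ A3) hp4) hM
    exact m1.union _ (mem_union_right _ (mem_union_left _ (mem_union_left _
      (mem_union_left _ hq1)))) hqN hN
  refine comps_diff_ncard_le_of_connected hopen hrayΩ ⟨_, ⟨1, by simp, rfl⟩⟩ hall ?_ ?_ ?_
    (by rw [comps_self F.comp]; exact finite_singleton _)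
    (by rw [comps_self F.comp, ncard_singleton])
  · rintro p ((hp | hp) | hp)
    · exact ⟨sleeve_subset hd.1 (by simp) hp,
        fun h => Set.disjoint_left.1 (sleeve_disjoint_lineSet hd.1) hp h⟩
    · exact ⟨hMΩ hp, hMray p hp⟩
    · exact ⟨sleeve_subset hd.1 (by simp) hp,
        fun h => Set.disjoint_left.1 (sleeve_disjoint_lineSet hd.1) hp h⟩
  · exact hLA.mono fun p hp => Or.inl (Or.inl hp.1)
  · intro p hp
    refine mem_of_superset (lineSet_union_sleeve_mem_nhds F.isOpen hne hd.1 isOpen_Ioi hrayΩ hp) ?_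
    rintro q (hq | hq | hq)
    · exact Or.inl hq
    · exact Or.inr (Or.inl (Or.inl hq))
    · exact Or.inr (Or.inr hq)

-- Only slits that start into `Ω` matter. Cutting along them one at a time, the free slit leaves `Ω`
-- connected and each other slit adds at most one component, so the count never exceeds the number
-- of slits. The saving of one here enters twice in `card_add_two_le`.
open scoped Classical in
theorem ncard_comps_cutRegion_le [Finite ι] (F : OuterFrame P Q V Ω) (hd : IsGenericDir V d) :
    (comps (cutRegion Ω (frameSet P Q V) V d)).Finite ∧
      (comps (cutRegion Ω (frameSet P Q V) V d)).ncard ≤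
        (V.filter fun v => PointsInto Ω v d).card +
          (V.filter fun v => PointsInto Ω v (-d)).card := by
  obtain ⟨v₀, hv₀, hpt, hfin, hcard⟩ := F.exists_free_slit hd
  set C := frameSet P Q V with hC
  set sh : Plane × Bool → Set Plane := fun s => shadow C (signedDir d s.2) s.1 with hsh
  set S : Finset (Plane × Bool) :=
    (V ×ˢ Finset.univ).filter fun s => PointsInto Ω s.1 (signedDir d s.2) with hS
  have hSm : ∀ s : Plane × Bool, s ∈ S ↔ s.1 ∈ V ∧ PointsInto Ω s.1 (signedDir d s.2) := by
    intro s
    rw [hS, Finset.mem_filter, Finset.mem_product]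
    exact and_congr_left fun _ => ⟨fun h => h.1, fun h => ⟨h, Finset.mem_univ _⟩⟩
  have hScard : S.card = (V.filter fun v => PointsInto Ω v d).card +
      (V.filter fun v => PointsInto Ω v (-d)).card := by
    have : S = ((V.filter fun v => PointsInto Ω v d).image fun v => (v, true)) ∪
        ((V.filter fun v => PointsInto Ω v (-d)).image fun v => (v, false)) := by
      ext ⟨v, b⟩
      rw [hSm]; cases b <;> simp [signedDir]
    rw [this, Finset.card_union_of_disjoint, Finset.card_image_of_injective,
      Finset.card_image_of_injective]
    · intro a b h; simpa using h
    · intro a b h; simpa using h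
    · rw [Finset.disjoint_left]
      intro a ha hb
      simp only [Finset.mem_image] at ha hb
      obtain ⟨_, _, rfl⟩ := ha
      obtain ⟨_, _, h⟩ := hb
      simp at h
  have h₀ : (v₀, true) ∈ S := (hSm _).2 ⟨hv₀, by simpa [signedDir] using hpt⟩
  have hsh₀ : sh (v₀, true) = shadow C d v₀ := by simp [hsh, signedDir]
  have hdis : ∀ s ∈ S, ∀ s' ∈ S, s ≠ s' → Disjoint (sh s) (sh s') := by
    rintro ⟨v, a⟩ hs ⟨w, b⟩ hs' hne
    exact disjoint_shadow hd ((hSm _).1 hs).1 ((hSm _).1 hs').1 hne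
  have hstep : ∀ A : Finset (Plane × Bool), A ⊆ S.erase (v₀, true) →
      IsOpen ((Ω \ sh (v₀, true)) \ ⋃ s ∈ A, sh s) ∧
      (comps ((Ω \ sh (v₀, true)) \ ⋃ s ∈ A, sh s)).Finite ∧
      (comps ((Ω \ sh (v₀, true)) \ ⋃ s ∈ A, sh s)).ncard ≤ 1 + A.card := by
    intro A
    induction A using Finset.induction_on with
    | empty =>
      intro _
      simp only [Finset.notMem_empty, iUnion_of_empty, iUnion_empty, sdiff_empty,
        Finset.card_empty, add_zero]
      rw [hsh₀]
      exact ⟨isOpen_diff_shadow hd.1 (mem_frameSet_of_vert hv₀) F.isOpen F.subset_compl, hfin,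
        hcard⟩
    | insert s A hsA ih =>
      intro hsub
      obtain ⟨i1, i2, i3⟩ := ih ((Finset.subset_insert _ _).trans hsub)
      have hs' := hsub (Finset.mem_insert_self _ _)
      have hsS := Finset.mem_of_mem_erase hs'
      have hs₀ := Finset.ne_of_mem_erase hs'
      have hsm := (hSm s).1 hsS
      obtain ⟨hne, hsΩ⟩ := F.shadow_of_pointsInto hsm.2
      have heq : (Ω \ sh (v₀, true)) \ ⋃ r ∈ insert s A, sh r =
          ((Ω \ sh (v₀, true)) \ ⋃ r ∈ A, sh r) \ sh s := by
        rw [Finset.set_biUnion_insert, union_comm (sh s)]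
        exact Set.sdiff_sdiff.symm
      have hsubU : sh s ⊆ (Ω \ sh (v₀, true)) \ ⋃ r ∈ A, sh r := by
        refine subset_sdiff.2 ⟨subset_sdiff.2 ⟨hsΩ, hdis s hsS _ h₀ hs₀⟩, ?_⟩
        rw [disjoint_iUnion₂_right]
        intro r hr
        refine hdis s hsS r ?_ fun h => hsA (h ▸ hr)
        exact Finset.mem_of_mem_erase (hsub (Finset.mem_insert_of_mem hr))
      have hUC : (Ω \ sh (v₀, true)) \ ⋃ r ∈ A, sh r ⊆ Cᶜ :=
        sdiff_subset.trans (sdiff_subset.trans F.subset_compl)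
      have hopen := isOpen_diff_shadow (norm_signedDir hd.1 s.2)
        (mem_frameSet_of_vert (P := P) (Q := Q) hsm.1) i1 hUC
      rw [heq]
      refine ⟨hopen, ?_⟩
      rw [Finset.card_insert_of_notMem hsA, ← add_assoc]
      exact comps_diff_lineSet_ncard_le i1
        ⟨s.1, fun h => hUC h (mem_frameSet_of_vert (P := P) (Q := Q) hsm.1)⟩
        (norm_signedDir hd.1 s.2) (isOpen_shadow_param F.isCompact.isClosed)
        (Set.image_nonempty.1 hne) isPreconnected_shadow_param hsubU hopen i2 i3
  have hcut : cutRegion Ω C V d = (Ω \ sh (v₀, true)) \ ⋃ s ∈ S.erase (v₀, true), sh s := by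
    ext p
    constructor
    · rintro ⟨hp, hpv⟩
      have hall : ∀ s ∈ S, p ∉ sh s := by
        rintro ⟨v, b⟩ hs
        have hv := ((hSm _).1 hs).1
        cases b
        · simpa [hsh, signedDir] using (hpv v hv).2
        · simpa [hsh, signedDir] using (hpv v hv).1
      refine ⟨⟨hp, hall _ h₀⟩, ?_⟩
      simp only [mem_iUnion, not_exists]
      exact fun s hs => hall s (Finset.mem_of_mem_erase hs)
    · rintro ⟨⟨hp, hp0⟩, hpr⟩
      have hall : ∀ s ∈ S, p ∉ sh s := by
        intro s hs
        by_cases h : s = (v₀, true)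
        · rw [h]; exact hp0
        · exact fun hps => hpr (mem_iUnion₂.2 ⟨s, Finset.mem_erase.2 ⟨h, hs⟩, hps⟩)
      have hb : ∀ v ∈ V, ∀ b : Bool, p ∉ shadow C (signedDir d b) v := by
        intro v hv b h
        exact hall (v, b) ((hSm _).2 ⟨hv, F.pointsInto_of_mem_shadow h hp⟩) h
      exact ⟨hp, fun v hv => ⟨by simpa [signedDir] using hb v hv true,
        by simpa [signedDir] using hb v hv false⟩⟩
  obtain ⟨-, h2, h3⟩ := hstep _ (Finset.Subset.refl _)
  rw [← hcut] at h2 h3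
  refine ⟨h2, ?_⟩
  rw [← hScard]
  have := Finset.card_erase_add_one h₀
  omega

end OuterFrame

end HardSphere

/-! ### Lower bound for the number of pieces, and the count of directions. -/

namespace HardSphere

open Set Filter Topology Metric

namespace OuterFrame

variable {ι : Type*} {P Q : ι → Plane} {V : Finset Plane} {Ω : Set Plane} {d : Plane}

/-- Slightly above a level there are only levels below the next vertex. -/
theorem exists_next_level (V : Finset Plane) (d : Plane) {a b : ℝ} (hab : a < b) :
    ∃ x, a < x ∧ x < b ∧ ∀ v ∈ V, a < cr d v → x < cr d v := by
  classical
  obtain ⟨m, hm1, hm2⟩ : ∃ m, a < m ∧ ∀ v ∈ V, a < cr d v → m ≤ cr d v := by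
    by_cases h : (V.filter fun v => a < cr d v).Nonempty
    · obtain ⟨w, hw, hmin⟩ := Finset.exists_min_image _ (cr d) h
      exact ⟨cr d w, (Finset.mem_filter.1 hw).2,
        fun v hv hav => hmin v (Finset.mem_filter.2 ⟨hv, hav⟩)⟩
    · exact ⟨b, hab, fun v hv hav => absurd ⟨v, Finset.mem_filter.2 ⟨hv, hav⟩⟩ h⟩
  obtain ⟨x, hx1, hx2⟩ := exists_between (lt_min hab hm1)
  exact ⟨x, hx1, hx2.trans_le (min_le_left _ _),
    fun v hv hav => (hx2.trans_le (min_le_right _ _)).trans_le (hm2 v hv hav)⟩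

/-- The open segment `i` has a point at each level between those of its endpoints. -/
theorem exists_mem_edge_of_level {x y : Plane} {t : ℝ} (h1 : cr d x < t) (h2 : t < cr d y) :
    ∃ q ∈ openSegment ℝ x y, cr d q = t := by
  refine ⟨x + ((t - cr d x) / (cr d y - cr d x)) • (y - x), ?_, ?_⟩
  · rw [← lineSet_Ioo_eq_openSegment]
    refine ⟨_, ⟨div_pos (by linarith) (by linarith), (div_lt_one (by linarith)).2 (by linarith)⟩, rfl⟩
  · rw [cr_add_right, cr_smul_right, cr_sub_right, div_mul_cancel₀ _ (by linarith)]
    ring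

theorem min_lt_cr_lt_max {x y q : Plane} (hne : cr d x ≠ cr d y) (hq : q ∈ openSegment ℝ x y) :
    min (cr d x) (cr d y) < cr d q ∧ cr d q < max (cr d x) (cr d y) := by
  obtain ⟨a, b, ha, hb, hab, rfl⟩ := hq
  rw [cr_add_right, cr_smul_right, cr_smul_right]
  obtain rfl : a = 1 - b := by linarith
  rcases lt_or_gt_of_ne hne with h | h
  · rw [min_eq_left h.le, max_eq_right h.le]; constructor <;> nlinarith
  · rw [min_eq_right h.le, max_eq_left h.le]; constructor <;> nlinarith

theorem exists_mem_edge_of_level' {x y : Plane} {t : ℝ} (h1 : min (cr d x) (cr d y) < t)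
    (h2 : t < max (cr d x) (cr d y)) : ∃ q ∈ openSegment ℝ x y, cr d q = t := by
  rcases le_total (cr d x) (cr d y) with h | h
  · rw [min_eq_left h] at h1; rw [max_eq_right h] at h2
    exact exists_mem_edge_of_level h1 h2
  · rw [min_eq_right h] at h1; rw [max_eq_left h] at h2
    rw [openSegment_symm]
    exact exists_mem_edge_of_level h1 h2

/-- `T` is a component of the cut region above the wall `W` whose left end is at the level `a`:
it has points slightly to the right of `a`. -/
def StartsAt (P Q : ι → Plane) (V : Finset Plane) (Ω : Set Plane) (d : Plane) (W : Option ι) (a : ℝ)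
    (T : Set Plane) : Prop :=
  T ∈ comps (cutRegion Ω (frameSet P Q V) V d) ∧ T ⊆ wallRegion P Q V d W ∧
    ∃ z ∈ T, a < cr d z ∧ ∀ v ∈ V, a < cr d v → cr d z < cr d v

/-- No component above the wall `W` meets the level `a`. -/
def Separates (P Q : ι → Plane) (V : Finset Plane) (Ω : Set Plane) (d : Plane) (W : Option ι)
    (a : ℝ) : Prop :=
  ∀ T ∈ comps (cutRegion Ω (frameSet P Q V) V d), T ⊆ wallRegion P Q V d W → ∀ r ∈ T, cr d r ≠ a

/-- If `a < a'`, then `T` has a point before the vertex level `a'` and a point after it, hence by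
connectedness one at this level, which separation forbids. So the left end is an invariant of the
piece. -/
theorem level_le_of_startsAt {W W' : Option ι} {a a' : ℝ} {T : Set Plane}
    (h : StartsAt P Q V Ω d W a T) (h' : StartsAt P Q V Ω d W' a' T) (ha' : ∃ v ∈ V, cr d v = a')
    (hs : Separates P Q V Ω d W' a') : a' ≤ a := by
  by_contra hlt
  rw [not_le] at hlt
  obtain ⟨v, hv, rfl⟩ := ha'
  obtain ⟨hT, -, z, hz, -, hz2⟩ := h
  obtain ⟨-, hW', z', hz', hz1', -⟩ := h'
  have h3 := hz2 v hv hlt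
  obtain ⟨r, hr, hre⟩ := (isPreconnected_of_mem_comps hT).intermediate_value hz hz'
    (continuous_cr d).continuousOn ⟨h3.le, hz1'.le⟩
  exact hs T hT hW' r hr hre

theorem exists_startsAt_edge [Finite ι] (F : OuterFrame P Q V Ω) (hd : IsGenericDir V d) {i : ι}
    {q₀ : Plane} (hq₀ : q₀ ∈ openSegment ℝ (P i) (Q i)) (h : PointsInto Ω q₀ d) {a : ℝ}
    (h1 : min (cr d (P i)) (cr d (Q i)) ≤ a) (h2 : a < max (cr d (P i)) (cr d (Q i))) :
    ∃ T, StartsAt P Q V Ω d (some i) a T := by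
  obtain ⟨x, hx1, hx2, hx3⟩ := exists_next_level V d h2
  obtain ⟨q, hq, rfl⟩ := exists_mem_edge_of_level' (h1.trans_lt hx1) hx2
  obtain ⟨z, hz, hzW, hzq⟩ := F.exists_mem_cutRegion_edge hd hq₀ h hq fun v hv he => by
    have := hx3 v hv (by rw [← he]; exact hx1)
    linarith
  have hT := comp_mem_comps hz
  have hzT := mem_connectedComponentIn hz
  exact ⟨_, hT, F.subset_wallRegion hd hT hzT hzW, z, hzT, by rw [hzq]; exact hx1,
    by rw [hzq]; exact hx3⟩

theorem exists_startsAt_none [Finite ι] (F : OuterFrame P Q V Ω) (hd : IsGenericDir V d) (a : ℝ) :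
    ∃ T, StartsAt P Q V Ω d none a T := by
  obtain ⟨x, hx1, -, hx3⟩ := exists_next_level V d (lt_add_one a)
  obtain ⟨z, hz, hzW, hzx⟩ := F.exists_mem_cutRegion_none hd (a := x) fun v hv he => by
    have := hx3 v hv (by rw [← he]; exact hx1)
    linarith
  have hT := comp_mem_comps hz
  have hzT := mem_connectedComponentIn hz
  exact ⟨_, hT, F.subset_wallRegion hd hT hzT hzW, z, hzT, by rw [hzx]; exact hx1,
    by rw [hzx]; exact hx3⟩

theorem separates_edge (F : OuterFrame P Q V Ω) (hd : IsGenericDir V d) (i : ι) :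
    Separates P Q V Ω d (some i) (min (cr d (P i)) (cr d (Q i))) := by
  intro T _ hTW r hr
  obtain ⟨q, hq, hrq⟩ := hTW hr
  rw [cr_of_mem_shadow hrq]
  refine (min_lt_cr_lt_max ?_ hq).1.ne'
  intro he
  exact F.cr_edge_ne hd i (by rw [cr_sub_right, he, sub_self])

/-- Each line downwards from a vertex starts a component. -/
theorem exists_startsAt_slit [Finite ι] (F : OuterFrame P Q V Ω) (hd : IsGenericDir V d)
    {v : Plane} (hv : v ∈ V) (h : PointsInto Ω v (-d)) :
    ∃ W, (∀ i, W = some i → min (cr d (P i)) (cr d (Q i)) < cr d v) ∧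
      Separates P Q V Ω d W (cr d v) ∧ ∃ T, StartsAt P Q V Ω d W (cr d v) T := by
  obtain ⟨⟨z, hz⟩, hsub⟩ := F.shadow_of_pointsInto h
  have hzcr : cr d z = cr d v := by
    have := cr_of_mem_shadow hz
    rw [cr_neg_left, cr_neg_left] at this
    linarith
  have hzC : z ∉ frameSet P Q V := F.subset_compl (hsub hz)
  have hsh : ∀ w ∈ V, z ∉ shadow (frameSet P Q V) d w := by
    intro w hw hzw
    have hwv := hd.eq_of_cr_eq hw hv ((cr_of_mem_shadow hzw).symm.trans hzcr)
    subst hwv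
    have hdd := norm_eq_one_iff.1 hd.1
    obtain ⟨s, ⟨hs, -⟩, rfl⟩ := hz
    obtain ⟨t, ⟨ht, -⟩, he⟩ := hzw
    have := congrArg (dt d) (add_left_cancel he)
    rw [dt_smul_right, dt_smul_right, dt_neg_right, hdd] at this
    linarith
  obtain ⟨W, hW⟩ := F.exists_wallRegion hzC hsh
  refine ⟨W, ?_, fun T hT hTW r hr =>
    F.cr_ne_of_lands hd (subset_of_mem_comps hT) hTW hv hz hW hr, ?_⟩
  · rintro i rfl
    obtain ⟨q, hq, hzq⟩ := hW
    rw [← hzcr, cr_of_mem_shadow hzq]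
    refine (min_lt_cr_lt_max ?_ hq).1
    intro he
    exact F.cr_edge_ne hd i (by rw [cr_sub_right, he, sub_self])
  · cases W with
    | none => exact F.exists_startsAt_none hd _
    | some i =>
      obtain ⟨q, hq, hzq⟩ := hW
      have hne : cr d (P i) ≠ cr d (Q i) := fun he =>
        F.cr_edge_ne hd i (by rw [cr_sub_right, he, sub_self])
      have hlev := min_lt_cr_lt_max hne hq
      rw [← cr_of_mem_shadow hzq, hzcr] at hlev
      exact F.exists_startsAt_edge hd hq (F.pointsInto_of_mem_shadow hzq (hsub hz)) hlev.1.le hlev.2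

-- A left end over a wall is the left end of the wall itself, or minus infinity for the wall at
-- infinity, or a downward slit landing on the wall. Distinct pairs of a wall and a left end give
-- distinct pieces: wall regions are disjoint, and `level_le_of_startsAt` recovers the level.
open scoped Classical in
theorem le_ncard_comps_cutRegion [Fintype ι] (F : OuterFrame P Q V Ω) (hd : IsGenericDir V d) :
    (Finset.univ.filter fun i => ∀ q ∈ openSegment ℝ (P i) (Q i), PointsInto Ω q d).card + 1 +
      (V.filter fun v => PointsInto Ω v (-d)).card ≤
        (comps (cutRegion Ω (frameSet P Q V) V d)).ncard := by
  have hfin := (F.ncard_comps_cutRegion_le hd).1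
  obtain ⟨v₀, hv₀, hmin⟩ := V.exists_min_image (cr d) F.nonempty
  set A := Finset.univ.filter fun i => ∀ q ∈ openSegment ℝ (P i) (Q i), PointsInto Ω q d with hA
  set B := V.filter fun v => PointsInto Ω v (-d) with hB
  have hslit : ∀ v : B, ∃ W, (∀ i, W = some i → min (cr d (P i)) (cr d (Q i)) < cr d v) ∧
      Separates P Q V Ω d W (cr d v) ∧ ∃ T, StartsAt P Q V Ω d W (cr d v) T := fun v =>
    F.exists_startsAt_slit hd (Finset.mem_filter.1 v.2).1 (Finset.mem_filter.1 v.2).2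
  choose wall hw1 hw2 hw3 using hslit
  let W : (A ⊕ Unit) ⊕ B → Option ι :=
    Sum.elim (Sum.elim (fun i => some i.1) fun _ => none) wall
  -- The value `cr d v₀ - 1` precedes the levels of all vertices and stands for minus infinity.
  let lev : (A ⊕ Unit) ⊕ B → ℝ :=
    Sum.elim (Sum.elim (fun i => min (cr d (P i.1)) (cr d (Q i.1))) fun _ => cr d v₀ - 1)
      fun v => cr d v.1
  have hex : ∀ k, ∃ T, StartsAt P Q V Ω d (W k) (lev k) T := by
    rintro ((i | _) | v)
    · have hi := (Finset.mem_filter.1 i.2).2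
      obtain ⟨q, hq⟩ : (openSegment ℝ (P i) (Q i)).Nonempty :=
        ⟨(1 / 2 : ℝ) • P i + (1 / 2 : ℝ) • Q i, 1 / 2, 1 / 2, by norm_num, by norm_num, by norm_num,
          rfl⟩
      refine F.exists_startsAt_edge hd hq (hi q hq) le_rfl ?_
      refine min_lt_max.2 fun he => F.cr_edge_ne hd i (by rw [cr_sub_right, he, sub_self])
    · exact F.exists_startsAt_none hd _
    · exact hw3 v
  have hlevel : ∀ k, (k ≠ Sum.inl (Sum.inr ()) →
      (∃ v ∈ V, cr d v = lev k) ∧ Separates P Q V Ω d (W k) (lev k)) := by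
    rintro ((i | _) | v) hk
    · refine ⟨?_, F.separates_edge hd i⟩
      rcases min_choice (cr d (P i.1)) (cr d (Q i.1)) with h | h
      · exact ⟨_, F.left_mem i, h.symm⟩
      · exact ⟨_, F.right_mem i, h.symm⟩
    · exact absurd rfl hk
    · exact ⟨⟨v, (Finset.mem_filter.1 v.2).1, rfl⟩, hw2 v⟩
  choose f hf using hex
  have hlow : ∀ k, cr d v₀ - 1 ≤ lev k := by
    intro k
    by_cases hk : k = Sum.inl (Sum.inr ())
    · subst hk; exact le_rfl
    · obtain ⟨⟨v, hv, he⟩, -⟩ := hlevel k hk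
      linarith [hmin v hv]
  have hlevinf : ∀ k, k ≠ Sum.inl (Sum.inr ()) → cr d v₀ - 1 < lev k := by
    intro k hk
    obtain ⟨⟨v, hv, he⟩, -⟩ := hlevel k hk
    linarith [hmin v hv]
  have hle : ∀ k l, f k = f l → lev k ≤ lev l := by
    intro k l hkl
    by_cases hk : k = Sum.inl (Sum.inr ())
    · subst hk; exact hlow l
    · obtain ⟨h1, h2⟩ := hlevel k hk
      exact level_le_of_startsAt (hf l) (hkl ▸ hf k) h1 h2
  have hinj : Function.Injective f := by
    intro k l hkl
    have hl : lev k = lev l := le_antisymm (hle k l hkl) (hle l k hkl.symm)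
    have hW : W k = W l := by
      obtain ⟨-, h1, z, hz, -⟩ := hf k
      obtain ⟨-, h2, -⟩ := hf l
      exact F.wallRegion_unique (h1 hz) (h2 (hkl ▸ hz))
    rcases k with (i | ⟨⟩) | v <;> rcases l with (j | ⟨⟩) | w
    · have : i.1 = j.1 := Option.some.inj hW
      rw [Subtype.ext this]
    · exact absurd hW (by simp [W])
    · have := hw1 w i hW.symm
      exact absurd hl this.ne
    · exact absurd hW (by simp [W])
    · rfl
    · exact absurd hl (hlevinf (Sum.inr w) (by simp)).ne
    · have := hw1 v j hW
      exact absurd hl this.ne'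
    · exact absurd hl (hlevinf (Sum.inr v) (by simp)).ne'
    · have := hd.eq_of_cr_eq (Finset.mem_filter.1 v.2).1 (Finset.mem_filter.1 w.2).1 hl
      rw [Subtype.ext this]
  have hcard : (Finset.univ.image f).card = A.card + 1 + B.card := by
    rw [Finset.card_image_of_injective _ hinj, Finset.card_univ]
    simp
  rw [← hcard, ← ncard_coe_finset]
  refine ncard_le_ncard ?_ hfin
  intro T hT
  simp only [Finset.coe_image, Finset.coe_univ, image_univ, mem_range] at hT
  obtain ⟨k, rfl⟩ := hT
  exact (hf k).1

open scoped Classical in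
/-- The number of vertical directions at the vertices that point into the unbounded component. -/
theorem card_add_two_le [Fintype ι] (F : OuterFrame P Q V Ω) (hd : IsGenericDir V d) :
    Fintype.card ι + 2 ≤ (V.filter fun v => PointsInto Ω v d).card +
      (V.filter fun v => PointsInto Ω v (-d)).card := by
  have h1 := F.le_ncard_comps_cutRegion hd
  -- Turning the picture upside down leaves the cut region unchanged and exchanges upward and
  -- downward slits.
  have h2 := F.le_ncard_comps_cutRegion hd.neg
  have h3 := (F.ncard_comps_cutRegion_le hd).2
  rw [cutRegion_neg, neg_neg] at h2
  -- Every edge has `Ω` above or below it, and the side does not vary along the edge. Adding the two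
  -- lower bounds to twice the upper bound leaves the claim.
  have h4 : Fintype.card ι ≤
      (Finset.univ.filter fun i => ∀ q ∈ openSegment ℝ (P i) (Q i), PointsInto Ω q d).card +
      (Finset.univ.filter fun i => ∀ q ∈ openSegment ℝ (P i) (Q i), PointsInto Ω q (-d)).card := by
    rw [← Finset.card_univ]
    refine le_trans (Finset.card_le_card ?_) (Finset.card_union_le _ _)
    intro i _
    obtain ⟨q, hq, hqΩ⟩ := F.side i
    rw [Finset.mem_union, Finset.mem_filter, Finset.mem_filter]
    rcases pointsInto_or_of_mem_closure (F.isClosed_rest i) (F.rest_nonempty i) (F.unit i)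
      (F.disjoint_rest i) (F.comp_rest i) hq (F.cr_edge_ne' hd i) hqΩ with h | h
    · exact Or.inl ⟨Finset.mem_univ _, fun q' hq' => PointsInto.of_edge (F.isClosed_rest i)
        (F.rest_nonempty i) (F.unit i) (F.disjoint_rest i) (F.comp_rest i) hq (F.cr_edge_ne' hd i)
        h hq'⟩
    · exact Or.inr ⟨Finset.mem_univ _, fun q' hq' => PointsInto.of_edge (F.isClosed_rest i)
        (F.rest_nonempty i) (F.unit i) (F.disjoint_rest i) (F.comp_rest i) hq
        (F.cr_edge_ne' hd.neg i) h hq'⟩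
  omega

end OuterFrame

end HardSphere

namespace HardSphere

open Set Filter Topology Metric

/-! ### Planarity of the bond graph -/

theorem bondGraph_adj {X : Finset Plane} {x y : Plane} :
    (bondGraph X).Adj x y ↔ x ∈ X ∧ y ∈ X ∧ dist x y = 1 := Iff.rfl

theorem norm_sub_of_adj {X : Finset Plane} {x y : Plane} (h : (bondGraph X).Adj x y) :
    ‖y - x‖ = 1 := by rw [← dist_eq_norm, dist_comm]; exact h.2.2

theorem IsHardSphere.notMem_openSegment {X : Finset Plane} (hX : IsHardSphere X) {x y z : Plane}
    (h : (bondGraph X).Adj x y) (hz : z ∈ X) : z ∉ openSegment ℝ x y := by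
  rw [← lineSet_Ioo_eq_openSegment]
  rintro ⟨t, ht, rfl⟩
  have hn : dist x (x + t • (y - x)) = t := by
    rw [dist_comm, dist_eq_norm, add_sub_cancel_left, norm_smul, norm_sub_of_adj h, mul_one,
      Real.norm_eq_abs, abs_of_pos ht.1]
  have hne : x ≠ x + t • (y - x) := by
    intro he
    rw [← he, dist_self] at hn
    exact ht.1.ne hn
  have := hX x h.1 _ hz hne
  rw [hn] at this
  linarith [ht.2]

/-- Unit segments from a common endpoint that meet again coincide. If bonds without common endpoint
meet at parameters `s` and `t`, a weighted mean of the four squared distances between their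
endpoints equals `s (1 - s) + t (1 - t) ≤ 1 / 2`, although each is at least `1`. -/
theorem IsHardSphere.disjoint_openSegment_segment {X : Finset Plane} (hX : IsHardSphere X)
    {x y z w : Plane} (h : (bondGraph X).Adj x y) (h' : (bondGraph X).Adj z w)
    (hne : s(x, y) ≠ s(z, w)) : Disjoint (openSegment ℝ x y) (segment ℝ z w) := by
  rw [Set.disjoint_left, ← lineSet_Ioo_eq_openSegment, ← lineSet_Icc_eq_segment]
  rintro _ ⟨s, hs, rfl⟩ ⟨t, ht, he⟩
  simp only at he
  have hxy := norm_sub_of_adj h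
  have hzw := norm_sub_of_adj h'
  have key : ∀ a b c d' : Plane, ‖b - a‖ = 1 → ‖d' - a‖ = 1 → ∀ s t : ℝ, 0 < s → 0 ≤ t →
      c = a → a + t • (d' - a) = a + s • (b - a) → b = d' := by
    intro a b c d' h1 h2 s t hs ht _ he
    have he' := add_left_cancel he
    have hn := congrArg norm he'
    rw [norm_smul, norm_smul, h1, h2, mul_one, mul_one, Real.norm_eq_abs, Real.norm_eq_abs,
      abs_of_nonneg ht, abs_of_pos hs] at hn
    rw [hn] at he'
    have := smul_right_injective Plane hs.ne' he'
    exact (sub_left_inj.1 this).symm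
  have hxz : x ≠ z := by
    rintro rfl
    have := key x y x w hxy hzw s t hs.1 ht.1 rfl he
    exact hne (by rw [this])
  have hyz : y ≠ z := by
    rintro rfl
    have := key y x y w (by rw [norm_sub_rev, hxy]) hzw (1 - s) t (by linarith [hs.2]) ht.1 rfl
      (by rw [he, sub_smul, one_smul, smul_sub, smul_sub]; abel)
    exact hne (by rw [this, Sym2.eq_swap])
  have hxw : x ≠ w := by
    rintro rfl
    have := key x y x z hxy (by rw [norm_sub_rev, hzw]) s (1 - t) hs.1 (by linarith [ht.2]) rfl
      (by rw [← he, sub_smul, one_smul, smul_sub, smul_sub]; abel)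
    exact hne (by rw [this, Sym2.eq_swap])
  have hyw : y ≠ w := by
    rintro rfl
    have := key y x y z (by rw [norm_sub_rev, hxy]) (by rw [norm_sub_rev, hzw]) (1 - s) (1 - t)
      (by linarith [hs.2]) (by linarith [ht.2]) rfl
      (by
        have e1 : y + (1 - t) • (z - y) = z + t • (y - z) := by
          rw [sub_smul, one_smul, smul_sub, smul_sub]; abel
        have e2 : y + (1 - s) • (x - y) = x + s • (y - x) := by
          rw [sub_smul, one_smul, smul_sub, smul_sub]; abel
        rw [e1, e2, he])
    exact hne (by rw [this])
  have b1 : 1 ≤ dt (x - z) (x - z) := one_le_norm_iff.1 (by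
    rw [← dist_eq_norm]; exact hX x h.1 z h'.1 hxz)
  have b2 : 1 ≤ dt (y - z) (y - z) := one_le_norm_iff.1 (by
    rw [← dist_eq_norm]; exact hX y h.2.1 z h'.1 hyz)
  have b3 : 1 ≤ dt (x - w) (x - w) := one_le_norm_iff.1 (by
    rw [← dist_eq_norm]; exact hX x h.1 w h'.2.1 hxw)
  have b4 : 1 ≤ dt (y - w) (y - w) := one_le_norm_iff.1 (by
    rw [← dist_eq_norm]; exact hX y h.2.1 w h'.2.1 hyw)
  have n1 := norm_eq_one_iff.1 hxy
  have n2 := norm_eq_one_iff.1 hzw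
  have e0 := congrArg (fun p : Plane => p 0) he
  have e1 := congrArg (fun p : Plane => p 1) he
  simp only [dt, PiLp.sub_apply, PiLp.add_apply, PiLp.smul_apply, smul_eq_mul] at *
  have ident : (1 - s) * (1 - t) * ((x 0 - z 0) * (x 0 - z 0) + (x 1 - z 1) * (x 1 - z 1)) +
      s * (1 - t) * ((y 0 - z 0) * (y 0 - z 0) + (y 1 - z 1) * (y 1 - z 1)) +
      (1 - s) * t * ((x 0 - w 0) * (x 0 - w 0) + (x 1 - w 1) * (x 1 - w 1)) +
      s * t * ((y 0 - w 0) * (y 0 - w 0) + (y 1 - w 1) * (y 1 - w 1)) =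
      s * (1 - s) + t * (1 - t) := by
    have z0 : z 0 = x 0 + s * (y 0 - x 0) - t * (w 0 - z 0) := by linarith
    have z1 : z 1 = x 1 + s * (y 1 - x 1) - t * (w 1 - z 1) := by linarith
    linear_combination (s * (1 - s)) * n1 + (t * (1 - t)) * n2 +
      (x 0 + s * (y 0 - x 0) - (z 0 + t * (w 0 - z 0))) * (-1) * e0 +
      (x 1 + s * (y 1 - x 1) - (z 1 + t * (w 1 - z 1))) * (-1) * e1
  have w1 : 0 ≤ (1 - s) * (1 - t) := mul_nonneg (by linarith [hs.2]) (by linarith [ht.2])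
  have w2 : 0 ≤ s * (1 - t) := mul_nonneg hs.1.le (by linarith [ht.2])
  have w3 : 0 ≤ (1 - s) * t := mul_nonneg (by linarith [hs.2]) ht.1
  have w4 : 0 ≤ s * t := mul_nonneg hs.1.le ht.1
  nlinarith [mul_le_mul_of_nonneg_left b1 w1, mul_le_mul_of_nonneg_left b2 w2,
    mul_le_mul_of_nonneg_left b3 w3, mul_le_mul_of_nonneg_left b4 w4, sq_nonneg (s - 1 / 2),
    sq_nonneg (t - 1 / 2)]

theorem finite_edgeSet (X : Finset Plane) : (bondGraph X).edgeSet.Finite := by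
  refine (Finset.finite_toSet X.sym2).subset fun e he => ?_
  induction e with
  | h x y =>
    have h : (bondGraph X).Adj x y := he
    exact Finset.mk_mem_sym2_iff.2 ⟨h.1, h.2.1⟩

@[simp] theorem edgeSegment_mk (x y : Plane) : edgeSegment s(x, y) = segment ℝ x y := rfl

theorem isCompact_edgeSegment (e : Sym2 Plane) : IsCompact (edgeSegment e) := by
  induction e with
  | h x y => exact isCompact_segment x y

theorem isCompact_drawing (X : Finset Plane) : IsCompact (drawing X) :=
  X.finite_toSet.isCompact.union ((finite_edgeSet X).isCompact_biUnion fun e _ =>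
    isCompact_edgeSegment e)

theorem isOpen_compl_drawing (X : Finset Plane) : IsOpen (drawing X)ᶜ :=
  (isCompact_drawing X).isClosed.isOpen_compl

/-- The drawn bond graph without the edge `e`. -/
def restDrawing (X : Finset Plane) (e : Sym2 Plane) : Set Plane :=
  (X : Set Plane) ∪ ⋃ e' ∈ (bondGraph X).edgeSet \ {e}, edgeSegment e'

theorem isClosed_restDrawing (X : Finset Plane) (e : Sym2 Plane) : IsClosed (restDrawing X e) :=
  (X.finite_toSet.isCompact.union (((finite_edgeSet X).subset sdiff_subset).isCompact_biUnion
    fun e _ => isCompact_edgeSegment e)).isClosed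

theorem segment_subset_drawing {X : Finset Plane} {x y : Plane} (h : (bondGraph X).Adj x y) :
    segment ℝ x y ⊆ drawing X := fun _ hp =>
  Or.inr (mem_iUnion₂.2 ⟨s(x, y), h, hp⟩)

theorem segment_eq_openSegment_union (x y : Plane) :
    segment ℝ x y = {x, y} ∪ openSegment ℝ x y := by
  rw [← insert_endpoints_openSegment, insert_union, singleton_union]

section Adj

variable {X : Finset Plane} {x y : Plane}

theorem drawing_eq (h : (bondGraph X).Adj x y) :
    drawing X = restDrawing X s(x, y) ∪ openSegment ℝ x y := by
  ext p
  constructor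
  · rintro (hp | hp)
    · exact Or.inl (Or.inl hp)
    · obtain ⟨e, he, hpe⟩ := mem_iUnion₂.1 hp
      by_cases hxy : e = s(x, y)
      · subst hxy
        rw [edgeSegment_mk, segment_eq_openSegment_union] at hpe
        rcases hpe with (rfl | rfl) | hpe
        · exact Or.inl (Or.inl h.1)
        · exact Or.inl (Or.inl h.2.1)
        · exact Or.inr hpe
      · exact Or.inl (Or.inr (mem_iUnion₂.2 ⟨e, ⟨he, hxy⟩, hpe⟩))
  · rintro ((hp | hp) | hp)
    · exact Or.inl hp
    · obtain ⟨e, he, hpe⟩ := mem_iUnion₂.1 hp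
      exact Or.inr (mem_iUnion₂.2 ⟨e, he.1, hpe⟩)
    · exact segment_subset_drawing h (openSegment_subset_segment ℝ _ _ hp)

theorem restDrawing_nonempty (h : (bondGraph X).Adj x y) (e : Sym2 Plane) :
    (restDrawing X e).Nonempty := ⟨x, Or.inl h.1⟩

theorem disjoint_restDrawing (hX : IsHardSphere X) (h : (bondGraph X).Adj x y) :
    Disjoint (openSegment ℝ x y) (restDrawing X s(x, y)) := by
  refine disjoint_union_right.2 ⟨?_, ?_⟩
  · rw [Set.disjoint_left]
    exact fun p hp hpX => hX.notMem_openSegment h hpX hp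
  · rw [disjoint_iUnion₂_right]
    rintro e ⟨he, hne⟩
    induction e with
    | h z w => exact hX.disjoint_openSegment_segment h he fun hh => hne hh.symm

/-- The component of the complement of the drawn bond graph to the left of the edge from `x` to
`y`. -/
def leftComp (X : Finset Plane) (x y : Plane) : Set Plane :=
  connectedComponentIn (drawing X)ᶜ
    (Classical.epsilon fun p => p ∈ edgeSide (restDrawing X s(x, y)) x y)

theorem edgeSide_subset_compl_drawing (h : (bondGraph X).Adj x y) :
    edgeSide (restDrawing X s(x, y)) x y ⊆ (drawing X)ᶜ := by
  rw [drawing_eq h]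
  exact edgeSide_subset (norm_sub_of_adj h)

theorem epsilon_mem_edgeSide (hX : IsHardSphere X) (h : (bondGraph X).Adj x y) :
    (Classical.epsilon fun p => p ∈ edgeSide (restDrawing X s(x, y)) x y) ∈
      edgeSide (restDrawing X s(x, y)) x y :=
  Classical.epsilon_spec (edgeSide_nonempty (isClosed_restDrawing X _)
    (restDrawing_nonempty h _) (norm_sub_of_adj h) (disjoint_restDrawing hX h))

theorem leftComp_mem_comps (hX : IsHardSphere X) (h : (bondGraph X).Adj x y) :
    leftComp X x y ∈ comps (drawing X)ᶜ :=
  comp_mem_comps (edgeSide_subset_compl_drawing h (epsilon_mem_edgeSide hX h))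

theorem edgeSide_subset_leftComp (hX : IsHardSphere X) (h : (bondGraph X).Adj x y) :
    edgeSide (restDrawing X s(x, y)) x y ⊆ leftComp X x y :=
  (isPreconnected_edgeSide (isClosed_restDrawing X _)
    (restDrawing_nonempty h _) (norm_sub_of_adj h) (disjoint_restDrawing hX h)).subset_connectedComponentIn
    (epsilon_mem_edgeSide hX h) (edgeSide_subset_compl_drawing h)

theorem eq_leftComp_of_mem (hX : IsHardSphere X) (h : (bondGraph X).Adj x y) {f : Set Plane}
    (hf : f ∈ comps (drawing X)ᶜ) {p : Plane} (hp : p ∈ edgeSide (restDrawing X s(x, y)) x y)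
    (hpf : p ∈ f) : leftComp X x y = f :=
  comps_eq_of_mem (leftComp_mem_comps hX h) hf (edgeSide_subset_leftComp hX h hp) hpf

theorem eq_leftComp_of_mem_closure (hX : IsHardSphere X) (h : (bondGraph X).Adj x y) {f : Set Plane}
    (hf : f ∈ comps (drawing X)ᶜ) {p : Plane} (hp : p ∈ openSegment ℝ x y) (hpf : p ∈ closure f) :
    leftComp X x y = f ∨ leftComp X y x = f := by
  have hf' := hf
  rw [drawing_eq h] at hf'
  rcases edgeSide_subset_of_mem_closure (isClosed_restDrawing X _) (restDrawing_nonempty h _)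
    (norm_sub_of_adj h) (disjoint_restDrawing hX h) hf' hp hpf with hs | hs
  · exact Or.inl (eq_leftComp_of_mem hX h hf (epsilon_mem_edgeSide hX h)
      (hs (epsilon_mem_edgeSide hX h)))
  · rw [Sym2.eq_swap] at hs
    exact Or.inr (eq_leftComp_of_mem hX h.symm hf (epsilon_mem_edgeSide hX h.symm)
      (hs (epsilon_mem_edgeSide hX h.symm)))

theorem segment_subset_frontier_leftComp (hX : IsHardSphere X) (h : (bondGraph X).Adj x y) :
    segment ℝ x y ⊆ frontier (leftComp X x y) := by
  have hm := leftComp_mem_comps hX h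
  have ho : openSegment ℝ x y ⊆ closure (leftComp X x y) :=
    (subset_closure_edgeSide (isClosed_restDrawing X _) (restDrawing_nonempty h _)
      (norm_sub_of_adj h) (disjoint_restDrawing hX h)).trans
      (closure_mono (edgeSide_subset_leftComp hX h))
  rw [(isOpen_of_mem_comps (isOpen_compl_drawing X) hm).frontier_eq]
  refine subset_sdiff.2 ⟨segment_subset_closure_openSegment.trans
    (closure_minimal ho isClosed_closure), ?_⟩
  rw [Set.disjoint_left]
  exact fun p hp hpf => subset_of_mem_comps hm hpf (segment_subset_drawing h hp)

/-- One accumulation point on the open edge is enough: a component close to it contains one of the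
two sides. -/
theorem segment_subset_frontier_iff (hX : IsHardSphere X) (h : (bondGraph X).Adj x y) {f : Set Plane}
    (hf : f ∈ comps (drawing X)ᶜ) :
    segment ℝ x y ⊆ frontier f ↔ leftComp X x y = f ∨ leftComp X y x = f := by
  constructor
  · intro hs
    obtain ⟨p, hp⟩ := openEdgeSegment_nonempty s(x, y)
    exact eq_leftComp_of_mem_closure hX h hf hp
      (frontier_subset_closure (hs (openSegment_subset_segment ℝ _ _ hp)))
  · rintro (rfl | rfl)
    · exact segment_subset_frontier_leftComp hX h
    · rw [segment_symm]
      exact segment_subset_frontier_leftComp hX h.symm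

theorem frontier_subset_drawing {f : Set Plane} (hf : f ∈ comps (drawing X)ᶜ) :
    frontier f ⊆ drawing X := by
  have := disjoint_frontier_of_mem_comps (isOpen_compl_drawing X) hf
  exact fun _ hp => not_not.1 fun hpd => Set.disjoint_left.1 this hp hpd

/-- Close to a particle the drawn bond graph consists of the bonds at this particle. -/
theorem exists_ball_drawing (hX : IsHardSphere X) (hxX : x ∈ X) : ∃ r > 0, ∀ p ∈ ball x r,
    p ∈ drawing X → p = x ∨ ∃ y, (bondGraph X).Adj x y ∧ p ∈ openSegment ℝ x y := by
  have hcl : IsClosed (((X : Set Plane) \ {x}) ∪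
      ⋃ e ∈ {e | e ∈ (bondGraph X).edgeSet ∧ x ∉ e}, edgeSegment e) :=
    ((X.finite_toSet.subset sdiff_subset).isCompact.union
      (((finite_edgeSet X).subset fun e he => he.1).isCompact_biUnion fun e _ =>
        isCompact_edgeSegment e)).isClosed
  have hx : x ∉ (((X : Set Plane) \ {x}) ∪
      ⋃ e ∈ {e | e ∈ (bondGraph X).edgeSet ∧ x ∉ e}, edgeSegment e) := by
    rintro (hx | hx)
    · exact hx.2 rfl
    · obtain ⟨e, ⟨he, hxe⟩, hpe⟩ := mem_iUnion₂.1 hx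
      induction e with
      | h a b =>
        rw [edgeSegment_mk, segment_eq_openSegment_union] at hpe
        rcases hpe with (rfl | rfl) | hpe
        · exact hxe (Sym2.mem_mk_left _ _)
        · exact hxe (Sym2.mem_mk_right _ _)
        · exact hX.notMem_openSegment he hxX hpe
  obtain ⟨r, hr, hb⟩ := Metric.isOpen_iff.1 hcl.isOpen_compl x hx
  refine ⟨r, hr, fun p hp hpd => ?_⟩
  have hnp := hb hp
  rw [mem_compl_iff, Set.mem_union, not_or] at hnp
  rcases hpd with hpX | hpe
  · left
    by_contra hne
    exact hnp.1 ⟨hpX, hne⟩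
  · obtain ⟨e, he, hpe⟩ := mem_iUnion₂.1 hpe
    by_cases hxe : x ∈ e
    · obtain ⟨y, rfl⟩ := Sym2.mem_iff_exists.1 hxe
      rw [edgeSegment_mk, segment_eq_openSegment_union] at hpe
      have hadj : (bondGraph X).Adj x y := he
      rcases hpe with (rfl | rfl) | hpe
      · exact Or.inl rfl
      · left
        by_contra hne
        exact hnp.1 ⟨hadj.2.1, hne⟩
      · exact Or.inr ⟨y, hadj, hpe⟩
    · exact absurd (mem_iUnion₂.2 ⟨e, ⟨he, hxe⟩, hpe⟩) hnp.2

/-- A component which accumulates at a non-isolated particle lies on one side of some bond at this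
particle. -/
theorem exists_leftComp_of_mem_frontier (hX : IsHardSphere X) (h : (bondGraph X).Adj x y)
    {f : Set Plane} (hf : f ∈ comps (drawing X)ᶜ) (hx : x ∈ frontier f) :
    ∃ z, (bondGraph X).Adj x z ∧ (leftComp X x z = f ∨ leftComp X z x = f) := by
  by_contra hcon
  push Not at hcon
  obtain ⟨r, hr, hb⟩ := exists_ball_drawing hX h.1
  have hfd := frontier_subset_drawing hf
  -- If `f` is on neither side of any bond at `x`, its frontier misses a punctured disc about `x`.
  -- The disc then lies in `f`, although a bond leaves `x` in it.
  have hsub : ball x r \ {x} ⊆ f := by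
    refine subset_of_disjoint_frontier (isPreconnected_ball_diff_singleton x hr) ?_ ?_
    · obtain ⟨p, hp, hpf⟩ := mem_closure_iff_nhds.1 (frontier_subset_closure hx) _
        (ball_mem_nhds x hr)
      refine ⟨p, ⟨hp, ?_⟩, hpf⟩
      rintro rfl
      exact subset_of_mem_comps hf hpf (Or.inl h.1)
    · rw [Set.disjoint_left]
      rintro p ⟨hp, hpx⟩ hpf
      rcases hb p hp (hfd hpf) with h1 | ⟨z, hz, hpz⟩
      · exact hpx h1
      · rcases eq_leftComp_of_mem_closure hX hz hf hpz (frontier_subset_closure hpf) with h1 | h1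
        · exact (hcon z hz).1 h1
        · exact (hcon z hz).2 h1
  set t := min (r / 2) (1 / 2) with ht
  have ht0 : 0 < t := lt_min (by positivity) (by norm_num)
  have hmem : x + t • (y - x) ∈ openSegment ℝ x y := by
    rw [← lineSet_Ioo_eq_openSegment]
    exact ⟨t, ⟨ht0, (min_le_right _ _).trans_lt (by norm_num)⟩, rfl⟩
  have hnorm : ‖t • (y - x)‖ = t := by
    rw [norm_smul, norm_sub_of_adj h, mul_one, Real.norm_eq_abs, abs_of_pos ht0]
  have hin : x + t • (y - x) ∈ f := by
    refine hsub ⟨?_, ?_⟩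
    · rw [mem_ball, dist_eq_norm, add_sub_cancel_left, hnorm]
      exact (min_le_left _ _).trans_lt (half_lt_self hr)
    · intro he
      have := add_eq_left.1 he
      rw [this, norm_zero] at hnorm
      exact ht0.ne hnorm
  exact subset_of_mem_comps hf hin (segment_subset_drawing h (openSegment_subset_segment ℝ _ _ hmem))

end Adj

end HardSphere

/-! ### Sides of bonds, types of edges, and double counting. -/

namespace HardSphere

open Set Filter Topology Metric

/-- The set of bonds. -/
noncomputable def bonds (X : Finset Plane) : Finset (Sym2 Plane) := (finite_edgeSet X).toFinset

open scoped Classical in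
/-- The ordered pairs of neighbours. -/
noncomputable def darts (X : Finset Plane) : Finset (Plane × Plane) :=
  (X ×ˢ X).filter fun a => (bondGraph X).Adj a.1 a.2

theorem mem_bonds {X : Finset Plane} {e : Sym2 Plane} : e ∈ bonds X ↔ e ∈ (bondGraph X).edgeSet :=
  (finite_edgeSet X).mem_toFinset

theorem mem_darts {X : Finset Plane} {a : Plane × Plane} :
    a ∈ darts X ↔ (bondGraph X).Adj a.1 a.2 := by
  classical
  rw [darts, Finset.mem_filter, Finset.mem_product]
  exact ⟨fun h => h.2, fun h => ⟨⟨h.1, h.2.1⟩, h⟩⟩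

/-- Counting ordered pairs of neighbours bond by bond. -/
theorem card_darts_filter {X : Finset Plane} (p : Plane × Plane → Prop) [DecidablePred p] (g : Sym2 Plane → ℕ)
    (hg : ∀ x y, (bondGraph X).Adj x y →
      g s(x, y) = (if p (x, y) then 1 else 0) + (if p (y, x) then 1 else 0)) :
    ((darts X).filter p).card = ∑ e ∈ bonds X, g e := by
  classical
  have hmaps : ∀ a ∈ darts X, s(a.1, a.2) ∈ bonds X := fun a ha => mem_bonds.2 (mem_darts.1 ha)
  rw [Finset.card_filter, ← Finset.sum_fiberwise_of_maps_to hmaps]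
  refine Finset.sum_congr rfl fun e he => ?_
  induction e with
  | h x y =>
    have hadj : (bondGraph X).Adj x y := mem_bonds.1 he
    have hfib : (darts X).filter (fun a => s(a.1, a.2) = s(x, y)) = {(x, y), (y, x)} := by
      ext ⟨a, b⟩
      simp only [Finset.mem_filter, mem_darts, Sym2.eq_iff, Finset.mem_insert,
        Finset.mem_singleton, Prod.mk.injEq]
      constructor
      · exact fun h => h.2
      · rintro (⟨rfl, rfl⟩ | ⟨rfl, rfl⟩)
        · exact ⟨hadj, Or.inl ⟨rfl, rfl⟩⟩
        · exact ⟨hadj.symm, Or.inr ⟨rfl, rfl⟩⟩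
    rw [hfib, Finset.sum_pair, hg x y hadj]
    intro h
    exact hadj.ne (Prod.mk.inj h).1

theorem card_darts (X : Finset Plane) : (darts X).card = 2 * (bonds X).card := by
  classical
  have := card_darts_filter (X := X) (fun _ => True) (fun _ => 2) (by simp)
  rw [Finset.filter_true] at this
  rw [this, Finset.sum_const, smul_eq_mul, mul_comm]

theorem IsFace.mem_comps {X : Finset Plane} {f : Set Plane} (h : IsFace X f) :
    f ∈ comps (drawing X)ᶜ := by
  obtain ⟨⟨p, hp, rfl⟩, -⟩ := h
  exact comp_mem_comps hp

section Sides

variable {X : Finset Plane} {x y : Plane}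

theorem facesAt_eq (hX : IsHardSphere X) (h : (bondGraph X).Adj x y) :
    facesAt X s(x, y) = {f | IsFace X f ∧ (leftComp X x y = f ∨ leftComp X y x = f)} := by
  ext f
  refine and_congr_right fun hf => ?_
  rw [edgeSegment_mk]
  exact segment_subset_frontier_iff hX h hf.mem_comps

theorem ncard_facesAt (hX : IsHardSphere X) (h : (bondGraph X).Adj x y) [Decidable (IsFace X (leftComp X x y))]
    [Decidable (IsFace X (leftComp X y x))] [Decidable (leftComp X x y = leftComp X y x)] :
    (facesAt X s(x, y)).ncard = (if IsFace X (leftComp X x y) then 1 else 0) +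
      (if IsFace X (leftComp X y x) ∧ leftComp X x y ≠ leftComp X y x then 1 else 0) := by
  rw [facesAt_eq hX h]
  by_cases hl : IsFace X (leftComp X x y) <;> by_cases hr : IsFace X (leftComp X y x)
  · by_cases hlr : leftComp X x y = leftComp X y x
    · have : {f | IsFace X f ∧ (leftComp X x y = f ∨ leftComp X y x = f)} = {leftComp X x y} := by
        ext f
        simp only [mem_ofPred_eq, mem_singleton_iff]
        constructor
        · rintro ⟨-, h | h⟩
          · exact h.symm
          · rw [hlr, h]
        · rintro rfl
          exact ⟨hl, Or.inl rfl⟩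
      rw [this, ncard_singleton]; simp [hr, hlr]
    · have : {f | IsFace X f ∧ (leftComp X x y = f ∨ leftComp X y x = f)} =
          {leftComp X x y, leftComp X y x} := by
        ext f
        simp only [mem_ofPred_eq, mem_insert_iff, mem_singleton_iff]
        constructor
        · rintro ⟨-, h | h⟩
          · exact Or.inl h.symm
          · exact Or.inr h.symm
        · rintro (rfl | rfl)
          · exact ⟨hl, Or.inl rfl⟩
          · exact ⟨hr, Or.inr rfl⟩
      rw [this, ncard_pair hlr]; simp [hl, hr, hlr]
  · have : {f | IsFace X f ∧ (leftComp X x y = f ∨ leftComp X y x = f)} = {leftComp X x y} := by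
      ext f
      simp only [mem_ofPred_eq, mem_singleton_iff]
      constructor
      · rintro ⟨hf, rfl | rfl⟩
        · rfl
        · exact absurd hf hr
      · rintro rfl
        exact ⟨hl, Or.inl rfl⟩
    rw [this, ncard_singleton]; simp [hl, hr]
  · have : {f | IsFace X f ∧ (leftComp X x y = f ∨ leftComp X y x = f)} = {leftComp X y x} := by
      ext f
      simp only [mem_ofPred_eq, mem_singleton_iff]
      constructor
      · rintro ⟨hf, rfl | rfl⟩
        · exact absurd hf hl
        · rfl
      · rintro rfl
        exact ⟨hr, Or.inr rfl⟩
    have hlr : leftComp X x y ≠ leftComp X y x := fun h => hl (h ▸ hr)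
    rw [this, ncard_singleton]; simp [hl, hr, hlr]
  · have : {f | IsFace X f ∧ (leftComp X x y = f ∨ leftComp X y x = f)} = ∅ := by
      ext f
      simp only [mem_ofPred_eq, mem_empty_iff_false, iff_false]
      rintro ⟨hf, rfl | rfl⟩
      · exact hl hf
      · exact hr hf
    rw [this, ncard_empty]; simp [hl, hr]

theorem leftComp_subset_outerRegion (hX : IsHardSphere X) (h : (bondGraph X).Adj x y)
    (hl : ¬ IsFace X (leftComp X x y)) : leftComp X x y ⊆ outerRegion X := by
  intro p hp hpc
  obtain ⟨f, hf, hpf⟩ := mem_iUnion₂.1 hpc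
  have hm := leftComp_mem_comps hX h
  obtain ⟨q, hq, hqf⟩ := mem_closure_iff.1 hpf _
    (isOpen_of_mem_comps (isOpen_compl_drawing X) hm) hp
  have : leftComp X x y = f := comps_eq_of_mem hm (IsFace.mem_comps hf) hq hqf
  exact hl (this ▸ hf)

theorem segment_subset_frontier_outerRegion (hX : IsHardSphere X) (h : (bondGraph X).Adj x y)
    (hl : ¬ IsFace X (leftComp X x y)) (hr : IsFace X (leftComp X y x)) :
    segment ℝ x y ⊆ frontier (outerRegion X) := by
  intro p hp
  refine ⟨closure_mono (leftComp_subset_outerRegion hX h hl)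
    (frontier_subset_closure (segment_subset_frontier_leftComp hX h hp)), fun hpi => ?_⟩
  refine interior_subset hpi (mem_iUnion₂.2 ⟨_, hr, ?_⟩)
  rw [segment_symm] at hp
  exact frontier_subset_closure (segment_subset_frontier_leftComp hX h.symm hp)

/-- The edge and its two sides fill a neighbourhood of each point of the open edge, and all of it is
covered by closed faces. -/
theorem not_segment_subset_frontier_outerRegion (hX : IsHardSphere X) (h : (bondGraph X).Adj x y)
    (hl : IsFace X (leftComp X x y)) (hr : IsFace X (leftComp X y x)) :
    ¬ segment ℝ x y ⊆ frontier (outerRegion X) := by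
  intro hsub
  obtain ⟨p, hp⟩ := openEdgeSegment_nonempty s(x, y)
  have hp : p ∈ openSegment ℝ x y := hp
  have hcl := frontier_subset_closure (hsub (openSegment_subset_segment ℝ _ _ hp))
  obtain ⟨q, hq, hqo⟩ := mem_closure_iff_nhds.1 hcl _ (edgeSide_mem_nhds
    (isClosed_restDrawing X _) (restDrawing_nonempty h s(x, y)) (norm_sub_of_adj h)
    (disjoint_restDrawing hX h) hp)
  rcases hq with hq | hq | hq
  · exact hqo (mem_iUnion₂.2 ⟨_, hl, frontier_subset_closure
      (segment_subset_frontier_leftComp hX h (openSegment_subset_segment ℝ _ _ hq))⟩)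
  · exact hqo (mem_iUnion₂.2 ⟨_, hl, subset_closure (edgeSide_subset_leftComp hX h hq)⟩)
  · rw [Sym2.eq_swap] at hq
    exact hqo (mem_iUnion₂.2 ⟨_, hr, subset_closure (edgeSide_subset_leftComp hX h.symm hq)⟩)

theorem isRegularBoundaryEdge_iff (hX : IsHardSphere X) (h : (bondGraph X).Adj x y) :
    IsRegularBoundaryEdge X s(x, y) ↔
      (IsFace X (leftComp X x y) ∧ ¬ IsFace X (leftComp X y x)) ∨
      (¬ IsFace X (leftComp X x y) ∧ IsFace X (leftComp X y x)) := by
  classical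
  have hn := ncard_facesAt hX h
  constructor
  · rintro ⟨-, h1, h2⟩
    rw [h1] at hn
    rw [edgeSegment_mk] at h2
    by_cases hl : IsFace X (leftComp X x y) <;> by_cases hr : IsFace X (leftComp X y x)
    · exact absurd h2 (not_segment_subset_frontier_outerRegion hX h hl hr)
    · exact Or.inl ⟨hl, hr⟩
    · exact Or.inr ⟨hl, hr⟩
    · simp [hl, hr] at hn
  · rintro (⟨hl, hr⟩ | ⟨hl, hr⟩)
    · refine ⟨h, by rw [hn]; simp [hl, hr], ?_⟩
      rw [edgeSegment_mk, segment_symm]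
      exact segment_subset_frontier_outerRegion hX h.symm hr hl
    · have hlr : leftComp X x y ≠ leftComp X y x := fun h => hl (h ▸ hr)
      refine ⟨h, by rw [hn]; simp [hl, hr, hlr], ?_⟩
      exact segment_subset_frontier_outerRegion hX h hl hr

theorem isOuterWireEdge_iff (hX : IsHardSphere X) (h : (bondGraph X).Adj x y) :
    IsOuterWireEdge X s(x, y) ↔ ¬ IsFace X (leftComp X x y) ∧ ¬ IsFace X (leftComp X y x) := by
  rw [IsOuterWireEdge, facesAt_eq hX h]
  constructor
  · rintro ⟨-, he⟩
    rw [Set.eq_empty_iff_forall_notMem] at he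
    exact ⟨fun hl => he _ ⟨hl, Or.inl rfl⟩, fun hr => he _ ⟨hr, Or.inr rfl⟩⟩
  · rintro ⟨hl, hr⟩
    refine ⟨h, Set.eq_empty_iff_forall_notMem.2 ?_⟩
    rintro f ⟨hf, rfl | rfl⟩
    · exact hl hf
    · exact hr hf

theorem isBoundaryEdge_iff (hX : IsHardSphere X) (h : (bondGraph X).Adj x y) :
    IsBoundaryEdge X s(x, y) ↔ ¬ IsFace X (leftComp X x y) ∨ ¬ IsFace X (leftComp X y x) := by
  rw [IsBoundaryEdge, isRegularBoundaryEdge_iff hX h, isOuterWireEdge_iff hX h]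
  tauto

/-- If only one side were a face, the other would belong to the outer region and put the edge on its
frontier; so the single face is on both sides. -/
theorem isInnerWireEdge_iff (hX : IsHardSphere X) (h : (bondGraph X).Adj x y) :
    IsInnerWireEdge X s(x, y) ↔ IsFace X (leftComp X x y) ∧ leftComp X x y = leftComp X y x := by
  classical
  have hn := ncard_facesAt hX h
  constructor
  · rintro ⟨-, h1, h2⟩
    rw [edgeSegment_mk] at h2
    rw [h1] at hn
    by_cases hl : IsFace X (leftComp X x y) <;> by_cases hr : IsFace X (leftComp X y x)
    · refine ⟨hl, ?_⟩
      by_contra hlr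
      simp [hl, hr, hlr] at hn
    · rw [segment_symm] at h2
      exact absurd (segment_subset_frontier_outerRegion hX h.symm hr hl) h2
    · exact absurd (segment_subset_frontier_outerRegion hX h hl hr) h2
    · simp [hl, hr] at hn
  · rintro ⟨hl, hlr⟩
    have hr : IsFace X (leftComp X y x) := hlr ▸ hl
    exact ⟨h, by rw [hn]; simp [hlr, hr],
      not_segment_subset_frontier_outerRegion hX h hl hr⟩

end Sides

-- A regular boundary edge has one side that is not a face, an outer wire edge has two; this
-- accounts for the weight two in the perimeter.
open scoped Classical in
theorem perimeter_eq {X : Finset Plane} (hX : IsHardSphere X) :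
    perimeter X = ((darts X).filter fun a => ¬ IsFace X (leftComp X a.1 a.2)).card := by
  rw [card_darts_filter (X := X) (fun a => ¬ IsFace X (leftComp X a.1 a.2))
    (fun e => (if IsRegularBoundaryEdge X e then 1 else 0) +
      2 * (if IsOuterWireEdge X e then 1 else 0))]
  · have h1 : {e | IsRegularBoundaryEdge X e} =
        (((bonds X).filter fun e => IsRegularBoundaryEdge X e : Finset _) : Set (Sym2 Plane)) := by
      ext e
      simp only [mem_ofPred_eq, Finset.coe_filter, mem_bonds]
      exact ⟨fun h => ⟨h.1, h⟩, fun h => h.2⟩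
    have h2 : {e | IsOuterWireEdge X e} =
        (((bonds X).filter fun e => IsOuterWireEdge X e : Finset _) : Set (Sym2 Plane)) := by
      ext e
      simp only [mem_ofPred_eq, Finset.coe_filter, mem_bonds]
      exact ⟨fun h => ⟨h.1, h⟩, fun h => h.2⟩
    rw [Finset.sum_add_distrib, ← Finset.mul_sum, ← Finset.card_filter, ← Finset.card_filter,
      perimeter, h1, h2, ncard_coe_finset, ncard_coe_finset]
  · intro x y h
    simp only [isRegularBoundaryEdge_iff hX h, isOuterWireEdge_iff hX h]
    by_cases hl : IsFace X (leftComp X x y) <;> by_cases hr : IsFace X (leftComp X y x) <;>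
      simp [hl, hr]

-- An inner wire edge has the face on both sides, so both of its orientations count, in agreement
-- with its double weight.
open scoped Classical in
theorem faceLength_eq {X : Finset Plane} (hX : IsHardSphere X) {f : Set Plane} (hf : IsFace X f) :
    faceLength X f = ((darts X).filter fun a => leftComp X a.1 a.2 = f).card := by
  rw [card_darts_filter (X := X) (fun a => leftComp X a.1 a.2 = f)
    (fun e => (if edgeSegment e ⊆ frontier f then 1 else 0) +
      (if IsInnerWireEdge X e ∧ edgeSegment e ⊆ frontier f then 1 else 0))]
  · rw [Finset.sum_add_distrib, ← Finset.card_filter, ← Finset.card_filter,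
      faceLength, ← ncard_coe_finset, ← ncard_coe_finset]
    congr 2
    · ext e
      simp only [mem_ofPred_eq, Finset.coe_filter, mem_bonds]
    · ext e
      simp only [mem_ofPred_eq, Finset.coe_filter, mem_bonds]
      exact ⟨fun h => ⟨h.1.1, h⟩, fun h => h.2⟩
  · intro x y h
    simp only [isInnerWireEdge_iff hX h, edgeSegment_mk,
      segment_subset_frontier_iff hX h hf.mem_comps]
    by_cases hl : leftComp X x y = f <;> by_cases hr : leftComp X y x = f
    · subst hl
      simp [hr, hf]
    · subst hl
      have : ¬ (leftComp X x y = leftComp X y x) := fun h => hr h.symm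
      simp [hr, this]
    · subst hr
      simp [hl]
    · simp [hl, hr]

/-- A walk starting on a bond cannot reach a disjoint bond using only these two bonds. -/
theorem notMem_edges_of_disjoint {G : SimpleGraph Plane} {e₁ e₂ : Sym2 Plane}
    (hdis : ∀ v ∈ e₁, v ∉ e₂) {x y : Plane} (w : G.Walk x y) (hx : x ∈ e₁)
    (hw : ∀ e ∈ w.edges, e = e₁ ∨ e = e₂) : e₂ ∉ w.edges := by
  induction w with
  | nil => simp
  | cons h p ih =>
    rename_i u v _
    have h1 : s(u, v) = e₁ := by
      rcases hw s(u, v) (by simp) with h1 | h1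
      · exact h1
      · exact absurd (h1 ▸ Sym2.mem_mk_left u v) (hdis _ hx)
    rw [SimpleGraph.Walk.edges_cons, List.mem_cons, not_or]
    refine ⟨fun h2 => ?_, ih (h1 ▸ Sym2.mem_mk_right u v) fun e he => hw e (by simp [he])⟩
    exact hdis _ hx (h2 ▸ Sym2.mem_mk_left u v)

/-- A bounded open set is not surrounded by segments with a common endpoint. -/
theorem not_frontier_star {f : Set Plane} (hfo : IsOpen f) (hne : f.Nonempty)
    (hb : Bornology.IsBounded f) (v : Plane)
    (hfr : ∀ p ∈ frontier f, segment ℝ v p ⊆ frontier f) : False := by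
  obtain ⟨p, hp, hpv⟩ : ∃ p ∈ f, p ≠ v := by
    obtain ⟨p, hp⟩ := hne
    by_contra hcon
    push Not at hcon
    have hfs : f = {v} := Subset.antisymm (fun q hq => hcon q hq) (by
      rintro _ rfl; exact hcon p hp ▸ hp)
    rw [hfs] at hfo
    exact not_isOpen_singleton v hfo
  -- A frontier point on the ray beyond `p` would bring with it the segment back to `v`, which
  -- contains `p ∈ f`. Hence the ray stays in `f` and `f` is unbounded.
  have hray : (fun s : ℝ => v + s • (p - v)) '' Ici 1 ⊆ f := by
    refine subset_of_disjoint_frontier (isPreconnected_Ici.image _ (by fun_prop))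
      ⟨p, ⟨1, by simp, by simp⟩, hp⟩ ?_
    rw [Set.disjoint_left]
    rintro _ ⟨s, hs, rfl⟩ hfrs
    have hs : 1 ≤ s := hs
    have hpf : p ∈ frontier f := by
      refine hfr _ hfrs ?_
      rw [segment_eq_image']
      refine ⟨s⁻¹, ⟨by positivity, inv_le_one_of_one_le₀ hs⟩, ?_⟩
      simp only [add_sub_cancel_left]
      rw [smul_smul, inv_mul_cancel₀ (by positivity), one_smul, add_sub_cancel]
    rw [hfo.frontier_eq] at hpf
    exact hpf.2 hp
  obtain ⟨M, hM⟩ := isBounded_iff_forall_norm_le.1 hb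
  have hpos : 0 < ‖p - v‖ := norm_pos_iff.2 (sub_ne_zero.2 hpv)
  obtain ⟨s, hs, h2⟩ : ∃ s : ℝ, 1 ≤ s ∧ M + ‖v‖ + 1 ≤ s * ‖p - v‖ :=
    ⟨max 1 ((M + ‖v‖ + 1) / ‖p - v‖), le_max_left _ _, by
      rw [← div_le_iff₀ hpos]; exact le_max_right _ _⟩
  have h1 := hM _ (hray ⟨s, hs, rfl⟩)
  have h3 : ‖s • (p - v)‖ ≤ ‖v + s • (p - v)‖ + ‖v‖ := by
    have := norm_sub_le (v + s • (p - v)) v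
    rwa [add_sub_cancel_left] at this
  rw [norm_smul, Real.norm_eq_abs, abs_of_pos (lt_of_lt_of_le one_pos hs)] at h3
  simp only at h1
  linarith

/-- A closed walk with at most two different edges runs in a star, all its edges having a common
vertex, and `not_frontier_star` excludes such a boundary. Hence the subtraction in `defect` never
truncates. -/
theorem three_le_faceLength {X : Finset Plane} {f : Set Plane}
    (hf : IsFace X f) : 3 ≤ faceLength X f := by
  classical
  by_contra hlt
  have hle : {e | e ∈ (bondGraph X).edgeSet ∧ edgeSegment e ⊆ frontier f}.ncard ≤ 2 := by
    unfold faceLength at hlt; omega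
  have hfin : {e | e ∈ (bondGraph X).edgeSet ∧ edgeSegment e ⊆ frontier f}.Finite :=
    (finite_edgeSet X).subset fun e he => he.1
  obtain ⟨-, hb, x, w, hw⟩ := id hf
  have hmem : ∀ e ∈ w.edges, e ∈ {e | e ∈ (bondGraph X).edgeSet ∧ edgeSegment e ⊆ frontier f} :=
    fun e he => ⟨w.edges_subset_edgeSet he, by rw [hw]; exact subset_biUnion_of_mem (u := edgeSegment) he⟩
  have htwo : ∀ e₁ ∈ w.edges, ∀ e₂ ∈ w.edges, e₁ ≠ e₂ → ∀ e ∈ w.edges, e = e₁ ∨ e = e₂ := by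
    intro e₁ h1 e₂ h2 hne e he
    by_contra hcon
    push Not at hcon
    have hsub : (({e₁, e₂, e} : Finset (Sym2 Plane)) : Set (Sym2 Plane)) ⊆
        {e | e ∈ (bondGraph X).edgeSet ∧ edgeSegment e ⊆ frontier f} := by
      intro z hz
      simp only [Finset.coe_insert, Finset.coe_singleton, mem_insert_iff, mem_singleton_iff] at hz
      rcases hz with rfl | rfl | rfl
      · exact hmem _ h1
      · exact hmem _ h2
      · exact hmem _ he
    have := ncard_le_ncard hsub hfin
    rw [ncard_coe_finset, Finset.card_eq_three.2 ⟨e₁, e₂, e, hne, hcon.1.symm, hcon.2.symm, rfl⟩]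
      at this
    omega
  obtain ⟨v, hv⟩ : ∃ v, ∀ e ∈ w.edges, v ∈ e := by
    cases w with
    | nil => exact ⟨x, by simp⟩
    | cons h p =>
      rename_i y
      set w := SimpleGraph.Walk.cons h p
      have h1 : s(x, y) ∈ w.edges := by simp [w]
      by_cases hall : ∀ e ∈ w.edges, x ∈ e
      · exact ⟨x, hall⟩
      · push Not at hall
        obtain ⟨e₂, he₂, hxe₂⟩ := hall
        have hne : s(x, y) ≠ e₂ := fun h => hxe₂ (h ▸ Sym2.mem_mk_left _ _)
        have h2 := htwo _ h1 _ he₂ hne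
        refine ⟨y, fun e he => ?_⟩
        rcases h2 e he with rfl | rfl
        · exact Sym2.mem_mk_right _ _
        · by_contra hye
          refine notMem_edges_of_disjoint (e₁ := s(x, y)) ?_ w (Sym2.mem_mk_left _ _) h2 he₂
          intro z hz
          rcases Sym2.mem_iff.1 hz with rfl | rfl
          · exact hxe₂
          · exact hye
  have hm := hf.mem_comps
  refine not_frontier_star (isOpen_of_mem_comps (isOpen_compl_drawing X) hm)
    (nonempty_of_mem_comps hm) hb v fun p hp => ?_
  rw [hw] at hp ⊢
  obtain ⟨e, he, hpe⟩ := mem_iUnion₂.1 hp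
  refine Subset.trans ?_ (subset_biUnion_of_mem (u := edgeSegment) he)
  obtain ⟨z, rfl⟩ := Sym2.mem_iff_exists.1 (hv e he)
  rw [edgeSegment_mk] at hpe ⊢
  exact (convex_segment v z).segment_subset (left_mem_segment ℝ v z) hpe

theorem exists_dart_of_isFace {X : Finset Plane} (hX : IsHardSphere X) {f : Set Plane}
    (hf : IsFace X f) : ∃ a ∈ darts X, leftComp X a.1 a.2 = f := by
  classical
  have h1 := three_le_faceLength hf
  rw [faceLength_eq hX hf] at h1
  obtain ⟨a, ha⟩ := Finset.card_pos.1 (lt_of_lt_of_le (by norm_num) h1)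
  exact ⟨a, (Finset.mem_filter.1 ha).1, (Finset.mem_filter.1 ha).2⟩

theorem finite_isFace {X : Finset Plane} (hX : IsHardSphere X) : {f | IsFace X f}.Finite := by
  refine ((darts X).finite_toSet.image fun a : Plane × Plane => leftComp X a.1 a.2).subset fun f hf => ?_
  obtain ⟨a, ha, rfl⟩ := exists_dart_of_isFace hX hf
  exact ⟨a, ha, rfl⟩

/-- Double counting of the sides of the bonds. -/
theorem perimeter_add_defect {X : Finset Plane} (hX : IsHardSphere X) :
    perimeter X + defect X + 3 * {f | IsFace X f}.ncard = 2 * (bonds X).card := by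
  classical
  have hfin := finite_isFace hX
  set F := hfin.toFinset with hF
  have hmF : ∀ f, f ∈ F ↔ IsFace X f := fun f => hfin.mem_toFinset
  have h1 : ((darts X).filter fun a => IsFace X (leftComp X a.1 a.2)).card =
      ∑ f ∈ F, faceLength X f := by
    rw [Finset.card_eq_sum_card_fiberwise (f := fun a : Plane × Plane => leftComp X a.1 a.2) (t := F)
      (fun a ha => (hmF _).2 (Finset.mem_filter.1 (Finset.mem_coe.1 ha)).2)]
    refine Finset.sum_congr rfl fun f hf => ?_
    rw [faceLength_eq hX ((hmF f).1 hf), Finset.filter_filter]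
    congr 1
    refine Finset.filter_congr fun a _ => ⟨fun h => h.2, fun h => ⟨by
      have := (hmF f).1 hf; rwa [← h] at this, h⟩⟩
  have h2 : defect X = ∑ f ∈ F, (faceLength X f - 3) := by
    rw [defect, finsum_mem_eq_finite_toFinset_sum _ hfin]
  have h3 : ∑ f ∈ F, (faceLength X f - 3) + 3 * F.card = ∑ f ∈ F, faceLength X f := by
    rw [mul_comm, ← smul_eq_mul, ← Finset.sum_const, ← Finset.sum_add_distrib]
    exact Finset.sum_congr rfl fun f hf =>
      Nat.sub_add_cancel (three_le_faceLength ((hmF f).1 hf))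
  have h4 := Finset.card_filter_add_card_filter_not (s := darts X)
    (fun a => IsFace X (leftComp X a.1 a.2))
  rw [ncard_eq_toFinset_card _ hfin, ← hF, h2, perimeter_eq hX, ← card_darts, ← h4, h1, ← h3]
  ring

end HardSphere

/-! ### Polygonal arcs, the boundary cycle, and the unbounded component. -/

namespace HardSphere

open Set Filter Topology Metric

/-- The polygonal arc with vertices `v 0, …, v k`. -/
def arc (v : ℕ → Plane) (k : ℕ) : Set Plane :=
  {p | (∃ i ≤ k, p = v i) ∨ ∃ i < k, p ∈ openSegment ℝ (v i) (v (i + 1))}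

theorem compl_arc_eq (v : ℕ → Plane) (k : ℕ) :
    (arc v k)ᶜ = {v 0}ᶜ \ ⋃ i < k, lineSet (v i) (v (i + 1) - v i) (Ioc 0 1) := by
  rw [Set.sdiff_eq, ← compl_union, compl_inj_iff]
  ext p
  simp only [arc, mem_ofPred_eq, Set.mem_union, mem_singleton_iff, mem_iUnion,
    Ioc_eq_insert_openSegment, mem_insert_iff, exists_prop]
  constructor
  · rintro (⟨i, hi, rfl⟩ | ⟨i, hi, hp⟩)
    · cases i with
      | zero => exact Or.inl rfl
      | succ i => exact Or.inr ⟨i, by omega, Or.inl rfl⟩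
    · exact Or.inr ⟨i, hi, Or.inr hp⟩
  · rintro (rfl | ⟨i, hi, rfl | hp⟩)
    · exact Or.inl ⟨0, by omega, rfl⟩
    · exact Or.inl ⟨i + 1, by omega, rfl⟩
    · exact Or.inr ⟨i, hi, hp⟩

theorem isPreconnected_of_ncard_comps_le_one {U : Set Plane} (hf : (comps U).Finite)
    (h : (comps U).ncard ≤ 1) : IsPreconnected U := by
  rcases U.eq_empty_or_nonempty with rfl | ⟨p, hp⟩
  · exact isPreconnected_empty
  have : U ⊆ connectedComponentIn U p := by
    intro q hq
    rw [ncard_le_one hf] at h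
    rw [← h _ (comp_mem_comps hq) _ (comp_mem_comps hp)]
    exact mem_connectedComponentIn hq
  rw [Subset.antisymm this (connectedComponentIn_subset U p)]
  exact isPreconnected_connectedComponentIn

theorem one_lt_rank_plane : 1 < Module.rank ℝ Plane := by
  apply Module.lt_rank_of_lt_finrank
  simp

theorem edge_ne_of_injOn {v : ℕ → Plane} {k : ℕ}
    (hinj : ∀ i ≤ k, ∀ j ≤ k, v i = v j → i = j) {i j : ℕ} (hi : i < k) (hj : j < k) (hij : i ≠ j) :
    s(v i, v (i + 1)) ≠ s(v j, v (j + 1)) := by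
  intro h
  rcases Sym2.eq_iff.1 h with ⟨h1, -⟩ | ⟨h1, h2⟩
  · exact hij (hinj _ hi.le _ hj.le h1)
  · have := hinj _ hi.le _ hj h1
    have := hinj _ hi _ hj.le h2
    omega

/-- The pairwise disjointness of the half open edges of a path. -/
theorem IsHardSphere.disjoint_path {X : Finset Plane} (hX : IsHardSphere X) {v : ℕ → Plane} {k : ℕ}
    (hadj : ∀ i < k, (bondGraph X).Adj (v i) (v (i + 1)))
    (hinj : ∀ i ≤ k, ∀ j ≤ k, v i = v j → i = j) {i j : ℕ} (hi : i < k) (hj : j < i) :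
    Disjoint (lineSet (v i) (v (i + 1) - v i) (Ioc 0 1))
      (lineSet (v j) (v (j + 1) - v j) (Ioc 0 1)) := by
  rw [Ioc_eq_insert_openSegment, Ioc_eq_insert_openSegment, Set.disjoint_left]
  rintro p (rfl | hp) (hq | hq)
  · have := hinj _ (by omega) _ (by omega) hq
    omega
  · exact hX.notMem_openSegment (hadj j (by omega)) (hadj i hi).2.1 hq
  · subst hq
    exact hX.notMem_openSegment (hadj i hi) (hadj j (by omega)).2.1 hp
  · exact Set.disjoint_left.1 (hX.disjoint_openSegment_segment (hadj i hi) (hadj j (by omega))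
      (edge_ne_of_injOn hinj hi (by omega) (by omega))) hp (openSegment_subset_segment ℝ _ _ hq)

/-- An arc does not separate the plane: starting from the punctured plane, its half-open edges are
removed one after the other, each hanging off the part removed before. For the boundary cycle this
takes the place of the Jordan curve theorem. -/
theorem IsHardSphere.isPreconnected_compl_arc {X : Finset Plane} (hX : IsHardSphere X)
    {v : ℕ → Plane} {k : ℕ} (hadj : ∀ i < k, (bondGraph X).Adj (v i) (v (i + 1)))
    (hinj : ∀ i ≤ k, ∀ j ≤ k, v i = v j → i = j) : IsPreconnected (arc v k)ᶜ := by
  have hU : IsPreconnected ({v 0}ᶜ : Set Plane) :=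
    (isConnected_compl_singleton_of_one_lt_rank one_lt_rank_plane _).isPreconnected
  have hc := comps_of_isPreconnected hU
  rw [compl_arc_eq]
  obtain ⟨-, h2, h3⟩ := comps_diff_path_ncard_le (U := {v 0}ᶜ) (v := v) (k := k) (n := 1)
    isOpen_compl_singleton (by simp) (fun i hi => norm_sub_of_adj (hadj i hi)) (fun i hi => by
      rw [Ioc_eq_insert_openSegment]
      rintro p (rfl | hp)
      · intro h
        have := hinj _ hi _ (by omega) h
        omega
      · rintro rfl
        exact hX.notMem_openSegment (hadj i hi) (hadj 0 (by omega)).1 hp)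
    (fun i hi j hj => hX.disjoint_path hadj hinj hi hj)
    ((finite_singleton _).subset hc) ((ncard_le_ncard hc).trans (by rw [ncard_singleton]))
  exact isPreconnected_of_ncard_comps_le_one h2 h3

/-- The boundary edges are the edges of the cycle with vertices `v 0, …, v (b - 1)`, continued
periodically. -/
structure BoundaryCycle (X : Finset Plane) (v : ℕ → Plane) (b : ℕ) : Prop where
  three_le : 3 ≤ b
  periodic : ∀ i, v (i % b) = v i
  inj : ∀ i < b, ∀ j < b, v i = v j → i = j
  adj : ∀ i, (bondGraph X).Adj (v i) (v (i + 1))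
  isBoundaryEdge : ∀ e, IsBoundaryEdge X e ↔ ∃ i < b, s(v i, v (i + 1)) = e
  walk : ∃ (x : Plane) (w : (bondGraph X).Walk x x), ∀ e, e ∈ w.edges ↔ IsBoundaryEdge X e
  reachable : ∀ x ∈ X, ∀ y ∈ X, (bondGraph X).Reachable x y

/-- Indices are read modulo the length, so that opening the cycle at an arbitrary edge is a mere
shift. -/
theorem HasSimplyClosedBoundary.exists_cycle {X : Finset Plane} (h : HasSimplyClosedBoundary X) :
    ∃ v b, BoundaryCycle X v b := by
  obtain ⟨hr, x, w, hw, he⟩ := h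
  have h3 := hw.three_le_length
  have hpos : 0 < w.length := by omega
  have hsucc : ∀ i < w.length, w.getVert ((i + 1) % w.length) = w.getVert (i + 1) := by
    intro i hi
    rcases Nat.lt_or_ge (i + 1) w.length with h | h
    · rw [Nat.mod_eq_of_lt h]
    · have : i + 1 = w.length := by omega
      rw [this, Nat.mod_self, SimpleGraph.Walk.getVert_zero, SimpleGraph.Walk.getVert_length]
  refine ⟨fun i => w.getVert (i % w.length), w.length, h3, fun i => by simp, ?_, ?_, ?_,
    ⟨x, w, he⟩, hr⟩
  · intro i hi j hj hij
    simp only [Nat.mod_eq_of_lt hi, Nat.mod_eq_of_lt hj] at hij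
    exact hw.getVert_injOn' (by simp only [mem_ofPred_eq]; omega)
      (by simp only [mem_ofPred_eq]; omega) hij
  · intro i
    have hlt := Nat.mod_lt i hpos
    have := w.adj_getVert_succ hlt
    rw [← hsucc _ hlt, Nat.mod_add_mod] at this
    exact this
  · intro e
    rw [← he]
    induction e with
    | h a c =>
      rw [SimpleGraph.Walk.mk_mem_edges_iff_exists]
      refine exists_congr fun i => and_congr_right fun hi => ?_
      simp only [hsucc i hi, Nat.mod_eq_of_lt hi]

namespace BoundaryCycle

variable {X : Finset Plane} {v : ℕ → Plane} {b : ℕ}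

theorem pos (h : BoundaryCycle X v b) : 0 < b := by have := h.three_le; omega

theorem modEq (h : BoundaryCycle X v b) {i j : ℕ} (hij : v i = v j) : i ≡ j [MOD b] := by
  rw [← h.periodic i, ← h.periodic j] at hij
  exact h.inj _ (Nat.mod_lt _ h.pos) _ (Nat.mod_lt _ h.pos) hij

theorem eq_of_modEq (h : BoundaryCycle X v b) {i j : ℕ} (hij : i ≡ j [MOD b]) : v i = v j := by
  rw [← h.periodic i, ← h.periodic j, hij]

theorem mem (h : BoundaryCycle X v b) (i : ℕ) : v i ∈ X := (h.adj i).1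

/-- Any `b` consecutive vertices are distinct. -/
theorem shift_inj (h : BoundaryCycle X v b) (c : ℕ) :
    ∀ i ≤ b - 1, ∀ j ≤ b - 1, v (c + i) = v (c + j) → i = j := by
  intro i hi j hj hij
  have hp := h.pos
  exact (Nat.ModEq.add_left_cancel' c (h.modEq hij)).eq_of_lt_of_lt (by omega) (by omega)

theorem exists_shift (h : BoundaryCycle X v b) (c i : ℕ) :
    ∃ k < b, v (c + k) = v i ∧ v (c + k + 1) = v (i + 1) := by
  have hp := h.pos
  -- The residue of `i - c` modulo `b`, written without negative numbers.
  refine ⟨(i + (b - c % b)) % b, Nat.mod_lt _ hp, ?_⟩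
  have : c + (i + (b - c % b)) % b ≡ i [MOD b] := by
    have h1 : c + (i + (b - c % b)) % b ≡ c % b + (i + (b - c % b)) [MOD b] :=
      (Nat.mod_modEq _ _).symm.add (Nat.mod_modEq _ _)
    have h2 : c % b + (i + (b - c % b)) = i + b := by have := Nat.mod_lt c hp; omega
    rw [h2] at h1
    exact h1.trans (by simp [Nat.ModEq])
  exact ⟨h.eq_of_modEq this, h.eq_of_modEq (this.add_right 1)⟩

theorem exists_lt (h : BoundaryCycle X v b) (i : ℕ) : ∃ k < b, v k = v i ∧ v (k + 1) = v (i + 1) := by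
  simpa using h.exists_shift 0 i

/-- The polygon through the boundary particles. -/
def polygon (v : ℕ → Plane) : Set Plane := ⋃ i, segment ℝ (v i) (v (i + 1))

/-- The polygon is an edge together with the remaining arc. -/
theorem polygon_subset (h : BoundaryCycle X v b) (j : ℕ) :
    polygon v ⊆ arc (fun i => v (j + 1 + i)) (b - 1) ∪ openSegment ℝ (v j) (v (j + 1)) := by
  have h3 := h.three_le
  have hv : ∀ i, v i ∈ arc (fun i => v (j + 1 + i)) (b - 1) := by
    intro i
    obtain ⟨k, hk, hki, -⟩ := h.exists_shift (j + 1) i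
    exact Or.inl ⟨k, by omega, hki.symm⟩
  refine iUnion_subset fun i => ?_
  rw [segment_eq_openSegment_union]
  rintro p ((rfl | rfl) | hp)
  · exact Or.inl (hv i)
  · exact Or.inl (hv _)
  · obtain ⟨k, hk, h1, h2⟩ := h.exists_shift (j + 1) i
    by_cases hkb : k = b - 1
    · right
      have e : j + 1 + k ≡ j [MOD b] := by
        have : j + 1 + k = j + b := by omega
        rw [this]; simp [Nat.ModEq]
      rw [h.eq_of_modEq e] at h1
      have e' : j + 1 + k + 1 ≡ j + 1 [MOD b] := e.add_right 1
      rw [h.eq_of_modEq e'] at h2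
      rwa [h1, h2]
    · left
      refine Or.inr ⟨k, by omega, ?_⟩
      change p ∈ openSegment ℝ (v (j + 1 + k)) (v (j + 1 + k + 1))
      rwa [h1, h2]

theorem arc_subset_polygon (v : ℕ → Plane) (b j : ℕ) :
    arc (fun i => v (j + 1 + i)) (b - 1) ⊆ polygon v := by
  rintro p (⟨i, -, rfl⟩ | ⟨i, -, hp⟩)
  · exact mem_iUnion.2 ⟨_, left_mem_segment ℝ _ _⟩
  · exact mem_iUnion.2 ⟨j + 1 + i, openSegment_subset_segment ℝ _ _ hp⟩

theorem polygon_subset_drawing (h : BoundaryCycle X v b) : polygon v ⊆ drawing X :=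
  iUnion_subset fun i => segment_subset_drawing (h.adj i)

theorem edge_ne (h : BoundaryCycle X v b) {j i : ℕ} (hi : i < b - 1) :
    s(v j, v (j + 1)) ≠ s(v (j + 1 + i), v (j + 1 + (i + 1))) := by
  have h3 := h.three_le
  have e1 : v j = v (j + 1 + (b - 1)) := by
    refine h.eq_of_modEq ?_
    have : j + 1 + (b - 1) = j + b := by omega
    rw [this]; simp [Nat.ModEq]
  intro he
  rcases Sym2.eq_iff.1 he with ⟨h1, -⟩ | ⟨h1, h2⟩
  · rw [e1] at h1
    have := h.shift_inj (j + 1) _ le_rfl _ hi.le h1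
    omega
  · rw [e1] at h1
    have := h.shift_inj (j + 1) _ le_rfl _ (by omega) h1
    have h2' : v (j + 1 + 0) = v (j + 1 + i) := h2
    have := h.shift_inj (j + 1) 0 (by omega) _ hi.le h2'
    omega

theorem disjoint_arc (h : BoundaryCycle X v b) (hX : IsHardSphere X) (j : ℕ) :
    Disjoint (openSegment ℝ (v j) (v (j + 1))) (arc (fun i => v (j + 1 + i)) (b - 1)) := by
  rw [Set.disjoint_left]
  rintro p hp (⟨i, -, rfl⟩ | ⟨i, hi, hp'⟩)
  · exact hX.notMem_openSegment (h.adj j) (h.mem _) hp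
  · exact Set.disjoint_left.1 (hX.disjoint_openSegment_segment (h.adj j) (h.adj (j + 1 + i))
      (h.edge_ne hi)) hp (openSegment_subset_segment ℝ _ _ hp')

theorem isPreconnected_compl_arc (h : BoundaryCycle X v b) (hX : IsHardSphere X) (j : ℕ) :
    IsPreconnected (arc (fun i => v (j + 1 + i)) (b - 1))ᶜ :=
  hX.isPreconnected_compl_arc (fun i _ => h.adj (j + 1 + i)) (h.shift_inj (j + 1))

theorem exists_adj (h : BoundaryCycle X v b) {x : Plane} (hx : x ∈ X) :
    ∃ y, (bondGraph X).Adj x y := by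
  obtain ⟨y, hy, hxy⟩ : ∃ y ∈ X, x ≠ y := by
    by_cases hx0 : x = v 0
    · exact ⟨v 1, h.mem 1, by rw [hx0]; exact (h.adj 0).ne⟩
    · exact ⟨v 0, h.mem 0, hx0⟩
  obtain ⟨w⟩ := h.reachable x hx y hy
  cases w with
  | nil => exact absurd rfl hxy
  | cons ha _ => exact ⟨_, ha⟩

theorem segment_subset_polygon (h : BoundaryCycle X v b) {x y : Plane}
    (he : IsBoundaryEdge X s(x, y)) : segment ℝ x y ⊆ polygon v := by
  obtain ⟨i, -, hi⟩ := (h.isBoundaryEdge _).1 he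
  have h1 : segment ℝ x y = segment ℝ (v i) (v (i + 1)) := by
    rw [← edgeSegment_mk, ← edgeSegment_mk, hi]
  rw [h1]
  exact subset_iUnion (fun i => segment ℝ (v i) (v (i + 1))) i

/-- A bond with a non-face on one side is a boundary edge. A particle on the frontier is reached
through a suitable bond at it, by `exists_leftComp_of_mem_frontier`. -/
theorem frontier_subset_polygon (h : BoundaryCycle X v b) (hX : IsHardSphere X) {f : Set Plane}
    (hf : f ∈ comps (drawing X)ᶜ) (hnf : ¬ IsFace X f) : frontier f ⊆ polygon v := by
  have key : ∀ {x y}, (bondGraph X).Adj x y → (leftComp X x y = f ∨ leftComp X y x = f) →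
      segment ℝ x y ⊆ polygon v := by
    intro x y ha hl
    refine h.segment_subset_polygon ((isBoundaryEdge_iff hX ha).2 ?_)
    rcases hl with rfl | rfl
    · exact Or.inl hnf
    · exact Or.inr hnf
  have hvert : ∀ x ∈ X, x ∈ frontier f → x ∈ polygon v := by
    intro x hx hxf
    obtain ⟨y, hy⟩ := h.exists_adj hx
    obtain ⟨z, hz, hl⟩ := exists_leftComp_of_mem_frontier hX hy hf hxf
    exact key hz hl (left_mem_segment ℝ _ _)
  intro p hp
  rcases frontier_subset_drawing hf hp with hpX | hpe
  · exact hvert p hpX hp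
  · obtain ⟨e, he, hpe⟩ := mem_iUnion₂.1 hpe
    induction e with
    | h x y =>
      have he : (bondGraph X).Adj x y := he
      rw [edgeSegment_mk, segment_eq_openSegment_union] at hpe
      rcases hpe with (rfl | rfl) | hpe
      · exact hvert _ he.1 hp
      · exact hvert _ he.2.1 hp
      · exact key he (eq_leftComp_of_mem_closure hX he hf hpe (frontier_subset_closure hp))
          (openSegment_subset_segment ℝ _ _ hpe)

/-- A component which is not a face touches every edge of the boundary cycle. -/
theorem exists_side (h : BoundaryCycle X v b) (hX : IsHardSphere X) {f : Set Plane}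
    (hf : f ∈ comps (drawing X)ᶜ) (hnf : ¬ IsFace X f) (j : ℕ) :
    leftComp X (v j) (v (j + 1)) = f ∨ leftComp X (v (j + 1)) (v j) = f := by
  by_contra hcon
  have hfr : frontier f ⊆ arc (fun i => v (j + 1 + i)) (b - 1) := by
    intro p hp
    rcases h.polygon_subset j (h.frontier_subset_polygon hX hf hnf hp) with h1 | h1
    · exact h1
    · exact absurd (eq_leftComp_of_mem_closure hX (h.adj j) hf h1 (frontier_subset_closure hp)) hcon
  have hfs := subset_of_mem_comps hf
  obtain ⟨p, hp⟩ := nonempty_of_mem_comps hf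
  -- If `f` missed the edge `j`, its frontier would lie on the remaining arc, whose complement is
  -- connected. Then `f` would contain this complement, and with it the open edge `j`.
  have hsub : (arc (fun i => v (j + 1 + i)) (b - 1))ᶜ ⊆ f :=
    subset_of_disjoint_frontier (h.isPreconnected_compl_arc hX j)
      ⟨p, fun hpa => hfs hp (h.polygon_subset_drawing (arc_subset_polygon v b j hpa)), hp⟩
      (disjoint_compl_left.mono_right hfr)
  obtain ⟨q, hq⟩ := openEdgeSegment_nonempty s(v j, v (j + 1))
  have hq : q ∈ openSegment ℝ (v j) (v (j + 1)) := hq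
  exact hfs (hsub (Set.disjoint_left.1 (h.disjoint_arc hX j) hq))
    (segment_subset_drawing (h.adj j) (openSegment_subset_segment ℝ _ _ hq))

theorem frontier_eq (h : BoundaryCycle X v b) (hX : IsHardSphere X) {f : Set Plane}
    (hf : f ∈ comps (drawing X)ᶜ) (hnf : ¬ IsFace X f) : frontier f = polygon v :=
  Subset.antisymm (h.frontier_subset_polygon hX hf hnf) (iUnion_subset fun j =>
    (segment_subset_frontier_iff hX (h.adj j) hf).2 (h.exists_side hX hf hnf j))

theorem polygon_eq (h : BoundaryCycle X v b) {x : Plane} {w : (bondGraph X).Walk x x}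
    (hw : ∀ e, e ∈ w.edges ↔ IsBoundaryEdge X e) : polygon v = ⋃ e ∈ w.edges, edgeSegment e := by
  refine Subset.antisymm (iUnion_subset fun i => ?_) (iUnion₂_subset fun e he => ?_)
  · obtain ⟨k, hk, h1, h2⟩ := h.exists_lt i
    rw [← h1, ← h2]
    have hm : s(v k, v (k + 1)) ∈ w.edges := (hw _).2 ((h.isBoundaryEdge _).2 ⟨k, hk, rfl⟩)
    exact subset_biUnion_of_mem (s := {e | e ∈ w.edges}) (u := edgeSegment) hm
  · induction e with
    | h x y => exact h.segment_subset_polygon ((hw _).1 he)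

/-- The frontier is the whole polygon, which the boundary walk traces; with boundedness this would
make `f` a face. -/
theorem not_isBounded (h : BoundaryCycle X v b) (hX : IsHardSphere X) {f : Set Plane}
    (hf : f ∈ comps (drawing X)ᶜ) (hnf : ¬ IsFace X f) : ¬ Bornology.IsBounded f := by
  intro hb
  obtain ⟨x, w, hw⟩ := h.walk
  exact hnf ⟨hf, hb, x, w, by rw [h.frontier_eq hX hf hnf, h.polygon_eq hw]⟩

theorem isBounded_drawing (X : Finset Plane) : Bornology.IsBounded (drawing X) :=
  (isCompact_drawing X).isBounded

/-- All components but the unbounded one are faces. -/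
theorem isFace_iff (h : BoundaryCycle X v b) (hX : IsHardSphere X) {Ω f : Set Plane}
    (hΩ : Ω ∈ comps (drawing X)ᶜ) (hΩb : ¬ Bornology.IsBounded Ω) (hf : f ∈ comps (drawing X)ᶜ) :
    IsFace X f ↔ f ≠ Ω := by
  constructor
  · rintro hF rfl
    exact hΩb hF.2.1
  · intro hne
    by_contra hnf
    exact hne (unbounded_comps_eq (isBounded_drawing X) hf (h.not_isBounded hX hf hnf) hΩ hΩb)

/-- With `Ω` on both sides, adding the open edge to `Ω` gives an open set whose frontier lies on the
remaining arc, so it contains the complement of that arc. But a particle off the cycle belongs to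
this complement and to the drawing. Here an inner particle is indispensable to the argument. -/
theorem edge_sides_ne (h : BoundaryCycle X v b) (hX : IsHardSphere X) {Ω : Set Plane}
    (hΩ : Ω ∈ comps (drawing X)ᶜ) (hΩb : ¬ Bornology.IsBounded Ω) {x : Plane} (hx : x ∈ X)
    (hxv : ∀ i, x ≠ v i) (j : ℕ) :
    leftComp X (v j) (v (j + 1)) ≠ Ω ∨ leftComp X (v (j + 1)) (v j) ≠ Ω := by
  by_contra hcon
  push Not at hcon
  obtain ⟨h1, h2⟩ := hcon
  have hnf : ¬ IsFace X Ω := fun hF => hΩb hF.2.1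
  have hadj := h.adj j
  have hK := isClosed_restDrawing X s(v j, v (j + 1))
  have hKne := restDrawing_nonempty hadj s(v j, v (j + 1))
  have hside1 := edgeSide_subset_leftComp hX hadj
  have hside2 := edgeSide_subset_leftComp hX hadj.symm
  rw [h1] at hside1
  rw [h2, Sym2.eq_swap] at hside2
  have hΩo := isOpen_of_mem_comps (isOpen_compl_drawing X) hΩ
  set W := Ω ∪ openSegment ℝ (v j) (v (j + 1)) with hW
  have hWo : IsOpen W := by
    rw [isOpen_iff_mem_nhds]
    rintro p (hp | hp)
    · exact mem_of_superset (hΩo.mem_nhds hp) subset_union_left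
    · refine mem_of_superset (edgeSide_mem_nhds hK hKne (norm_sub_of_adj hadj)
        (disjoint_restDrawing hX hadj) hp) ?_
      rintro q (hq | hq | hq)
      · exact Or.inr hq
      · exact Or.inl (hside1 hq)
      · exact Or.inl (hside2 hq)
  have hfr : frontier W ⊆ arc (fun i => v (j + 1 + i)) (b - 1) := by
    intro p hp
    rw [hWo.frontier_eq] at hp
    have hcl : closure W ⊆ closure Ω := by
      refine closure_minimal (union_subset subset_closure ?_) isClosed_closure
      refine Subset.trans (openSegment_subset_segment ℝ _ _) (Subset.trans ?_ frontier_subset_closure)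
      exact (segment_subset_frontier_iff hX hadj hΩ).2 (Or.inl h1)
    have hpΩ : p ∈ frontier Ω := by
      rw [hΩo.frontier_eq]
      exact ⟨hcl hp.1, fun hpΩ => hp.2 (Or.inl hpΩ)⟩
    rcases h.polygon_subset j (h.frontier_subset_polygon hX hΩ hnf hpΩ) with h3 | h3
    · exact h3
    · exact absurd (Or.inr h3) hp.2
  have hsub : (arc (fun i => v (j + 1 + i)) (b - 1))ᶜ ⊆ W := by
    obtain ⟨q, hq⟩ := openEdgeSegment_nonempty s(v j, v (j + 1))
    have hq : q ∈ openSegment ℝ (v j) (v (j + 1)) := hq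
    exact subset_of_disjoint_frontier (h.isPreconnected_compl_arc hX j)
      ⟨q, Set.disjoint_left.1 (h.disjoint_arc hX j) hq, Or.inr hq⟩
      (disjoint_compl_left.mono_right hfr)
  have hxa : x ∉ arc (fun i => v (j + 1 + i)) (b - 1) := by
    rintro (⟨i, -, hxi⟩ | ⟨i, -, hxi⟩)
    · exact hxv _ hxi
    · exact hX.notMem_openSegment (h.adj (j + 1 + i)) hx hxi
  rcases hsub hxa with h3 | h3
  · exact subset_of_mem_comps hΩ h3 (Or.inl hx)
  · exact hX.notMem_openSegment hadj hx h3

theorem mem_boundary_iff (h : BoundaryCycle X v b) {x : Plane} :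
    x ∈ boundary X ↔ ∃ i < b, v i = x := by
  classical
  rw [boundary, Finset.mem_filter]
  constructor
  · rintro ⟨hx, -, hiso | ⟨e, he, hxe⟩⟩
    · obtain ⟨y, hy⟩ := h.exists_adj hx
      exact absurd hy (hiso y)
    · obtain ⟨i, hi, rfl⟩ := (h.isBoundaryEdge e).1 he
      rcases Sym2.mem_iff.1 hxe with rfl | rfl
      · exact ⟨i, hi, rfl⟩
      · obtain ⟨k, hk, hki, -⟩ := h.exists_lt (i + 1)
        exact ⟨k, hk, hki⟩
  · rintro ⟨i, hi, rfl⟩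
    exact ⟨h.mem i, h.mem i, Or.inr ⟨s(v i, v (i + 1)), (h.isBoundaryEdge _).2 ⟨i, hi, rfl⟩,
      Sym2.mem_mk_left _ _⟩⟩

theorem mem_boundary (h : BoundaryCycle X v b) (i : ℕ) : v i ∈ boundary X := by
  obtain ⟨k, hk, hki, -⟩ := h.exists_lt i
  exact h.mem_boundary_iff.2 ⟨k, hk, hki⟩

theorem card_boundary (h : BoundaryCycle X v b) : (boundary X).card = b := by
  classical
  have : boundary X = (Finset.range b).image v := by
    ext x
    simp [h.mem_boundary_iff]
  rw [this, Finset.card_image_of_injOn, Finset.card_range]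
  intro i hi j hj hij
  exact h.inj i (by simpa using hi) j (by simpa using hj) hij

theorem mem_removeBoundary {X : Finset Plane} {x : Plane} :
    x ∈ removeBoundary X ↔ x ∈ X ∧ x ∉ boundary X := by
  classical
  rw [removeBoundary, Finset.mem_sdiff]

theorem frameSet_eq_polygon (h : BoundaryCycle X v b) :
    frameSet (fun i : Fin b => v i) (fun i : Fin b => v (i + 1)) (boundary X) = polygon v := by
  refine Subset.antisymm ?_ (iUnion_subset fun i => ?_)
  · rintro p (hp | hp)
    · obtain ⟨i, -, rfl⟩ := h.mem_boundary_iff.1 hp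
      exact mem_iUnion.2 ⟨i, left_mem_segment ℝ _ _⟩
    · obtain ⟨i, hi⟩ := mem_iUnion.1 hp
      exact mem_iUnion.2 ⟨i, openSegment_subset_segment ℝ _ _ hi⟩
  · rw [segment_eq_openSegment_union]
    rintro p ((rfl | rfl) | hp)
    · exact Or.inl (h.mem_boundary _)
    · exact Or.inl (h.mem_boundary _)
    · obtain ⟨k, hk, h1, h2⟩ := h.exists_lt i
      rw [← h1, ← h2] at hp
      exact Or.inr (mem_iUnion.2 ⟨⟨k, hk⟩, hp⟩)

/-- The frontier of `Ω` is the polygon, so `Ω` is also a component of the complement of the polygon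
alone and touches all its edges. -/
theorem outerFrame (h : BoundaryCycle X v b) (hX : IsHardSphere X) {Ω : Set Plane}
    (hΩ : Ω ∈ comps (drawing X)ᶜ) (hΩb : ¬ Bornology.IsBounded Ω) :
    OuterFrame (fun i : Fin b => v i) (fun i : Fin b => v (i + 1)) (boundary X) Ω where
  nonempty := ⟨v 0, h.mem_boundary 0⟩
  left_mem i := h.mem_boundary i
  right_mem i := h.mem_boundary _
  unit i := norm_sub_of_adj (h.adj i)
  vert i x hx := by
    obtain ⟨k, -, rfl⟩ := h.mem_boundary_iff.1 hx
    exact hX.notMem_openSegment (h.adj i) (h.mem k)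
  disj i j hij := by
    refine (hX.disjoint_openSegment_segment (h.adj i) (h.adj j) ?_).mono_right
      (openSegment_subset_segment ℝ _ _)
    obtain ⟨k, hk, h1, h2⟩ := h.exists_shift (i + 1) j
    have h3 := h.three_le
    by_cases hkb : k = b - 1
    · exfalso
      have e : (i : ℕ) + 1 + k ≡ i [MOD b] := by
        have : (i : ℕ) + 1 + k = i + b := by omega
        rw [this]; simp [Nat.ModEq]
      rw [h.eq_of_modEq e] at h1
      exact hij (Fin.ext (h.inj _ i.2 _ j.2 h1))
    · have := h.edge_ne (j := i) (i := k) (by omega)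
      rwa [← add_assoc, h1, h2] at this
  comp := by
    have hnf : ¬ IsFace X Ω := fun hF => hΩb hF.2.1
    rw [h.frameSet_eq_polygon]
    refine mem_comps_of_disjoint_frontier (isPreconnected_of_mem_comps hΩ)
      (nonempty_of_mem_comps hΩ) ((subset_of_mem_comps hΩ).trans
        (compl_subset_compl.2 h.polygon_subset_drawing)) ?_
    exact disjoint_compl_right.mono_left (h.frontier_subset_polygon hX hΩ hnf)
  unbounded := hΩb
  side i := by
    have hnf : ¬ IsFace X Ω := fun hF => hΩb hF.2.1
    obtain ⟨q, hq⟩ := openEdgeSegment_nonempty s(v i, v (i + 1))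
    refine ⟨q, hq, frontier_subset_closure ?_⟩
    rw [h.frontier_eq hX hΩ hnf]
    exact mem_iUnion.2 ⟨i, openSegment_subset_segment ℝ _ _ hq⟩

end BoundaryCycle

end HardSphere

/-! ### Removing the boundary and counting the lost faces. -/

namespace HardSphere

open Set Filter Topology Metric

/-- Cutting along open bonds creates at most one new component per bond. -/
theorem comps_diff_edges_ncard_le {X : Finset Plane} (hX : IsHardSphere X) {U : Set Plane}
    (hU : IsOpen U) {S : Finset (Sym2 Plane)} (hS : ∀ e ∈ S, e ∈ (bondGraph X).edgeSet)
    (hend : ∀ e ∈ S, ∀ x ∈ e, x ∉ U) (hsub : ∀ e ∈ S, openEdgeSegment e ⊆ U) {n : ℕ}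
    (hf : (comps U).Finite) (hn : (comps U).ncard ≤ n) :
    IsOpen (U \ ⋃ e ∈ S, openEdgeSegment e) ∧
    (comps (U \ ⋃ e ∈ S, openEdgeSegment e)).Finite ∧
    (comps (U \ ⋃ e ∈ S, openEdgeSegment e)).ncard ≤ n + S.card := by
  classical
  induction S using Finset.induction_on with
  | empty => simpa using ⟨hU, hf, hn⟩
  | insert e S he ih =>
    obtain ⟨h1, h2, h3⟩ := ih (fun a ha => hS a (Finset.mem_insert_of_mem ha))
      (fun a ha => hend a (Finset.mem_insert_of_mem ha))
      (fun a ha => hsub a (Finset.mem_insert_of_mem ha))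
    have hset : U \ ⋃ a ∈ insert e S, openEdgeSegment a =
        (U \ ⋃ a ∈ S, openEdgeSegment a) \ openEdgeSegment e := by
      rw [Finset.set_biUnion_insert, Set.sdiff_sdiff, union_comm]
    rw [hset, Finset.card_insert_of_notMem he, ← add_assoc]
    have hedge := hS e (Finset.mem_insert_self _ _)
    have hend' := hend e (Finset.mem_insert_self _ _)
    have hsub' := hsub e (Finset.mem_insert_self _ _)
    have hdis : ∀ a ∈ S, Disjoint (openEdgeSegment e) (openEdgeSegment a) := by
      intro a ha
      have hae := hS a (Finset.mem_insert_of_mem ha)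
      have hne : e ≠ a := fun h => he (h ▸ ha)
      induction e with
      | h x y =>
        induction a with
        | h z w =>
          exact (hX.disjoint_openSegment_segment hedge hae hne).mono_right
            (openSegment_subset_segment ℝ _ _)
    induction e with
    | h x y =>
      have hadj : (bondGraph X).Adj x y := hedge
      have hx := hend' x (Sym2.mem_mk_left _ _)
      have hy := hend' y (Sym2.mem_mk_right _ _)
      set W := U \ ⋃ a ∈ S, openEdgeSegment a with hW
      have hWU : W ⊆ U := sdiff_subset
      have hseg : openEdgeSegment s(x, y) = lineSet x (y - x) (Ioo 0 1) :=
        (lineSet_Ioo_eq_openSegment x y).symm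
      have hWe : openEdgeSegment s(x, y) ⊆ W := by
        refine subset_sdiff.2 ⟨hsub', ?_⟩
        rw [disjoint_iUnion₂_right]
        exact hdis
      have hopen : IsOpen (W \ openEdgeSegment s(x, y)) := by
        have : W \ openEdgeSegment s(x, y) = W \ segment ℝ x y := by
          rw [segment_eq_openSegment_union]
          ext p
          constructor
          · rintro ⟨hp, hpe⟩
            refine ⟨hp, ?_⟩
            rintro ((rfl | rfl) | h)
            · exact hx (hWU hp)
            · exact hy (hWU hp)
            · exact hpe h
          · rintro ⟨hp, hpe⟩
            exact ⟨hp, fun h => hpe (Or.inr h)⟩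
        rw [this]
        exact h1.sdiff (isClosed_segment x y)
      rw [hseg] at hopen hWe ⊢
      exact ⟨hopen, comps_diff_lineSet_ncard_le h1 ⟨x, fun h => hx (hWU h)⟩ (norm_sub_of_adj hadj)
        isOpen_Ioo (by simp) isPreconnected_Ioo hWe hopen h2 h3⟩

/-- This describes the side of a bond by short vectors, without reference to the rest of the
drawing, so that sides for `X` and for `X'` can be compared. -/
theorem leftComp_eq_iff_pointsInto {X : Finset Plane} (hX : IsHardSphere X) {x y : Plane}
    (h : (bondGraph X).Adj x y) {f : Set Plane} (hf : f ∈ comps (drawing X)ᶜ) {q d : Plane}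
    (hq : q ∈ openSegment ℝ x y) (hd : 0 < cr (y - x) d) :
    leftComp X x y = f ↔ PointsInto f q d := by
  have hK := isClosed_restDrawing X s(x, y)
  have hKne := restDrawing_nonempty h s(x, y)
  have hdis := disjoint_restDrawing hX h
  constructor
  · rintro rfl
    exact pointsInto_of_edgeSide_subset hK hKne (norm_sub_of_adj h) hdis
      (edgeSide_subset_leftComp hX h) hq hd
  · intro hp
    have hf' := hf
    rw [drawing_eq h] at hf'
    have := edgeSide_subset_of_pointsInto hK hKne (norm_sub_of_adj h) hdis hf' hq hd hp
    have hm := epsilon_mem_edgeSide hX h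
    exact eq_leftComp_of_mem hX h hf hm (this hm)

section Remove

variable {X : Finset Plane}

theorem bondGraph_removeBoundary_adj {x y : Plane} :
    (bondGraph (removeBoundary X)).Adj x y ↔
      (bondGraph X).Adj x y ∧ x ∉ boundary X ∧ y ∉ boundary X := by
  simp only [bondGraph_adj, BoundaryCycle.mem_removeBoundary]
  tauto

theorem removeBoundary_subset : removeBoundary X ⊆ X := by
  intro x hx
  exact (BoundaryCycle.mem_removeBoundary.1 hx).1

theorem IsHardSphere.removeBoundary (hX : IsHardSphere X) : IsHardSphere (removeBoundary X) :=
  fun x hx y hy => hX x (removeBoundary_subset hx) y (removeBoundary_subset hy)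

theorem edgeSet_removeBoundary_subset :
    (bondGraph (removeBoundary X)).edgeSet ⊆ (bondGraph X).edgeSet := by
  intro e he
  induction e with
  | h x y => exact (bondGraph_removeBoundary_adj.1 he).1

theorem bonds_removeBoundary_subset : bonds (removeBoundary X) ⊆ bonds X := fun _ he =>
  mem_bonds.2 (edgeSet_removeBoundary_subset (mem_bonds.1 he))

theorem drawing_removeBoundary_subset : drawing (removeBoundary X) ⊆ drawing X :=
  union_subset_union (Finset.coe_subset.2 removeBoundary_subset)
    (biUnion_subset_biUnion_left edgeSet_removeBoundary_subset)

theorem notMem_drawing_removeBoundary (hX : IsHardSphere X) {x : Plane} (hx : x ∈ boundary X) :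
    x ∉ drawing (removeBoundary X) := by
  have hxX : x ∈ X := by classical exact (Finset.mem_filter.1 hx).1
  rintro (h | h)
  · exact (BoundaryCycle.mem_removeBoundary.1 h).2 hx
  · obtain ⟨e, he, hxe⟩ := mem_iUnion₂.1 h
    induction e with
    | h a c =>
      obtain ⟨hac, ha, hc⟩ := bondGraph_removeBoundary_adj.1 he
      rw [edgeSegment_mk, segment_eq_openSegment_union] at hxe
      rcases hxe with (rfl | rfl) | hxe
      · exact ha hx
      · exact hc hx
      · exact hX.notMem_openSegment hac hxX hxe

theorem disjoint_openSegment_drawing_removeBoundary (hX : IsHardSphere X) {x y : Plane}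
    (h : (bondGraph X).Adj x y) (h' : ¬ (bondGraph (removeBoundary X)).Adj x y) :
    Disjoint (openSegment ℝ x y) (drawing (removeBoundary X)) := by
  rw [Set.disjoint_left]
  rintro p hp (hpY | hpe)
  · exact hX.notMem_openSegment h (removeBoundary_subset hpY) hp
  · obtain ⟨e, he, hpe⟩ := mem_iUnion₂.1 hpe
    induction e with
    | h a c =>
      refine Set.disjoint_left.1 (hX.disjoint_openSegment_segment h
        (bondGraph_removeBoundary_adj.1 he).1 fun hh => h' ?_) hp hpe
      have : s(x, y) ∈ (bondGraph (removeBoundary X)).edgeSet := hh ▸ he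
      exact this

/-- An edge on the boundary of a component of the complement of the inner configuration belongs to
the inner configuration. -/
theorem adj_removeBoundary_of_segment_subset (hX : IsHardSphere X) {x y : Plane}
    (h : (bondGraph X).Adj x y) (hs : segment ℝ x y ⊆ drawing (removeBoundary X)) :
    (bondGraph (removeBoundary X)).Adj x y :=
  bondGraph_removeBoundary_adj.2 ⟨h,
    fun hx => notMem_drawing_removeBoundary hX hx (hs (left_mem_segment ℝ _ _)),
    fun hy => notMem_drawing_removeBoundary hX hy (hs (right_mem_segment ℝ _ _))⟩

/-- The frontier of a common face lies in the inner drawing, so all its bonds survive, and on which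
side of a bond the face lies depends on the face alone. -/
theorem faceLength_removeBoundary (hX : IsHardSphere X) {f : Set Plane} (hf : IsFace X f)
    (hf' : IsFace (removeBoundary X) f) : faceLength (removeBoundary X) f = faceLength X f := by
  classical
  rw [faceLength_eq hX hf, faceLength_eq hX.removeBoundary hf']
  congr 1
  ext ⟨x, y⟩
  simp only [Finset.mem_filter, mem_darts]
  have key : ∀ h' : (bondGraph (removeBoundary X)).Adj x y,
      leftComp (removeBoundary X) x y = f ↔ leftComp X x y = f := by
    intro h'
    obtain ⟨q, hq⟩ := openEdgeSegment_nonempty s(x, y)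
    have hd : 0 < cr (y - x) (pp (y - x)) := by
      rw [cr_pp, norm_eq_one_iff.1 (norm_sub_of_adj h')]; exact one_pos
    rw [leftComp_eq_iff_pointsInto hX.removeBoundary h' hf'.mem_comps hq hd,
      leftComp_eq_iff_pointsInto hX (bondGraph_removeBoundary_adj.1 h').1 hf.mem_comps hq hd]
  constructor
  · rintro ⟨h', hl⟩
    exact ⟨(bondGraph_removeBoundary_adj.1 h').1, (key h').1 hl⟩
  · rintro ⟨h, hl⟩
    have h' : (bondGraph (removeBoundary X)).Adj x y := by
      refine adj_removeBoundary_of_segment_subset hX h ?_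
      refine Subset.trans ?_ (frontier_subset_drawing hf'.mem_comps)
      exact (segment_subset_frontier_iff hX h hf.mem_comps).2 (Or.inl hl)
    exact ⟨h', (key h').2 hl⟩

end Remove

namespace BoundaryCycle

variable {X : Finset Plane} {v : ℕ → Plane} {b : ℕ} {Ω : Set Plane}

/-- The unbounded component after removing the boundary. -/
def outside (X : Finset Plane) (Ω : Set Plane) : Set Plane :=
  connectedComponentIn (drawing (removeBoundary X))ᶜ (Classical.epsilon fun p => p ∈ Ω)

theorem epsilon_mem (hΩ : Ω ∈ comps (drawing X)ᶜ) : (Classical.epsilon fun p => p ∈ Ω) ∈ Ω :=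
  Classical.epsilon_spec (nonempty_of_mem_comps hΩ)

theorem subset_compl_inner (hΩ : Ω ∈ comps (drawing X)ᶜ) : Ω ⊆ (drawing (removeBoundary X))ᶜ :=
  (subset_of_mem_comps hΩ).trans (compl_subset_compl.2 drawing_removeBoundary_subset)

theorem outside_mem_comps (hΩ : Ω ∈ comps (drawing X)ᶜ) :
    outside X Ω ∈ comps (drawing (removeBoundary X))ᶜ :=
  comp_mem_comps (subset_compl_inner hΩ (epsilon_mem hΩ))

theorem subset_outside (hΩ : Ω ∈ comps (drawing X)ᶜ) : Ω ⊆ outside X Ω :=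
  (isPreconnected_of_mem_comps hΩ).subset_connectedComponentIn (epsilon_mem hΩ)
    (subset_compl_inner hΩ)

theorem isOpen_outside (hΩ : Ω ∈ comps (drawing X)ᶜ) : IsOpen (outside X Ω) :=
  isOpen_of_mem_comps (isOpen_compl_drawing _) (outside_mem_comps hΩ)

theorem boundary_subset_outside (h : BoundaryCycle X v b) (hX : IsHardSphere X)
    (hΩ : Ω ∈ comps (drawing X)ᶜ) (hΩb : ¬ Bornology.IsBounded Ω) (i : ℕ) :
    v i ∈ outside X Ω := by
  have hnf : ¬ IsFace X Ω := fun hF => hΩb hF.2.1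
  have hcl : v i ∈ closure Ω := by
    apply frontier_subset_closure
    rw [h.frontier_eq hX hΩ hnf]
    exact mem_iUnion.2 ⟨i, left_mem_segment ℝ _ _⟩
  have hv := notMem_drawing_removeBoundary hX (h.mem_boundary i)
  have hm := outside_mem_comps hΩ
  have hc := comp_mem_comps (U := (drawing (removeBoundary X))ᶜ) hv
  obtain ⟨q, hq, hqΩ⟩ := mem_closure_iff.1 hcl _
    (isOpen_of_mem_comps (isOpen_compl_drawing _) hc) (mem_connectedComponentIn hv)
  rw [comps_eq_of_mem hm hc (subset_outside hΩ hqΩ) hq]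
  exact mem_connectedComponentIn hv

/-- A removed bond has an end at a boundary particle, which lies in the outside component. The bond
without its other end is connected and avoids the inner drawing, so it stays there. -/
theorem openSegment_subset_outside (h : BoundaryCycle X v b) (hX : IsHardSphere X)
    (hΩ : Ω ∈ comps (drawing X)ᶜ) (hΩb : ¬ Bornology.IsBounded Ω) {x y : Plane}
    (ha : (bondGraph X).Adj x y) (ha' : ¬ (bondGraph (removeBoundary X)).Adj x y) :
    openSegment ℝ x y ⊆ outside X Ω := by
  have key : ∀ x y, (bondGraph X).Adj x y → ¬ (bondGraph (removeBoundary X)).Adj x y →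
      x ∈ boundary X → openSegment ℝ x y ⊆ outside X Ω := by
    intro x y ha ha' hx
    obtain ⟨i, -, rfl⟩ := h.mem_boundary_iff.1 hx
    have hins : lineSet (v i) (y - v i) (Ico 0 1) = insert (v i) (openSegment ℝ (v i) y) := by
      rw [lineSet, ← Ioo_insert_left one_pos, image_insert_eq, zero_smul, add_zero]
      congr 1
      exact lineSet_Ioo_eq_openSegment (v i) y
    have := subset_comp_of_isPreconnected (outside_mem_comps hΩ)
      (isPreconnected_lineSet (x := v i) (u := y - v i) (I := Ico 0 1) isPreconnected_Ico) (by
        rw [hins]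
        refine insert_subset (notMem_drawing_removeBoundary hX hx) ?_
        exact subset_compl_iff_disjoint_right.2
          (disjoint_openSegment_drawing_removeBoundary hX ha ha'))
      ⟨v i, by rw [hins]; exact mem_insert _ _, h.boundary_subset_outside hX hΩ hΩb i⟩
    rw [hins] at this
    exact (subset_insert _ _).trans this
  by_cases hx : x ∈ boundary X
  · exact key x y ha ha' hx
  · by_cases hy : y ∈ boundary X
    · rw [openSegment_symm]
      exact key y x ha.symm (fun h => ha' h.symm) hy
    · exact absurd (bondGraph_removeBoundary_adj.2 ⟨ha, hx, hy⟩) ha'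

theorem drawing_diff_subset_outside (h : BoundaryCycle X v b) (hX : IsHardSphere X)
    (hΩ : Ω ∈ comps (drawing X)ᶜ) (hΩb : ¬ Bornology.IsBounded Ω) :
    drawing X \ drawing (removeBoundary X) ⊆ outside X Ω := by
  have hvert : ∀ p ∈ X, p ∉ drawing (removeBoundary X) → p ∈ outside X Ω := by
    intro p hpX hp
    by_cases hpb : p ∈ boundary X
    · obtain ⟨i, -, rfl⟩ := h.mem_boundary_iff.1 hpb
      exact h.boundary_subset_outside hX hΩ hΩb i
    · exact absurd (Or.inl (mem_removeBoundary.2 ⟨hpX, hpb⟩)) hp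
  rintro p ⟨hpX | hpe, hp⟩
  · exact hvert p hpX hp
  · obtain ⟨e, he, hpe⟩ := mem_iUnion₂.1 hpe
    induction e with
    | h x y =>
      have he : (bondGraph X).Adj x y := he
      rw [edgeSegment_mk, segment_eq_openSegment_union] at hpe
      rcases hpe with (rfl | rfl) | hpe
      · exact hvert _ he.1 hp
      · exact hvert _ he.2.1 hp
      · refine h.openSegment_subset_outside hX hΩ hΩb he (fun h' => hp ?_) hpe
        exact segment_subset_drawing h' (openSegment_subset_segment ℝ _ _ hpe)

/-- Everything removed from the drawing lies in the outside component, so the other components for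
`X'` are not cut by it. -/
theorem mem_comps_of_inner (h : BoundaryCycle X v b) (hX : IsHardSphere X)
    (hΩ : Ω ∈ comps (drawing X)ᶜ) (hΩb : ¬ Bornology.IsBounded Ω) {f : Set Plane}
    (hf : f ∈ comps (drawing (removeBoundary X))ᶜ) (hne : f ≠ outside X Ω) :
    f ∈ comps (drawing X)ᶜ := by
  refine mem_comps_of_subset hf ?_ (compl_subset_compl.2 drawing_removeBoundary_subset)
  intro p hp hpd
  exact hne (comps_eq_of_mem hf (outside_mem_comps hΩ) hp
    (h.drawing_diff_subset_outside hX hΩ hΩb ⟨hpd, subset_of_mem_comps hf hp⟩))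

theorem not_isBounded_outside (hΩ : Ω ∈ comps (drawing X)ᶜ) (hΩb : ¬ Bornology.IsBounded Ω) :
    ¬ Bornology.IsBounded (outside X Ω) := fun hb => hΩb (hb.subset (subset_outside hΩ))

theorem isFace_of_isFace_removeBoundary (h : BoundaryCycle X v b) (hX : IsHardSphere X)
    (hΩ : Ω ∈ comps (drawing X)ᶜ) (hΩb : ¬ Bornology.IsBounded Ω) {f : Set Plane}
    (hf : IsFace (removeBoundary X) f) : IsFace X f := by
  have hne : f ≠ outside X Ω := by
    rintro rfl
    exact not_isBounded_outside hΩ hΩb hf.2.1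
  refine (h.isFace_iff hX hΩ hΩb (h.mem_comps_of_inner hX hΩ hΩb hf.mem_comps hne)).2 ?_
  rintro rfl
  exact hΩb hf.2.1

/-- A face whose edges all belong to the inner configuration is a face of it. -/
theorem isFace_removeBoundary_of_edges {f : Set Plane} (hf : IsFace X f)
    (hfe : ∀ x y, (bondGraph X).Adj x y → segment ℝ x y ⊆ frontier f →
      (bondGraph (removeBoundary X)).Adj x y) : IsFace (removeBoundary X) f := by
  obtain ⟨hc, hb, x, w, hw⟩ := hf
  have hedge : ∀ e ∈ w.edges, e ∈ (bondGraph (removeBoundary X)).edgeSet := by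
    intro e he
    have hs : edgeSegment e ⊆ frontier f := by
      rw [hw]
      exact subset_biUnion_of_mem (s := {e | e ∈ w.edges}) (u := edgeSegment) he
    have hm := w.edges_subset_edgeSet he
    induction e with
    | h a c => exact hfe a c hm hs
  refine ⟨?_, hb, x, w.transfer _ hedge, by rw [SimpleGraph.Walk.edges_transfer, hw]⟩
  refine mem_comps_of_disjoint_frontier (isPreconnected_of_mem_comps hc)
    (nonempty_of_mem_comps hc) ((subset_of_mem_comps hc).trans
      (compl_subset_compl.2 drawing_removeBoundary_subset)) ?_
  rw [hw, Set.disjoint_left]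
  intro p hp hpd
  obtain ⟨e, he, hpe⟩ := mem_iUnion₂.1 hp
  exact hpd (Or.inr (mem_iUnion₂.2 ⟨e, hedge e he, hpe⟩))

/-- A face of `X` that is not inside the outside component is a whole component for `X'` as well.
All bonds on its frontier then belong to `X'`, so the closed walk tracing the frontier can be
transferred. -/
theorem isFace_removeBoundary_iff (h : BoundaryCycle X v b) (hX : IsHardSphere X)
    (hΩ : Ω ∈ comps (drawing X)ᶜ) (hΩb : ¬ Bornology.IsBounded Ω) {f : Set Plane} :
    IsFace (removeBoundary X) f ↔ IsFace X f ∧ ¬ f ⊆ outside X Ω := by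
  constructor
  · intro hf
    refine ⟨h.isFace_of_isFace_removeBoundary hX hΩ hΩb hf, fun hs => ?_⟩
    obtain ⟨p, hp⟩ := nonempty_of_mem_comps hf.mem_comps
    have := comps_eq_of_mem hf.mem_comps (outside_mem_comps hΩ) hp (hs hp)
    exact not_isBounded_outside hΩ hΩb (this ▸ hf.2.1)
  · rintro ⟨hf, hns⟩
    have hfc : f ∈ comps (drawing (removeBoundary X))ᶜ := by
      obtain ⟨p, hp⟩ := nonempty_of_mem_comps hf.mem_comps
      have hpY : p ∈ (drawing (removeBoundary X))ᶜ := fun hpd =>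
        subset_of_mem_comps hf.mem_comps hp (drawing_removeBoundary_subset hpd)
      have hc := comp_mem_comps hpY
      have hsub : f ⊆ connectedComponentIn (drawing (removeBoundary X))ᶜ p :=
        (isPreconnected_of_mem_comps hf.mem_comps).subset_connectedComponentIn hp
          ((subset_of_mem_comps hf.mem_comps).trans
            (compl_subset_compl.2 drawing_removeBoundary_subset))
      have hne : connectedComponentIn (drawing (removeBoundary X))ᶜ p ≠ outside X Ω :=
        fun he => hns (he ▸ hsub)
      rw [comps_eq_of_mem hf.mem_comps (h.mem_comps_of_inner hX hΩ hΩb hc hne) hp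
        (mem_connectedComponentIn hpY)]
      exact hc
    exact isFace_removeBoundary_of_edges hf fun x y hxy hs =>
      adj_removeBoundary_of_segment_subset hX hxy (hs.trans (frontier_subset_drawing hfc))

/-- A face that is lost by removing the boundary has an edge at a boundary particle. -/
theorem exists_dart_of_not_isFace (hX : IsHardSphere X)
    {f : Set Plane} (hf : IsFace X f) (hnf : ¬ IsFace (removeBoundary X) f) :
    ∃ x y, (bondGraph X).Adj x y ∧ x ∈ boundary X ∧
      (leftComp X x y = f ∨ leftComp X y x = f) := by
  by_contra hcon
  push Not at hcon
  refine hnf (isFace_removeBoundary_of_edges hf fun x y hxy hs => ?_)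
  have hs' := (segment_subset_frontier_iff hX hxy hf.mem_comps).1 hs
  refine bondGraph_removeBoundary_adj.2 ⟨hxy, fun hx => ?_, fun hy => ?_⟩
  · rcases hs' with h1 | h1
    · exact (hcon x y hxy hx).1 h1
    · exact (hcon x y hxy hx).2 h1
  · rcases hs' with h1 | h1
    · exact (hcon y x hxy.symm hy).2 h1
    · exact (hcon y x hxy.symm hy).1 h1

theorem exists_adj_inner (h : BoundaryCycle X v b) (hne : (removeBoundary X).Nonempty) :
    ∃ c, ∃ x ∈ removeBoundary X, (bondGraph X).Adj x (v c) := by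
  obtain ⟨x, hx⟩ := hne
  obtain ⟨w⟩ := h.reachable x (mem_removeBoundary.1 hx).1 (v 0) (h.mem 0)
  obtain ⟨d, -, hd1, hd2⟩ := w.exists_boundary_dart (removeBoundary X) hx
    (fun hv => (mem_removeBoundary.1 hv).2 (h.mem_boundary 0))
  have hd2 : d.snd ∉ removeBoundary X := hd2
  have hd3 : d.snd ∈ boundary X := by
    by_contra hb
    exact hd2 (mem_removeBoundary.2 ⟨d.adj.2.1, hb⟩)
  obtain ⟨c, -, hc⟩ := h.mem_boundary_iff.1 hd3
  exact ⟨c, d.fst, hd1, hc ▸ d.adj⟩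

/-- A path which starts at an inner particle and then runs through all boundary particles. -/
def tailPath (v : ℕ → Plane) (c : ℕ) (x : Plane) : ℕ → Plane
  | 0 => x
  | i + 1 => v (c + i)

theorem tailPath_adj (h : BoundaryCycle X v b) {c : ℕ} {x : Plane}
    (hx : (bondGraph X).Adj x (v c)) (i : ℕ) :
    (bondGraph X).Adj (tailPath v c x i) (tailPath v c x (i + 1)) := by
  cases i with
  | zero => exact hx
  | succ i => exact h.adj (c + i)

theorem tailPath_inj (h : BoundaryCycle X v b) {c : ℕ} {x : Plane} (hx : x ∉ boundary X) :
    ∀ i ≤ b, ∀ j ≤ b, tailPath v c x i = tailPath v c x j → i = j := by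
  have hp := h.pos
  intro i hi j hj hij
  cases i with
  | zero =>
    cases j with
    | zero => rfl
    | succ j => exact absurd (h.mem_boundary (c + j)) (by rw [← show x = v (c + j) from hij]; exact hx)
  | succ i =>
    cases j with
    | zero => exact absurd (h.mem_boundary (c + i)) (by rw [show v (c + i) = x from hij]; exact hx)
    | succ j =>
      have := (Nat.ModEq.add_left_cancel' c (h.modEq hij)).eq_of_lt_of_lt (by omega) (by omega)
      omega

/-- Removing the boundary merges at most as many faces as the number of removed bonds exceeds the
number of removed particles. -/
theorem ncard_lost_faces_le (h : BoundaryCycle X v b) (hX : IsHardSphere X)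
    (hne : (removeBoundary X).Nonempty)
    (hΩ : Ω ∈ comps (drawing X)ᶜ) (hΩb : ¬ Bornology.IsBounded Ω) :
    {f | IsFace X f ∧ f ⊆ outside X Ω}.ncard + (bonds (removeBoundary X)).card + b ≤
      (bonds X).card := by
  classical
  obtain ⟨c, x, hx, hadj⟩ := h.exists_adj_inner hne
  have hp := h.pos
  have hxb := (mem_removeBoundary.1 hx).2
  set g := outside X Ω with hg
  set p := tailPath v c x with hpd
  have hpadj : ∀ i, (bondGraph X).Adj (p i) (p (i + 1)) := h.tailPath_adj hadj
  have hpinj := h.tailPath_inj (c := c) hxb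
  have hgo : IsOpen g := isOpen_outside hΩ
  have hgY : ∀ q ∈ g, q ∉ drawing (removeBoundary X) :=
    fun q hq => subset_of_mem_comps (outside_mem_comps hΩ) hq
  have hxg : x ∉ g := fun hxg => hgY x hxg (Or.inl hx)
  have hcut : ∀ i, ¬ (bondGraph (removeBoundary X)).Adj (p i) (p (i + 1)) := fun i hi =>
    (bondGraph_removeBoundary_adj.1 hi).2.2 (h.mem_boundary _)
  -- The path starts at an inner particle, outside `g`, and omits one edge of the cycle; cutting
  -- along its `b` bonds leaves at most one component.
  obtain ⟨h1, h2, h3⟩ := comps_diff_path_ncard_le (U := g) (v := p) (k := b) (n := 1) hgo hxg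
    (fun i _ => norm_sub_of_adj (hpadj i))
    (fun i _ => by
      rw [Ioc_eq_insert_openSegment]
      exact insert_subset (h.boundary_subset_outside hX hΩ hΩb _)
        (h.openSegment_subset_outside hX hΩ hΩb (hpadj i) (hcut i)))
    (fun i hi j hj => hX.disjoint_path (fun i _ => hpadj i) hpinj hi hj)
    (by rw [comps_self (outside_mem_comps hΩ)]; exact finite_singleton _)
    (by rw [comps_self (outside_mem_comps hΩ), ncard_singleton])
  have harc : g \ ⋃ i < b, lineSet (p i) (p (i + 1) - p i) (Ioc 0 1) = g \ arc p b := by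
    have := compl_arc_eq p b
    ext q
    constructor
    · rintro ⟨hq, hq'⟩
      refine ⟨hq, ?_⟩
      rw [← mem_compl_iff, this]
      exact ⟨fun hqx => hxg (by rwa [show q = x from hqx] at hq), hq'⟩
    · rintro ⟨hq, hq'⟩
      rw [← mem_compl_iff, this] at hq'
      exact ⟨hq, hq'.2⟩
  rw [harc] at h1 h2 h3
  set P : Finset (Sym2 Plane) := (Finset.range b).image fun i => s(p i, p (i + 1)) with hPd
  have hPcard : P.card = b := by
    rw [hPd, Finset.card_image_of_injOn, Finset.card_range]
    intro i hi j hj hij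
    by_contra hne
    exact edge_ne_of_injOn hpinj (by simpa using hi) (by simpa using hj) hne hij
  have hPX : P ⊆ bonds X := by
    intro e he
    obtain ⟨i, -, rfl⟩ := Finset.mem_image.1 he
    exact mem_bonds.2 (hpadj i)
  have hPY : Disjoint P (bonds (removeBoundary X)) := by
    rw [Finset.disjoint_left]
    intro e he heY
    obtain ⟨i, -, rfl⟩ := Finset.mem_image.1 he
    exact hcut i (mem_bonds.1 heY)
  -- The other removed bonds, each costing at most one component. Their ends are no longer in the
  -- region, since all particles have been removed from it.
  set S := bonds X \ (P ∪ bonds (removeBoundary X)) with hSd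
  have hScard : S.card + b + (bonds (removeBoundary X)).card = (bonds X).card := by
    have hsub : P ∪ bonds (removeBoundary X) ⊆ bonds X :=
      Finset.union_subset hPX bonds_removeBoundary_subset
    have := Finset.card_sdiff_add_card_eq_card hsub
    rw [Finset.card_union_of_disjoint hPY, hPcard, ← hSd] at this
    omega
  have hSX : ∀ e ∈ S, e ∈ (bondGraph X).edgeSet := fun e he =>
    mem_bonds.1 (Finset.mem_sdiff.1 he).1
  have hvarc : ∀ i, v i ∈ arc p b := by
    intro i
    obtain ⟨k, hk, hki, -⟩ := h.exists_shift c i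
    exact Or.inl ⟨k + 1, hk, hki.symm⟩
  have hvert : ∀ z ∈ X, z ∉ g \ arc p b := by
    rintro z hz ⟨hzg, hza⟩
    by_cases hzb : z ∈ boundary X
    · obtain ⟨i, -, rfl⟩ := h.mem_boundary_iff.1 hzb
      exact hza (hvarc i)
    · exact hgY z hzg (Or.inl (mem_removeBoundary.2 ⟨hz, hzb⟩))
  have hcuts := comps_diff_edges_ncard_le hX h1 hSX
    (fun e he z hze => by
      refine hvert z ?_
      have := hSX e he
      obtain ⟨y, rfl⟩ := Sym2.mem_iff_exists.1 hze
      have hadj : (bondGraph X).Adj z y := this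
      exact hadj.1)
    (fun e he => by
      have heX := hSX e he
      have he' := (Finset.mem_sdiff.1 he).2
      rw [Finset.mem_union, not_or] at he'
      induction e with
      | h a d =>
        have hadj : (bondGraph X).Adj a d := heX
        refine subset_sdiff.2 ⟨h.openSegment_subset_outside hX hΩ hΩb hadj
          (fun h' => he'.2 (mem_bonds.2 h')), ?_⟩
        rw [Set.disjoint_left]
        rintro q hq (⟨i, -, rfl⟩ | ⟨i, hi, hqi⟩)
        · exact hX.notMem_openSegment hadj (hpadj i).1 hq
        · refine Set.disjoint_left.1 (hX.disjoint_openSegment_segment hadj (hpadj i) ?_) hq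
            (openSegment_subset_segment ℝ _ _ hqi)
          exact fun hh => he'.1 (Finset.mem_image.2 ⟨i, Finset.mem_range.2 hi, hh.symm⟩))
    h2 h3
  have hset : (g \ arc p b) \ ⋃ e ∈ S, openEdgeSegment e = g \ drawing X := by
    ext q
    constructor
    · rintro ⟨⟨hqg, hqa⟩, hqS⟩
      refine ⟨hqg, ?_⟩
      rintro (hqX | hqe)
      · exact hvert q hqX ⟨hqg, hqa⟩
      · obtain ⟨e, he, hqe⟩ := mem_iUnion₂.1 hqe
        induction e with
        | h a d =>
          have hadj : (bondGraph X).Adj a d := he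
          rw [edgeSegment_mk, segment_eq_openSegment_union] at hqe
          rcases hqe with (rfl | rfl) | hqe
          · exact hvert _ hadj.1 ⟨hqg, hqa⟩
          · exact hvert _ hadj.2.1 ⟨hqg, hqa⟩
          · by_cases heP : s(a, d) ∈ P
            · obtain ⟨i, hi, hie⟩ := Finset.mem_image.1 heP
              refine hqa (Or.inr ⟨i, Finset.mem_range.1 hi, ?_⟩)
              have : openEdgeSegment s(p i, p (i + 1)) = openEdgeSegment s(a, d) := by rw [hie]
              change q ∈ openEdgeSegment s(p i, p (i + 1))
              rw [this]
              exact hqe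
            · by_cases heY : s(a, d) ∈ bonds (removeBoundary X)
              · exact hgY q hqg (segment_subset_drawing (mem_bonds.1 heY)
                  (openSegment_subset_segment ℝ _ _ hqe))
              · refine hqS (mem_iUnion₂.2 ⟨s(a, d), ?_, hqe⟩)
                rw [hSd, Finset.mem_sdiff, Finset.mem_union, not_or]
                exact ⟨mem_bonds.2 hadj, heP, heY⟩
    · rintro ⟨hqg, hqd⟩
      refine ⟨⟨hqg, ?_⟩, ?_⟩
      · rintro (⟨i, -, rfl⟩ | ⟨i, -, hqi⟩)
        · exact hqd (Or.inl (hpadj i).1)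
        · exact hqd (segment_subset_drawing (hpadj i) (openSegment_subset_segment ℝ _ _ hqi))
      · intro hqS
        obtain ⟨e, he, hqe⟩ := mem_iUnion₂.1 hqS
        have heX := hSX e he
        induction e with
        | h a d => exact hqd (segment_subset_drawing heX (openSegment_subset_segment ℝ _ _ hqe))
  rw [hset] at hcuts
  -- The unbounded component is among the pieces of `g` and uses up the initial one, so only the
  -- cuts along `S` account for the lost faces.
  have hsubc : insert Ω {f | IsFace X f ∧ f ⊆ g} ⊆ comps (g \ drawing X) := by
    have hm : ∀ f ∈ comps (drawing X)ᶜ, f ⊆ g → f ∈ comps (g \ drawing X) := fun f hf hfg =>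
      mem_comps_of_subset hf (subset_sdiff.2 ⟨hfg, disjoint_left.2 fun q hq hqd =>
        subset_of_mem_comps hf hq hqd⟩) (fun q hq => hq.2)
    rintro f (rfl | ⟨hf, hfg⟩)
    · exact hm _ hΩ (subset_outside hΩ)
    · exact hm _ hf.mem_comps hfg
  have hcard := ncard_le_ncard hsubc hcuts.2.1
  rw [ncard_insert_of_notMem (fun hΩm => hΩb hΩm.1.2.1)
    ((finite_isFace hX).subset fun f hf => hf.1)] at hcard
  have := hcuts.2.2
  omega

end BoundaryCycle

end HardSphere

namespace HardSphere

open Set Filter Topology Metric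

/-! ### Six directions -/

theorem dt_eq_of_unit {e : Plane} (he : ‖e‖ = 1) (a c : Plane) :
    dt a c = dt e a * dt e c + cr e a * cr e c := by
  have h := norm_eq_one_iff.1 he
  have : dt a c * dt e e = dt e a * dt e c + cr e a * cr e c := by simp only [dt, cr]; ring
  rwa [h, mul_one] at this

theorem cr_eq_of_unit {e : Plane} (he : ‖e‖ = 1) (a c : Plane) :
    cr a c = dt e a * cr e c - cr e a * dt e c := by
  have h := norm_eq_one_iff.1 he
  have : cr a c * dt e e = dt e a * cr e c - cr e a * dt e c := by simp only [dt, cr]; ring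
  rwa [h, mul_one] at this

theorem dt_sq_add_cr_sq {e a : Plane} (he : ‖e‖ = 1) (ha : ‖a‖ = 1) :
    dt e a ^ 2 + cr e a ^ 2 = 1 := by
  have h1 := dt_eq_of_unit he a a
  rw [norm_eq_one_iff.1 ha] at h1
  nlinarith

theorem cr_add_left (a c e : Plane) : cr (a + c) e = cr a e + cr c e := by simp [cr]; ring
theorem cr_smul_left (t : ℝ) (c e : Plane) : cr (t • c) e = t * cr c e := by simp [cr]; ring
theorem dt_pp_right (a c : Plane) : dt a (pp c) = - cr a c := by simp [dt, cr]; ring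
theorem cr_pp_right (a c : Plane) : cr a (pp c) = dt a c := by simp [dt, cr]

/-- Half the square root of three. -/
noncomputable def hs : ℝ := √3 / 2

theorem hs_pos : 0 < hs := by unfold hs; positivity

theorem hs_sq : hs * hs = 3 / 4 := by
  unfold hs
  have := Real.mul_self_sqrt (show (0 : ℝ) ≤ 3 by norm_num)
  linear_combination this / 4

/-- The six directions obtained from `d` by turning through multiples of sixty degrees. -/
noncomputable def hexDir (d : Plane) : Fin 6 → Plane :=
  ![d, (1 / 2 : ℝ) • d + hs • pp d, (-1 / 2 : ℝ) • d + hs • pp d,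
    -d, -((1 / 2 : ℝ) • d + hs • pp d), -((-1 / 2 : ℝ) • d + hs • pp d)]

theorem norm_turn {d : Plane} (hd : ‖d‖ = 1) {c s : ℝ} (hcs : c ^ 2 + s ^ 2 = 1) :
    ‖c • d + s • pp d‖ = 1 := by
  rw [norm_eq_one_iff] at hd ⊢
  have : dt (c • d + s • pp d) (c • d + s • pp d) = (c ^ 2 + s ^ 2) * dt d d := by
    simp [dt]; ring
  rw [this, hcs, hd, one_mul]

/-- Here `A` and `B` are the cosine and sine of the angle from `a` to `d`, and the alternatives are
the six directions in turn. Going around, some direction has positive sine while the one sixty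
degrees before it has negative sine; its angle lies strictly between zero and sixty degrees. -/
theorem exists_sector {A B : ℝ} (h : A ^ 2 + B ^ 2 = 1) (h0 : B ≠ 0) (h1 : B / 2 + hs * A ≠ 0)
    (h2 : -B / 2 + hs * A ≠ 0) :
    (0 < B ∧ 1 / 2 < A) ∨ (0 < B / 2 + hs * A ∧ 1 / 2 < A / 2 - hs * B) ∨
    (0 < -B / 2 + hs * A ∧ 1 / 2 < -A / 2 - hs * B) ∨ (0 < -B ∧ 1 / 2 < -A) ∨
    (0 < -(B / 2 + hs * A) ∧ 1 / 2 < -(A / 2 - hs * B)) ∨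
    (0 < -(-B / 2 + hs * A) ∧ 1 / 2 < -(-A / 2 - hs * B)) := by
  have hsq := hs_sq
  have hp := hs_pos
  -- If `a`, `c` are the cosine and sine of an angle, then `c / 2 - hs * a` is the sine of that
  -- angle diminished by sixty degrees.
  have key : ∀ a c : ℝ, a ^ 2 + c ^ 2 = 1 → 0 < c → c / 2 - hs * a < 0 → 1 / 2 < a := by
    intro a c hac hc hlt
    have ha : 0 < a := by
      by_contra hn
      have : hs * a ≤ 0 := mul_nonpos_of_nonneg_of_nonpos hp.le (not_lt.1 hn)
      linarith
    have h3 : c ^ 2 < 4 * (hs * a) ^ 2 := by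
      have : c < 2 * (hs * a) := by linarith
      nlinarith
    have h4 : (hs * a) ^ 2 = 3 / 4 * a ^ 2 := by rw [mul_pow, sq hs, hsq]
    nlinarith
  have n1 : (A / 2 - hs * B) ^ 2 + (B / 2 + hs * A) ^ 2 = 1 := by
    have : (A / 2 - hs * B) ^ 2 + (B / 2 + hs * A) ^ 2 = (1 / 4 + hs * hs) * (A ^ 2 + B ^ 2) := by
      ring
    rw [this, hsq, h]; norm_num
  have n2 : (-A / 2 - hs * B) ^ 2 + (-B / 2 + hs * A) ^ 2 = 1 := by
    have : (-A / 2 - hs * B) ^ 2 + (-B / 2 + hs * A) ^ 2 = (1 / 4 + hs * hs) * (A ^ 2 + B ^ 2) := by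
      ring
    rw [this, hsq, h]; norm_num
  have r1 : (B / 2 + hs * A) / 2 - hs * (A / 2 - hs * B) = B := by
    linear_combination B * hsq
  have r2 : (-B / 2 + hs * A) / 2 - hs * (-A / 2 - hs * B) = B / 2 + hs * A := by
    linear_combination B * hsq
  rcases lt_or_gt_of_ne h0 with b0 | b0 <;> rcases lt_or_gt_of_ne h1 with b1 | b1 <;>
    rcases lt_or_gt_of_ne h2 with b2 | b2
  · exact Or.inr (Or.inr (Or.inr (Or.inl ⟨by linarith, key _ (-B) (by linarith [h]) (by linarith)
      (by linarith)⟩)))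
  · exact Or.inr (Or.inr (Or.inl ⟨b2, key _ _ n2 b2 (by linarith)⟩))
  · linarith
  · exact Or.inr (Or.inl ⟨b1, key _ _ n1 b1 (by linarith)⟩)
  · exact Or.inr (Or.inr (Or.inr (Or.inr (Or.inl ⟨by linarith,
      key _ (-(B / 2 + hs * A)) (by linarith [n1]) (by linarith) (by linarith)⟩))))
  · linarith
  · exact Or.inr (Or.inr (Or.inr (Or.inr (Or.inr ⟨by linarith,
      key _ (-(-B / 2 + hs * A)) (by linarith [n2]) (by linarith) (by linarith)⟩))))
  · exact Or.inl ⟨b0, key _ _ h b0 (by linarith)⟩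

/-- One of the six directions makes an angle of less than sixty degrees with `a`, on the prescribed
side. -/
theorem exists_hexDir {a d : Plane} (ha : ‖a‖ = 1) (hd : ‖d‖ = 1) {σ : ℝ} (hσ : σ = 1 ∨ σ = -1)
    (hne : ∀ k, cr a (hexDir d k) ≠ 0) :
    ∃ k, 0 < σ * cr a (hexDir d k) ∧ 1 / 2 < dt a (hexDir d k) := by
  have hAB := dt_sq_add_cr_sq ha hd
  have h0 := hne 0
  have h1 := hne 1
  have h2 := hne 2
  simp only [hexDir, Matrix.cons_val] at h0 h1 h2
  rw [cr_add_right, cr_smul_right, cr_smul_right, cr_pp_right] at h1 h2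
  have c1 : cr a ((1 / 2 : ℝ) • d + hs • pp d) = cr a d / 2 + hs * dt a d := by
    rw [cr_add_right, cr_smul_right, cr_smul_right, cr_pp_right]; ring
  have c2 : cr a ((-1 / 2 : ℝ) • d + hs • pp d) = -cr a d / 2 + hs * dt a d := by
    rw [cr_add_right, cr_smul_right, cr_smul_right, cr_pp_right]; ring
  have d1 : dt a ((1 / 2 : ℝ) • d + hs • pp d) = dt a d / 2 - hs * cr a d := by
    rw [dt_add_right, dt_smul_right, dt_smul_right, dt_pp_right]; ring
  have d2 : dt a ((-1 / 2 : ℝ) • d + hs • pp d) = -dt a d / 2 - hs * cr a d := by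
    rw [dt_add_right, dt_smul_right, dt_smul_right, dt_pp_right]; ring
  have e0 : hexDir d 0 = d := rfl
  have e1 : hexDir d 1 = (1 / 2 : ℝ) • d + hs • pp d := rfl
  have e2 : hexDir d 2 = (-1 / 2 : ℝ) • d + hs • pp d := rfl
  have e3 : hexDir d 3 = -d := rfl
  have e4 : hexDir d 4 = -((1 / 2 : ℝ) • d + hs • pp d) := rfl
  have e5 : hexDir d 5 = -((-1 / 2 : ℝ) • d + hs • pp d) := rfl
  rcases hσ with rfl | rfl
  · rcases exists_sector hAB h0 (fun h => h1 (by linarith)) (fun h => h2 (by linarith)) with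
      h | h | h | h | h | h
    · exact ⟨0, by rw [e0, one_mul]; exact h.1, by rw [e0]; exact h.2⟩
    · exact ⟨1, by rw [e1, c1, one_mul]; exact h.1, by rw [e1, d1]; exact h.2⟩
    · exact ⟨2, by rw [e2, c2, one_mul]; exact h.1, by rw [e2, d2]; exact h.2⟩
    · exact ⟨3, by rw [e3, cr_neg_right, one_mul]; exact h.1, by rw [e3, dt_neg_right]; exact h.2⟩
    · exact ⟨4, by rw [e4, cr_neg_right, c1, one_mul]; exact h.1,
        by rw [e4, dt_neg_right, d1]; exact h.2⟩
    · exact ⟨5, by rw [e5, cr_neg_right, c2, one_mul]; exact h.1,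
        by rw [e5, dt_neg_right, d2]; exact h.2⟩
  -- Reflection in the line of `a` reduces the other side to the first; it exchanges the directions
  -- `1` and `5`, and `2` and `4`.
  · rcases exists_sector (A := dt a d) (B := -cr a d) (by linarith) (neg_ne_zero.2 h0)
      (fun h => h2 (by linarith)) (fun h => h1 (by linarith)) with h | h | h | h | h | h
    · exact ⟨0, by rw [e0]; linarith [h.1], by rw [e0]; exact h.2⟩
    · exact ⟨5, by rw [e5, cr_neg_right, c2]; linarith [h.1],
        by rw [e5, dt_neg_right, d2]; linarith [h.2]⟩
    · exact ⟨4, by rw [e4, cr_neg_right, c1]; linarith [h.1],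
        by rw [e4, dt_neg_right, d1]; linarith [h.2]⟩
    · exact ⟨3, by rw [e3, cr_neg_right]; linarith [h.1], by rw [e3, dt_neg_right]; exact h.2⟩
    · exact ⟨2, by rw [e2, c2]; linarith [h.1], by rw [e2, d2]; linarith [h.2]⟩
    · exact ⟨1, by rw [e1, c1]; linarith [h.1], by rw [e1, d1]; linarith [h.2]⟩

/-- Two directions on the same side of a third one and closer to it than sixty degrees. -/
theorem half_lt_dt_of_same_side {a a' e : Plane} (ha : ‖a‖ = 1) (ha' : ‖a'‖ = 1) (he : ‖e‖ = 1)
    {σ : ℝ} (h1 : 0 < σ * cr a e) (h2 : 1 / 2 < dt a e) (h1' : 0 < σ * cr a' e)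
    (h2' : 1 / 2 < dt a' e) : 1 / 2 < dt a a' := by
  have n := dt_sq_add_cr_sq he ha
  have n' := dt_sq_add_cr_sq he ha'
  rw [dt_eq_of_unit he]
  rw [dt_comm] at h2 h2'
  have hpos : 0 < cr e a * cr e a' := by
    have hm := mul_pos h1 h1'
    rw [cr_comm a e, cr_comm a' e] at hm
    have : σ * -cr e a * (σ * -cr e a') = σ ^ 2 * (cr e a * cr e a') := by ring
    rw [this] at hm
    exact pos_of_mul_pos_right hm (sq_nonneg σ)
  -- For the smaller sine `s`, the product `s * s'` is at least `s ^ 2 = 1 - c ^ 2`, and `c / 2 + 1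
  -- - c ^ 2 ≥ 1 / 2` for `0 < c ≤ 1`.
  have key : ∀ c s c' s' : ℝ, 0 < c → c ≤ 1 → 1 / 2 < c' → c' ≤ 1 → c ^ 2 + s ^ 2 = 1 → 0 < s * s' →
      s ^ 2 ≤ s' ^ 2 → 1 / 2 < c * c' + s * s' := by
    intro c s c' s' hc hc1 hc' hc1' hn hss hle
    have h3 : s ^ 2 ≤ s * s' := by
      rw [sq_le_sq] at hle
      calc s ^ 2 = |s| * |s| := by rw [abs_mul_abs_self, sq]
        _ ≤ |s| * |s'| := by gcongr
        _ = s * s' := by rw [← abs_mul, abs_of_pos hss]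
    nlinarith
  have b1 : dt e a ≤ 1 := by nlinarith [sq_nonneg (cr e a)]
  have b1' : dt e a' ≤ 1 := by nlinarith [sq_nonneg (cr e a')]
  rcases le_total (cr e a ^ 2) (cr e a' ^ 2) with hle | hle
  · exact key _ _ _ _ (by linarith) b1 h2' b1' n hpos hle
  · rw [mul_comm (dt e a), mul_comm (cr e a)] at *
    exact key _ _ _ _ (by linarith) b1' h2 b1 n' hpos hle

/-- Bonds at a common particle enclose at least sixty degrees; otherwise, by the law of cosines,
their far ends would be too close. -/
theorem IsHardSphere.dt_le_half {X : Finset Plane} (hX : IsHardSphere X) {x y z : Plane}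
    (hy : (bondGraph X).Adj x y) (hz : (bondGraph X).Adj x z) (hne : y ≠ z) :
    dt (y - x) (z - x) ≤ 1 / 2 := by
  have h1 := norm_eq_one_iff.1 (norm_sub_of_adj hy)
  have h2 := norm_eq_one_iff.1 (norm_sub_of_adj hz)
  have h3 : 1 ≤ dt (y - z) (y - z) := one_le_norm_iff.1 (by
    rw [← dist_eq_norm]; exact hX y hy.2.1 z hz.2.1 hne)
  have : dt (y - z) (y - z) = dt (y - x) (y - x) + dt (z - x) (z - x) - 2 * dt (y - x) (z - x) := by
    simp only [dt, PiLp.sub_apply]; ring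
  linarith

/-! ### Sides of bonds at a particle -/

open scoped Classical in
/-- The component on the left or on the right of the bond from `x` to `y`, depending on the sign
of `σ`. -/
noncomputable def sideComp (X : Finset Plane) (σ : ℝ) (x y : Plane) : Set Plane :=
  if 0 < σ then leftComp X x y else leftComp X y x

theorem sideComp_eq_iff {X : Finset Plane} (hX : IsHardSphere X) {x y : Plane}
    (h : (bondGraph X).Adj x y) {f : Set Plane} (hf : f ∈ comps (drawing X)ᶜ) {σ : ℝ} {q d : Plane}
    (hq : q ∈ openSegment ℝ x y) (hd : 0 < σ * cr (y - x) d) :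
    sideComp X σ x y = f ↔ PointsInto f q d := by
  unfold sideComp
  split_ifs with hσ
  · exact leftComp_eq_iff_pointsInto hX h hf hq (pos_of_mul_pos_right hd hσ.le)
  · rw [openSegment_symm] at hq
    refine leftComp_eq_iff_pointsInto hX h.symm hf hq ?_
    rw [← neg_sub, cr_neg_left]
    by_contra hcon
    have : 0 ≤ cr (y - x) d := by linarith
    exact absurd (mul_nonpos_of_nonpos_of_nonneg (not_lt.1 hσ) this) (not_le.2 hd)

theorem sideComp_eq_or (X : Finset Plane) (σ : ℝ) (x y : Plane) :
    sideComp X σ x y = leftComp X x y ∨ sideComp X σ x y = leftComp X y x := by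
  unfold sideComp
  split_ifs
  · exact Or.inl rfl
  · exact Or.inr rfl

/-- If there is no bond between the bond from `x` to `y` and the direction `e`, then `e` points into
the component next to the bond. -/
theorem sideComp_eq_of_pointsInto {X : Finset Plane} (hX : IsHardSphere X) {x y e : Plane}
    (h : (bondGraph X).Adj x y) (he : ‖e‖ = 1) {f : Set Plane} (hf : f ∈ comps (drawing X)ᶜ) {σ : ℝ}
    (hd : 0 < σ * cr (y - x) e)
    (hgap : ∀ z, (bondGraph X).Adj x z → ∀ α β : ℝ, 0 ≤ α → 0 < β →
      z - x ≠ α • (y - x) + β • e)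
    (hp : PointsInto f x e) : sideComp X σ x y = f := by
  obtain ⟨r, hr, hb⟩ := exists_ball_drawing hX h.1
  have hyx := norm_sub_of_adj h
  have hcr : cr (y - x) e ≠ 0 := fun h0 => by rw [h0, mul_zero] at hd; exact hd.false
  -- A small sector between the bond and `e`, without the bond itself. It is convex and free of the
  -- drawing by `hgap`; it contains the beginning of the ray along `e`, hence lies in `f`, and it
  -- reaches the side of the bond.
  set S : Set Plane := (fun t : ℝ × ℝ => x + (t.1 • (y - x) + t.2 • e)) ''
    {t | 0 ≤ t.1 ∧ 0 < t.2 ∧ t.1 + t.2 < r} with hS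
  have hSc : IsPreconnected S := by
    refine IsPreconnected.image ?_ _ (by fun_prop)
    refine Convex.isPreconnected ?_
    rintro ⟨a, c⟩ ⟨h1, h2, h3⟩ ⟨a', c'⟩ ⟨h1', h2', h3'⟩ s t hs ht hst
    simp only at h1 h2 h3 h1' h2' h3'
    simp only [Prod.smul_mk, Prod.mk_add_mk, smul_eq_mul, mem_ofPred_eq]
    refine ⟨by positivity, ?_, ?_⟩
    · rcases hs.eq_or_lt with rfl | hs
      · have : t = 1 := by linarith
        subst this; linarith
      · have : 0 < s * c := mul_pos hs h2
        have : 0 ≤ t * c' := mul_nonneg ht h2'.le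
        linarith
    · rcases hs.eq_or_lt with rfl | hs
      · have : t = 1 := by linarith
        subst this; linarith
      · have h4 : s * (a + c) < s * r := mul_lt_mul_of_pos_left h3 hs
        have h5 : t * (a' + c') ≤ t * r := mul_le_mul_of_nonneg_left h3'.le ht
        have h6 : s * r + t * r = r := by rw [← add_mul, hst, one_mul]
        linarith
  have hSd : S ⊆ (drawing X)ᶜ := by
    rintro _ ⟨⟨α, β⟩, ⟨h1, h2, h3⟩, rfl⟩ hpd
    simp only at h1 h2 h3 hpd
    have hin : x + (α • (y - x) + β • e) ∈ ball x r := by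
      rw [mem_ball, dist_eq_norm, add_sub_cancel_left]
      refine (norm_add_le _ _).trans_lt ?_
      rw [norm_smul, norm_smul, hyx, he, mul_one, mul_one, Real.norm_eq_abs, Real.norm_eq_abs,
        abs_of_nonneg h1, abs_of_pos h2]
      exact h3
    rcases hb _ hin hpd with h4 | ⟨z, hz, hpz⟩
    · have h5 := add_eq_left.1 h4
      have h6 := congrArg (cr (y - x)) h5
      rw [cr_add_right, cr_smul_right, cr_smul_right, cr_self, cr_zero_right, mul_zero, zero_add]
        at h6
      rcases mul_eq_zero.1 h6 with h7 | h7
      · exact h2.ne' h7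
      · exact hcr h7
    · rw [← lineSet_Ioo_eq_openSegment] at hpz
      obtain ⟨s, hs, hse⟩ := hpz
      have hse' : s • (z - x) = α • (y - x) + β • e := add_left_cancel hse
      refine hgap z hz (s⁻¹ * α) (s⁻¹ * β) (mul_nonneg (inv_nonneg.2 hs.1.le) h1)
        (mul_pos (inv_pos.2 hs.1) h2) ?_
      rw [mul_smul, mul_smul, ← smul_add, ← hse', smul_smul, inv_mul_cancel₀ hs.1.ne', one_smul]
  have hSf : S ⊆ f := by
    refine subset_comp_of_isPreconnected hf hSc hSd ?_
    have hlt : ∀ᶠ t : ℝ in 𝓝[>] 0, t < r ∧ 0 < t := by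
      filter_upwards [Ioo_mem_nhdsGT hr] with t ht using ⟨ht.2, ht.1⟩
    obtain ⟨t, htf, ht⟩ := (hp.and hlt).exists
    exact ⟨_, ⟨(0, t), ⟨le_rfl, ht.2, by simpa using ht.1⟩, by simp⟩, htf⟩
  set α := min (r / 2) (1 / 2) with hα
  have hα0 : 0 < α := lt_min (by positivity) (by norm_num)
  have hα1 : α < 1 := (min_le_right _ _).trans_lt (by norm_num)
  have hαr : α ≤ r / 2 := min_le_left _ _
  have hq : x + α • (y - x) ∈ openSegment ℝ x y := by
    rw [← lineSet_Ioo_eq_openSegment]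
    exact ⟨α, ⟨hα0, hα1⟩, rfl⟩
  refine (sideComp_eq_iff hX h hf hq hd).2 ?_
  filter_upwards [Ioo_mem_nhdsGT (half_pos hr)] with t ht
  exact hSf ⟨(α, t), ⟨hα0.le, ht.1, by have := ht.2; simp only; linarith⟩, by
    simp only [add_assoc]⟩

/-- A unit vector in the sector has `1 ≤ α + β` by the triangle inequality, so its cosine with the
bond is `α + β * dt (y - x) e > 1 / 2`, less than the admissible sixty degrees. -/
theorem gap_of_half_lt {X : Finset Plane} (hX : IsHardSphere X) {x y e : Plane}
    (h : (bondGraph X).Adj x y) (he : ‖e‖ = 1) (hcr : cr (y - x) e ≠ 0)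
    (hdt : 1 / 2 < dt (y - x) e) : ∀ z, (bondGraph X).Adj x z → ∀ α β : ℝ, 0 ≤ α → 0 < β →
      z - x ≠ α • (y - x) + β • e := by
  intro z hz α β hα hβ heq
  have hyx := norm_sub_of_adj h
  have hzx := norm_sub_of_adj hz
  have hsum : 1 ≤ α + β := by
    rw [← hzx, heq]
    refine (norm_add_le _ _).trans ?_
    rw [norm_smul, norm_smul, hyx, he, mul_one, mul_one, Real.norm_eq_abs, Real.norm_eq_abs,
      abs_of_nonneg hα, abs_of_pos hβ]
  have hd1 : dt (y - x) (z - x) = α + β * dt (y - x) e := by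
    rw [heq, dt_add_right, dt_smul_right, dt_smul_right, norm_eq_one_iff.1 hyx, mul_one]
  have hc1 : cr (y - x) (z - x) = β * cr (y - x) e := by
    rw [heq, cr_add_right, cr_smul_right, cr_smul_right, cr_self, mul_zero, zero_add]
  by_cases hyz : y = z
  · rw [← hyz, cr_self] at hc1
    rcases mul_eq_zero.1 hc1.symm with h7 | h7
    · exact hβ.ne' h7
    · exact hcr h7
  · have := hX.dt_le_half h hz hyz
    have : β * (1 / 2) < β * dt (y - x) e := mul_lt_mul_of_pos_left hdt hβ
    linarith

end HardSphere

namespace HardSphere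

open Set Filter Topology Metric

/-! ### Generic directions -/

theorem norm_hexDir {d : Plane} (hd : ‖d‖ = 1) (k : Fin 6) : ‖hexDir d k‖ = 1 := by
  have hsq := hs_sq
  have h1 : ‖(1 / 2 : ℝ) • d + hs • pp d‖ = 1 := norm_turn hd (by nlinarith)
  have h2 : ‖(-1 / 2 : ℝ) • d + hs • pp d‖ = 1 := norm_turn hd (by nlinarith)
  fin_cases k
  · exact hd
  · exact h1
  · exact h2
  · exact (norm_neg _).trans hd
  · exact (norm_neg _).trans h1
  · exact (norm_neg _).trans h2

theorem hexDir_linear (c : Plane) (l t : ℝ) (k : Fin 6) :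
    hexDir (l • (c + t • pp c)) k = l • (hexDir c k + t • pp (hexDir c k)) := by
  fin_cases k <;> refine plane_ext ?_ ?_ <;> simp [hexDir] <;> ring

/-- The unit vector in the direction `c + t • pp c`. -/
noncomputable def nearDir (c : Plane) (t : ℝ) : Plane := (√(1 + t ^ 2))⁻¹ • (c + t • pp c)

theorem norm_nearDir {c : Plane} (hc : ‖c‖ = 1) (t : ℝ) : ‖nearDir c t‖ = 1 := by
  have h0 : 0 < 1 + t ^ 2 := by positivity
  have h1 : (√(1 + t ^ 2))⁻¹ ^ 2 = (1 + t ^ 2)⁻¹ := by rw [inv_pow, Real.sq_sqrt h0.le]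
  rw [nearDir, smul_add, smul_smul]
  refine norm_turn hc ?_
  rw [mul_pow, h1]
  field_simp

/-- All six directions are in general position. -/
def IsHexGeneric (X : Finset Plane) (d : Plane) : Prop := ‖d‖ = 1 ∧ ∀ k, IsGenericDir X (hexDir d k)

theorem eventually_affine_ne {A B : ℝ} (h : A ≠ 0 ∨ B ≠ 0) : ∀ᶠ s : ℝ in 𝓝[>] 0, A + s * B ≠ 0 := by
  by_cases hA : A = 0
  · subst hA
    filter_upwards [self_mem_nhdsWithin] with s hs
    rw [zero_add]
    exact mul_ne_zero (ne_of_gt hs) (h.resolve_left (by simp))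
  · have hc : Continuous fun s : ℝ => A + s * B := by fun_prop
    have := hc.tendsto 0
    rw [zero_mul, add_zero] at this
    exact (this.mono_left nhdsWithin_le_nhds).eventually_ne hA

/-- Up to a positive factor, each cross product in question is affine in `s`, and its two
coefficients vanish together only for `v = w`. The finitely many conditions therefore hold for all
small `s`. Genericity close to a prescribed `c` is needed in the extremal case. -/
theorem eventually_isHexGeneric (X : Finset Plane) {c : Plane} (hc : ‖c‖ = 1) {τ : ℝ} (hτ : τ ≠ 0) :
    ∀ᶠ s : ℝ in 𝓝[>] 0, IsHexGeneric X (nearDir c (s * τ)) := by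
  have key : ∀ k : Fin 6, ∀ v ∈ X, ∀ w ∈ X, ∀ᶠ s : ℝ in 𝓝[>] 0,
      v ≠ w → cr (hexDir (nearDir c (s * τ)) k) (v - w) ≠ 0 := by
    intro k v _ w _
    by_cases hvw : v = w
    · exact Eventually.of_forall fun s h => absurd hvw h
    have he := norm_hexDir hc k
    have hAB : cr (hexDir c k) (v - w) ≠ 0 ∨ τ * cr (pp (hexDir c k)) (v - w) ≠ 0 := by
      by_contra hcon
      push Not at hcon
      have h2 := (mul_eq_zero.1 hcon.2).resolve_left hτ
      have h3 : dt (hexDir c k) (v - w) = 0 := by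
        rw [cr_comm, cr_pp_right, dt_comm] at h2
        linarith
      have := decomp he (v - w)
      rw [hcon.1, h3, zero_smul, zero_smul, add_zero] at this
      exact hvw (sub_eq_zero.1 this)
    filter_upwards [eventually_affine_ne hAB] with s hs _
    rw [nearDir, hexDir_linear, cr_smul_left, cr_add_left, cr_smul_left, mul_assoc]
    refine mul_ne_zero (inv_ne_zero (Real.sqrt_ne_zero'.2 (by positivity))) hs
  have hall : ∀ᶠ s : ℝ in 𝓝[>] 0, ∀ k : Fin 6, ∀ v ∈ X, ∀ w ∈ X,
      v ≠ w → cr (hexDir (nearDir c (s * τ)) k) (v - w) ≠ 0 :=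
    eventually_all.2 fun k => (eventually_all_finset X).2 fun v hv =>
      (eventually_all_finset X).2 fun w hw => key k v hv w hw
  filter_upwards [hall] with s hs
  exact ⟨norm_nearDir hc _, fun k => ⟨norm_hexDir (norm_nearDir hc _) k, hs k⟩⟩

theorem exists_isHexGeneric (X : Finset Plane) : ∃ d, IsHexGeneric X d := by
  obtain ⟨c, hc⟩ := exists_unit
  obtain ⟨s, hs⟩ := (eventually_isHexGeneric X hc one_ne_zero).exists
  exact ⟨_, hs⟩

/-! ### Counting darts at the boundary by corners of six directions. -/

theorem boundary_subset (X : Finset Plane) : boundary X ⊆ X := by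
  classical
  exact Finset.filter_subset _ _

open scoped Classical in
/-- The bonds at boundary particles, directed outwards, whose `σ`-side does not belong to `Ω`. -/
noncomputable def innerDarts (X : Finset Plane) (σ : ℝ) (Ω : Set Plane) : Finset (Plane × Plane) :=
  (darts X).filter fun a => a.1 ∈ boundary X ∧ sideComp X σ a.1 a.2 ≠ Ω

theorem mem_innerDarts {X : Finset Plane} {σ : ℝ} {Ω : Set Plane} {a : Plane × Plane} :
    a ∈ innerDarts X σ Ω ↔
      (bondGraph X).Adj a.1 a.2 ∧ a.1 ∈ boundary X ∧ sideComp X σ a.1 a.2 ≠ Ω := by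
  classical
  rw [innerDarts, Finset.mem_filter, mem_darts]

open scoped Classical in
/-- The corners of the six directions at boundary particles which do not point into `Ω`. -/
noncomputable def innerCorners (X : Finset Plane) (Ω : Set Plane) (d : Plane) :
    Finset (Σ _ : Fin 6, Plane) :=
  Finset.univ.sigma fun k => (boundary X).filter fun v => ¬ PointsInto Ω v (hexDir d k)

theorem mem_innerCorners {X : Finset Plane} {Ω : Set Plane} {d : Plane} {k : Fin 6} {v : Plane} :
    (⟨k, v⟩ : Σ _ : Fin 6, Plane) ∈ innerCorners X Ω d ↔
      v ∈ boundary X ∧ ¬ PointsInto Ω v (hexDir d k) := by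
  classical
  rw [innerCorners, Finset.mem_sigma, Finset.mem_filter]
  simp

namespace BoundaryCycle

variable {X : Finset Plane} {v : ℕ → Plane} {b : ℕ} {Ω : Set Plane}

/-- The six directions form three opposite pairs. For each pair at least `b + 2` of the `2 * b`
corners point into `Ω`, which leaves at most `b - 2`. -/
theorem card_innerCorners (h : BoundaryCycle X v b) (hX : IsHardSphere X)
    (hΩ : Ω ∈ comps (drawing X)ᶜ) (hΩb : ¬ Bornology.IsBounded Ω) {d : Plane}
    (hd : IsHexGeneric X d) : (innerCorners X Ω d).card + 6 ≤ 3 * b := by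
  classical
  have F := h.outerFrame hX hΩ hΩb
  have hgen : ∀ k, IsGenericDir (boundary X) (hexDir d k) := fun k =>
    ⟨(hd.2 k).1, fun x hx y hy => (hd.2 k).2 x (boundary_subset X hx) y (boundary_subset X hy)⟩
  have hsplit : ∀ e : Plane, ((boundary X).filter fun v => PointsInto Ω v e).card +
      ((boundary X).filter fun v => ¬ PointsInto Ω v e).card = b := by
    intro e
    rw [Finset.card_filter_add_card_filter_not, h.card_boundary]
  have hpair : ∀ k, ((boundary X).filter fun v => ¬ PointsInto Ω v (hexDir d k)).card +
      ((boundary X).filter fun v => ¬ PointsInto Ω v (-hexDir d k)).card + 2 ≤ b := by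
    intro k
    have h1 := F.card_add_two_le (hgen k)
    rw [Fintype.card_fin] at h1
    have h2 := hsplit (hexDir d k)
    have h3 := hsplit (-hexDir d k)
    omega
  rw [innerCorners, Finset.card_sigma, Fin.sum_univ_six]
  have h0 := hpair 0
  have h1 := hpair 1
  have h2 := hpair 2
  have e3 : hexDir d 3 = -hexDir d 0 := rfl
  have e4 : hexDir d 4 = -hexDir d 1 := rfl
  have e5 : hexDir d 5 = -hexDir d 2 := rfl
  rw [e3, e4, e5]
  omega

/-- A bond is sent to the one of the six directions within sixty degrees on its `σ`-side. No bond
lies in between, so a direction into `Ω` would put `Ω` on that side of the bond. Two bonds sent to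
the same corner would enclose less than sixty degrees. -/
theorem exists_sector_map (hX : IsHardSphere X)
    (hΩ : Ω ∈ comps (drawing X)ᶜ) {d : Plane}
    (hd : IsHexGeneric X d) {σ : ℝ} (hσ : σ = 1 ∨ σ = -1) :
    ∃ φ : Plane × Plane → (Σ _ : Fin 6, Plane),
      (∀ a ∈ innerDarts X σ Ω, φ a ∈ innerCorners X Ω d ∧ (φ a).2 = a.1 ∧
        0 < σ * cr (a.2 - a.1) (hexDir d (φ a).1) ∧ 1 / 2 < dt (a.2 - a.1) (hexDir d (φ a).1)) ∧
      InjOn φ (innerDarts X σ Ω) := by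
  have hex : ∀ a ∈ innerDarts X σ Ω, ∃ k,
      0 < σ * cr (a.2 - a.1) (hexDir d k) ∧ 1 / 2 < dt (a.2 - a.1) (hexDir d k) := by
    intro a ha
    obtain ⟨hadj, -, -⟩ := mem_innerDarts.1 ha
    refine exists_hexDir (norm_sub_of_adj hadj) hd.1 hσ fun k hk => ?_
    refine (hd.2 k).2 _ hadj.2.1 _ hadj.1 hadj.ne' ?_
    rw [cr_comm, hk, neg_zero]
  choose! κ hκ using hex
  refine ⟨fun a => ⟨κ a, a.1⟩, fun a ha => ?_, ?_⟩
  · obtain ⟨hadj, hab, hside⟩ := mem_innerDarts.1 ha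
    obtain ⟨h1, h2⟩ := hκ a ha
    refine ⟨mem_innerCorners.2 ⟨hab, fun hp => hside ?_⟩, rfl, h1, h2⟩
    refine sideComp_eq_of_pointsInto hX hadj (hd.2 _).1 hΩ h1
      (gap_of_half_lt hX hadj (hd.2 _).1 ?_ h2) hp
    intro h0
    rw [h0, mul_zero] at h1
    exact h1.false
  · rintro ⟨x, y⟩ ha ⟨x', y'⟩ ha' he
    have he1 : κ (x, y) = κ (x', y') := congrArg Sigma.fst he
    have he2 : x = x' := by simpa using congrArg Sigma.snd he
    subst he2
    have hadj := (mem_innerDarts.1 ha).1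
    have hadj' := (mem_innerDarts.1 ha').1
    obtain ⟨h1, h2⟩ := hκ _ ha
    obtain ⟨h1', h2'⟩ := hκ _ ha'
    rw [← he1] at h1' h2'
    by_contra hne
    have hyy : y ≠ y' := fun hh => hne (by rw [hh])
    have h3 := half_lt_dt_of_same_side (norm_sub_of_adj hadj) (norm_sub_of_adj hadj') (hd.2 _).1
      h1 h2 h1' h2'
    have h4 := hX.dt_le_half hadj hadj' hyy
    simp only at h3
    linarith

theorem card_innerDarts (h : BoundaryCycle X v b) (hX : IsHardSphere X)
    (hΩ : Ω ∈ comps (drawing X)ᶜ) (hΩb : ¬ Bornology.IsBounded Ω) {σ : ℝ} (hσ : σ = 1 ∨ σ = -1) :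
    (innerDarts X σ Ω).card + 6 ≤ 3 * b := by
  obtain ⟨d, hd⟩ := exists_isHexGeneric X
  obtain ⟨φ, h1, h2⟩ := exists_sector_map hX hΩ hd hσ
  have := Finset.card_le_card_of_injOn φ (fun a ha => (h1 a ha).1) h2
  have := h.card_innerCorners hX hΩ hΩb hd
  omega

/-- In the extremal case every corner not pointing into `Ω` comes from a bond. -/
theorem exists_bond_of_card_eq (h : BoundaryCycle X v b) (hX : IsHardSphere X)
    (hΩ : Ω ∈ comps (drawing X)ᶜ) (hΩb : ¬ Bornology.IsBounded Ω) {σ : ℝ} (hσ : σ = 1 ∨ σ = -1)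
    (heq : 3 * b ≤ (innerDarts X σ Ω).card + 6) {d : Plane} (hd : IsHexGeneric X d) {x : Plane}
    (hx : x ∈ boundary X) {k : Fin 6} (hk : ¬ PointsInto Ω x (hexDir d k)) :
    ∃ y, (bondGraph X).Adj x y ∧ 0 < σ * cr (y - x) (hexDir d k) ∧
      1 / 2 < dt (y - x) (hexDir d k) := by
  classical
  obtain ⟨φ, h1, h2⟩ := exists_sector_map hX hΩ hd hσ
  have hle := h.card_innerCorners hX hΩ hΩb hd
  have himg : (innerDarts X σ Ω).image φ = innerCorners X Ω d := by
    refine Finset.eq_of_subset_of_card_le ?_ ?_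
    · intro c hc
      obtain ⟨a, ha, rfl⟩ := Finset.mem_image.1 hc
      exact (h1 a ha).1
    · rw [Finset.card_image_of_injOn h2]
      omega
  have hm := mem_innerCorners.2 ⟨hx, hk⟩
  rw [← himg] at hm
  obtain ⟨a, ha, hφ⟩ := Finset.mem_image.1 hm
  obtain ⟨-, h3, h4, h5⟩ := h1 a ha
  rw [hφ] at h3 h4 h5
  have h3 : x = a.1 := h3
  subst h3
  exact ⟨a.2, (mem_innerDarts.1 ha).1, h4, h5⟩

/-- Such a dart runs along an edge of the cycle, and two opposite ones would have `Ω` on both sides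
of their edge, contrary to `edge_sides_ne`. -/
theorem card_outer_darts_le (h : BoundaryCycle X v b) (hX : IsHardSphere X)
    (hne : (removeBoundary X).Nonempty)
    (hΩ : Ω ∈ comps (drawing X)ᶜ) (hΩb : ¬ Bornology.IsBounded Ω) (σ : ℝ)
    [DecidablePred fun a : Plane × Plane => sideComp X σ a.1 a.2 = Ω] :
    ((darts X).filter fun a => sideComp X σ a.1 a.2 = Ω).card ≤ b := by
  classical
  have hnf : ¬ IsFace X Ω := fun hF => hΩb hF.2.1
  obtain ⟨z, hz⟩ := hne
  obtain ⟨hzX, hzb⟩ := mem_removeBoundary.1 hz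
  have hzv : ∀ i, z ≠ v i := fun i hi => hzb (hi ▸ h.mem_boundary i)
  set C : Finset (Sym2 Plane) := (Finset.range b).image fun i => s(v i, v (i + 1))
  have hC : C.card ≤ b := Finset.card_image_le.trans (by rw [Finset.card_range])
  have hbd : ∀ x y, (bondGraph X).Adj x y → sideComp X σ x y = Ω → ∃ i < b, s(v i, v (i + 1)) = s(x, y) := by
    intro x y ha hs
    refine (h.isBoundaryEdge _).1 ((isBoundaryEdge_iff hX ha).2 ?_)
    rcases sideComp_eq_or X σ x y with h1 | h1 <;> rw [h1] at hs <;> rw [hs]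
    · exact Or.inl hnf
    · exact Or.inr hnf
  refine le_trans (Finset.card_le_card_of_injOn (fun a => s(a.1, a.2)) (t := C) ?_ ?_) hC
  · intro a ha
    obtain ⟨ha1, ha2⟩ := Finset.mem_filter.1 (Finset.mem_coe.1 ha)
    obtain ⟨i, hi, he⟩ := hbd _ _ (mem_darts.1 ha1) ha2
    exact Finset.mem_coe.2 (Finset.mem_image.2 ⟨i, Finset.mem_range.2 hi, he⟩)
  · rintro ⟨x, y⟩ ha ⟨x', y'⟩ ha' he
    obtain ⟨ha1, ha2⟩ := Finset.mem_filter.1 (Finset.mem_coe.1 ha)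
    obtain ⟨-, ha2'⟩ := Finset.mem_filter.1 (Finset.mem_coe.1 ha')
    rcases Sym2.eq_iff.1 he with ⟨h1, h2⟩ | ⟨h1, h2⟩
    · exact Prod.ext h1 h2
    · exfalso
      simp only at h1 h2 ha2 ha2'
      subst h1 h2
      have hboth : leftComp X x y = Ω ∧ leftComp X y x = Ω := by
        unfold sideComp at ha2 ha2'
        split_ifs at ha2 ha2'
        · exact ⟨ha2, ha2'⟩
        · exact ⟨ha2', ha2⟩
      obtain ⟨i, hi, hie⟩ := hbd _ _ (mem_darts.1 ha1) ha2
      have := h.edge_sides_ne hX hΩ hΩb hzX hzv i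
      rcases Sym2.eq_iff.1 hie with ⟨h3, h4⟩ | ⟨h3, h4⟩
      · rw [h3, h4] at this
        exact this.elim (fun h5 => h5 hboth.1) (fun h5 => h5 hboth.2)
      · rw [h3, h4] at this
        exact this.elim (fun h5 => h5 hboth.2) (fun h5 => h5 hboth.1)

/-- Every removed bond provides a dart that starts at a boundary particle. It provides two if both
ends are boundary particles, as for the `b` edges of the cycle. -/
theorem card_boundary_darts (h : BoundaryCycle X v b)
    [DecidablePred fun a : Plane × Plane => a.1 ∈ boundary X] :
    (bonds X).card + b ≤
      ((darts X).filter fun a => a.1 ∈ boundary X).card + (bonds (removeBoundary X)).card := by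
  classical
  have h1 := card_darts_filter (X := X) (fun a => a.1 ∈ boundary X)
    (fun e => (if e ∉ bonds (removeBoundary X) then 1 else 0) +
      (if ∀ z ∈ e, z ∈ boundary X then 1 else 0)) (by
      intro x y ha
      have hb : s(x, y) ∈ bonds (removeBoundary X) ↔ x ∉ boundary X ∧ y ∉ boundary X := by
        rw [mem_bonds, SimpleGraph.mem_edgeSet, bondGraph_removeBoundary_adj]
        exact and_iff_right ha
      have hc : (∀ z ∈ s(x, y), z ∈ boundary X) ↔ x ∈ boundary X ∧ y ∈ boundary X := by
        simp
      simp only [hb, hc]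
      by_cases hx : x ∈ boundary X <;> by_cases hy : y ∈ boundary X <;> simp [hx, hy])
  rw [h1, Finset.sum_add_distrib, ← Finset.card_filter, ← Finset.card_filter]
  have h2 : ((bonds X).filter fun e => e ∉ bonds (removeBoundary X)).card +
      (bonds (removeBoundary X)).card = (bonds X).card := by
    rw [← Finset.sdiff_eq_filter]
    exact Finset.card_sdiff_add_card_eq_card bonds_removeBoundary_subset
  have h3 : b ≤ ((bonds X).filter fun e => ∀ z ∈ e, z ∈ boundary X).card := by
    have hC : ((Finset.range b).image fun i => s(v i, v (i + 1))).card = b := by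
      rw [Finset.card_image_of_injOn, Finset.card_range]
      intro i hi j hj hij
      have h3 := h.three_le
      rcases Sym2.eq_iff.1 hij with ⟨h4, -⟩ | ⟨h4, h5⟩
      · exact h.inj i (by simpa using hi) j (by simpa using hj) h4
      · exfalso
        have h6 := (h.modEq h4).add_right 1
        have h7 := (h.modEq h5).symm.trans h6
        have h8 : 0 ≡ 2 [MOD b] := by
          refine Nat.ModEq.add_left_cancel' j ?_
          exact h7
        have := h8.eq_of_lt_of_lt (by omega) (by omega)
        omega
    rw [← hC]
    refine Finset.card_le_card fun e he => ?_
    obtain ⟨i, -, rfl⟩ := Finset.mem_image.1 he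
    rw [Finset.mem_filter]
    refine ⟨mem_bonds.2 (h.adj i), fun z hz => ?_⟩
    rcases Sym2.mem_iff.1 hz with rfl | rfl
    · exact h.mem_boundary _
    · exact h.mem_boundary _
  omega

/-- At most `b` of the darts starting on the boundary have `Ω` on their `σ`-side, which uses up the
surplus from the edges of the cycle. -/
theorem card_bonds_le (h : BoundaryCycle X v b) (hX : IsHardSphere X)
    (hne : (removeBoundary X).Nonempty)
    (hΩ : Ω ∈ comps (drawing X)ᶜ) (hΩb : ¬ Bornology.IsBounded Ω) (σ : ℝ) :
    (bonds X).card ≤ (innerDarts X σ Ω).card + (bonds (removeBoundary X)).card := by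
  classical
  have h1 := h.card_boundary_darts
  have h2 := h.card_outer_darts_le hX hne hΩ hΩb σ
  have h3 : ((darts X).filter fun a => a.1 ∈ boundary X).card ≤
      (innerDarts X σ Ω).card + ((darts X).filter fun a => sideComp X σ a.1 a.2 = Ω).card := by
    refine le_trans (Finset.card_le_card fun a ha => ?_) (Finset.card_union_le _ _)
    obtain ⟨ha1, ha2⟩ := Finset.mem_filter.1 ha
    rw [Finset.mem_union, mem_innerDarts, Finset.mem_filter]
    by_cases hs : sideComp X σ a.1 a.2 = Ω
    · exact Or.inr ⟨ha1, hs⟩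
    · exact Or.inl ⟨mem_darts.1 ha1, ha2, hs⟩
  omega

end BoundaryCycle

end HardSphere

namespace HardSphere

open Set Filter Topology Metric

/-! ### Equilateral triangles -/

/-- The open triangle with the vertices `x`, `y`, `w`, in barycentric coordinates. -/
def triangle (x y w : Plane) : Set Plane :=
  {p | 0 < cr (p - x) (w - x) / cr (y - x) (w - x) ∧ 0 < cr (y - x) (p - x) / cr (y - x) (w - x) ∧
    cr (p - x) (w - x) / cr (y - x) (w - x) + cr (y - x) (p - x) / cr (y - x) (w - x) < 1}

theorem triangle_decomp {x y w : Plane} (hK : cr (y - x) (w - x) ≠ 0) (p : Plane) :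
    p = x + ((cr (p - x) (w - x) / cr (y - x) (w - x)) • (y - x) +
      (cr (y - x) (p - x) / cr (y - x) (w - x)) • (w - x)) := by
  refine plane_ext ?_ ?_ <;>
  · simp only [PiLp.add_apply, PiLp.smul_apply, PiLp.sub_apply, smul_eq_mul]
    rw [div_mul_eq_mul_div, div_mul_eq_mul_div, ← add_div, ← sub_eq_iff_eq_add', eq_div_iff hK]
    simp only [cr, PiLp.sub_apply]
    ring

theorem convex_triangle (x y w : Plane) : Convex ℝ (triangle x y w) := by
  have hpos : ∀ A B s t : ℝ, 0 < A → 0 < B → 0 ≤ s → 0 ≤ t → s + t = 1 → 0 < s * A + t * B := by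
    intro A B s t hA hB hs ht hst
    rcases hs.eq_or_lt with rfl | hs
    · have : t = 1 := by linarith
      subst this; linarith
    · have := mul_pos hs hA
      have := mul_nonneg ht hB.le
      linarith
  rintro p ⟨h1, h2, h3⟩ q ⟨h1', h2', h3'⟩ s t hs ht hst
  have e1 : cr (s • p + t • q - x) (w - x) / cr (y - x) (w - x) =
      s * (cr (p - x) (w - x) / cr (y - x) (w - x)) +
      t * (cr (q - x) (w - x) / cr (y - x) (w - x)) := by
    rw [← mul_div_assoc, ← mul_div_assoc, ← add_div]
    congr 1
    simp only [cr, PiLp.sub_apply, PiLp.add_apply, PiLp.smul_apply, smul_eq_mul]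
    linear_combination (x 0 * (w 1 - x 1) - x 1 * (w 0 - x 0)) * hst
  have e2 : cr (y - x) (s • p + t • q - x) / cr (y - x) (w - x) =
      s * (cr (y - x) (p - x) / cr (y - x) (w - x)) +
      t * (cr (y - x) (q - x) / cr (y - x) (w - x)) := by
    rw [← mul_div_assoc, ← mul_div_assoc, ← add_div]
    congr 1
    simp only [cr, PiLp.sub_apply, PiLp.add_apply, PiLp.smul_apply, smul_eq_mul]
    linear_combination ((y 0 - x 0) * x 1 - (y 1 - x 1) * x 0) * hst
  refine ⟨?_, ?_, ?_⟩
  · rw [e1]; exact hpos _ _ _ _ h1 h1' hs ht hst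
  · rw [e2]; exact hpos _ _ _ _ h2 h2' hs ht hst
  · rw [e1, e2]
    have := hpos _ _ s t (sub_pos.2 h3) (sub_pos.2 h3') hs ht hst
    linarith

theorem frontier_triangle_subset {x y w : Plane} (hK : cr (y - x) (w - x) ≠ 0) :
    frontier (triangle x y w) ⊆ segment ℝ x y ∪ segment ℝ x w ∪ segment ℝ y w := by
  have hc1 : Continuous fun p : Plane => cr (p - x) (w - x) / cr (y - x) (w - x) := by
    unfold cr; fun_prop
  have hc2 : Continuous fun p : Plane => cr (y - x) (p - x) / cr (y - x) (w - x) := by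
    unfold cr; fun_prop
  have hopen : IsOpen (triangle x y w) :=
    (isOpen_lt continuous_const hc1).inter
      ((isOpen_lt continuous_const hc2).inter (isOpen_lt (hc1.add hc2) continuous_const))
  have hcl : closure (triangle x y w) ⊆ {p | 0 ≤ cr (p - x) (w - x) / cr (y - x) (w - x) ∧
      0 ≤ cr (y - x) (p - x) / cr (y - x) (w - x) ∧
      cr (p - x) (w - x) / cr (y - x) (w - x) + cr (y - x) (p - x) / cr (y - x) (w - x) ≤ 1} :=
    closure_minimal (fun p hp => ⟨hp.1.le, hp.2.1.le, hp.2.2.le⟩)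
      ((isClosed_le continuous_const hc1).inter
        ((isClosed_le continuous_const hc2).inter (isClosed_le (hc1.add hc2) continuous_const)))
  intro p hp
  rw [hopen.frontier_eq] at hp
  obtain ⟨h1, h2, h3⟩ := hcl hp.1
  have hdec := triangle_decomp hK p
  set α := cr (p - x) (w - x) / cr (y - x) (w - x) with hα
  set β := cr (y - x) (p - x) / cr (y - x) (w - x) with hβ
  rcases h1.eq_or_lt with h1 | h1
  · left; right
    rw [← h1, zero_smul, zero_add] at hdec
    rw [← lineSet_Icc_eq_segment]
    exact ⟨β, ⟨h2, by linarith⟩, hdec.symm⟩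
  rcases h2.eq_or_lt with h2 | h2
  · left; left
    rw [← h2, zero_smul, add_zero] at hdec
    rw [← lineSet_Icc_eq_segment]
    exact ⟨α, ⟨h1.le, by linarith⟩, hdec.symm⟩
  rcases h3.eq_or_lt with h3 | h3
  · right
    rw [← lineSet_Icc_eq_segment]
    refine ⟨β, ⟨h2.le, by linarith⟩, ?_⟩
    have : α = 1 - β := by linarith
    rw [hdec, this]
    module
  · exact absurd ⟨h1, h2, h3⟩ hp.2

theorem disjoint_triangle_segments {x y w : Plane} (hK : cr (y - x) (w - x) ≠ 0) :
    Disjoint (triangle x y w) (segment ℝ x y ∪ segment ℝ x w ∪ segment ℝ y w) := by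
  rw [Set.disjoint_left]
  rintro p ⟨h1, h2, h3⟩ ((hp | hp) | hp) <;> rw [← lineSet_Icc_eq_segment] at hp <;>
    obtain ⟨t, -, rfl⟩ := hp
  · simp only [add_sub_cancel_left, cr_smul_right, cr_self, mul_zero, zero_div, lt_irrefl] at h2
  · simp only [add_sub_cancel_left, cr_smul_left, cr_self, mul_zero, zero_div, lt_irrefl] at h1
  · have e : cr (y + t • (w - y) - x) (w - x) + cr (y - x) (y + t • (w - y) - x) =
        cr (y - x) (w - x) := by
      simp only [cr, PiLp.sub_apply, PiLp.add_apply, PiLp.smul_apply, smul_eq_mul]; ring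
    simp only at h3
    rw [← add_div, e, div_self hK] at h3
    exact h3.false

section Triangle

variable {X : Finset Plane} {x y w : Plane}

/-- With barycentric coordinates `α`, `β` the squared distance from `x` is at most `α ^ 2 + β ^ 2 +
α * β < (α + β) ^ 2 < 1`. -/
theorem IsHardSphere.notMem_triangle (hX : IsHardSphere X) (hxy : (bondGraph X).Adj x y)
    (hxw : (bondGraph X).Adj x w) (hyw : (bondGraph X).Adj y w) (hK : cr (y - x) (w - x) ≠ 0)
    {p : Plane} (hp : p ∈ X) : p ∉ triangle x y w := by
  intro hpT
  have hdec := triangle_decomp hK p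
  obtain ⟨h1, h2, h3⟩ := hpT
  set α := cr (p - x) (w - x) / cr (y - x) (w - x) with hα
  set β := cr (y - x) (p - x) / cr (y - x) (w - x) with hβ
  have hne : p ≠ x := by
    rintro rfl
    rw [hβ, sub_self, cr_zero_right, zero_div] at h2
    exact h2.false
  have n1 := norm_eq_one_iff.1 (norm_sub_of_adj hxy)
  have n2 := norm_eq_one_iff.1 (norm_sub_of_adj hxw)
  have n4 := hX.dt_le_half hxy hxw hyw.ne
  have n3 : 1 ≤ dt (p - x) (p - x) := one_le_norm_iff.1 (by
    rw [← dist_eq_norm]; exact hX p hp x hxy.1 hne)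
  have e : dt (p - x) (p - x) = α ^ 2 * dt (y - x) (y - x) + β ^ 2 * dt (w - x) (w - x) +
      2 * (α * β) * dt (y - x) (w - x) := by
    conv_lhs => rw [hdec, add_sub_cancel_left]
    simp only [dt, PiLp.sub_apply, PiLp.add_apply, PiLp.smul_apply, smul_eq_mul]; ring
  rw [n1, n2] at e
  have hαβ := mul_pos h1 h2
  nlinarith

/-- A bond meeting the open triangle crosses none of the sides, so it lies inside. Its ends are then
particles on the frontier, that is, vertices of the triangle, and the bond is one of the sides after
all. -/
theorem triangle_mem_comps (hX : IsHardSphere X) (hxy : (bondGraph X).Adj x y)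
    (hxw : (bondGraph X).Adj x w) (hyw : (bondGraph X).Adj y w) (hK : cr (y - x) (w - x) ≠ 0) :
    triangle x y w ∈ comps (drawing X)ᶜ := by
  have hseg : segment ℝ x y ∪ segment ℝ x w ∪ segment ℝ y w ⊆ drawing X :=
    union_subset (union_subset (segment_subset_drawing hxy) (segment_subset_drawing hxw))
      (segment_subset_drawing hyw)
  have hfr := frontier_triangle_subset hK
  have hdis := disjoint_triangle_segments hK
  have hend : ∀ {p q}, (bondGraph X).Adj p q → ∀ z ∈ X, z ∈ segment ℝ p q → z = p ∨ z = q := by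
    intro p q hpq z hz hzs
    rw [segment_eq_openSegment_union] at hzs
    rcases hzs with (h | h) | h
    · exact Or.inl h
    · exact Or.inr h
    · exact absurd h (hX.notMem_openSegment hpq hz)
  have hvert : ∀ z ∈ X, z ∈ frontier (triangle x y w) → z = x ∨ z = y ∨ z = w := by
    intro z hz hzf
    rcases hfr hzf with (h | h) | h
    · rcases hend hxy z hz h with h | h <;> simp [h]
    · rcases hend hxw z hz h with h | h <;> simp [h]
    · rcases hend hyw z hz h with h | h <;> simp [h]
  refine mem_comps_of_disjoint_frontier (convex_triangle x y w).isPreconnected ?_ ?_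
    (disjoint_compl_right.mono_left (hfr.trans hseg))
  · refine ⟨x + ((1 / 3 : ℝ) • (y - x) + (1 / 3 : ℝ) • (w - x)), ?_⟩
    simp only [triangle, mem_ofPred_eq, add_sub_cancel_left, cr_add_left, cr_add_right,
      cr_smul_left, cr_smul_right, cr_self, mul_zero, add_zero, zero_add,
      mul_div_assoc, div_self hK]
    norm_num
  · intro p hp hpd
    rcases hpd with hpX | hpe
    · exact hX.notMem_triangle hxy hxw hyw hK hpX hp
    · obtain ⟨e, he, hpe⟩ := mem_iUnion₂.1 hpe
      induction e with
      | h z z' =>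
        have hadj : (bondGraph X).Adj z z' := he
        rw [edgeSegment_mk, segment_eq_openSegment_union] at hpe
        rcases hpe with (rfl | rfl) | hpe
        · exact hX.notMem_triangle hxy hxw hyw hK hadj.1 hp
        · exact hX.notMem_triangle hxy hxw hyw hK hadj.2.1 hp
        have hseg' : ∀ {a c}, s(z, z') = s(a, c) → p ∈ segment ℝ a c := by
          intro a c hac
          have : edgeSegment s(z, z') = edgeSegment s(a, c) := by rw [hac]
          rw [edgeSegment_mk, edgeSegment_mk] at this
          exact this ▸ openSegment_subset_segment ℝ _ _ hpe
        have n1 : s(z, z') ≠ s(x, y) := fun h => Set.disjoint_left.1 hdis hp (Or.inl (Or.inl (hseg' h)))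
        have n2 : s(z, z') ≠ s(x, w) := fun h => Set.disjoint_left.1 hdis hp (Or.inl (Or.inr (hseg' h)))
        have n3 : s(z, z') ≠ s(y, w) := fun h => Set.disjoint_left.1 hdis hp (Or.inr (hseg' h))
        have hdf : Disjoint (openSegment ℝ z z') (frontier (triangle x y w)) := by
          refine Disjoint.mono_right hfr (disjoint_union_right.2 ⟨disjoint_union_right.2 ⟨?_, ?_⟩, ?_⟩)
          · exact hX.disjoint_openSegment_segment hadj hxy n1
          · exact hX.disjoint_openSegment_segment hadj hxw n2
          · exact hX.disjoint_openSegment_segment hadj hyw n3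
        have hsub : openSegment ℝ z z' ⊆ triangle x y w :=
          subset_of_disjoint_frontier (convex_openSegment z z').isPreconnected ⟨p, hpe, hp⟩ hdf
        have hcl : segment ℝ z z' ⊆ closure (triangle x y w) :=
          segment_subset_closure_openSegment.trans (closure_mono hsub)
        have hin : ∀ q ∈ X, q ∈ segment ℝ z z' → q = x ∨ q = y ∨ q = w := by
          intro q hq hqs
          refine hvert q hq ⟨hcl hqs, fun hqi => ?_⟩
          exact hX.notMem_triangle hxy hxw hyw hK hq (interior_subset hqi)
        have hz := hin z hadj.1 (left_mem_segment ℝ _ _)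
        have hz' := hin z' hadj.2.1 (right_mem_segment ℝ _ _)
        have hne := hadj.ne
        rcases hz with rfl | rfl | rfl <;> rcases hz' with rfl | rfl | rfl
        · exact hne rfl
        · exact n1 rfl
        · exact n2 rfl
        · exact n1 Sym2.eq_swap
        · exact hne rfl
        · exact n3 rfl
        · exact n2 Sym2.eq_swap
        · exact n3 Sym2.eq_swap
        · exact hne rfl

theorem sideComp_eq_triangle (hX : IsHardSphere X) (hxy : (bondGraph X).Adj x y)
    (hxw : (bondGraph X).Adj x w) (hyw : (bondGraph X).Adj y w) {σ : ℝ}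
    (hK : 0 < σ * cr (y - x) (w - x)) : sideComp X σ x y = triangle x y w := by
  have hK0 : cr (y - x) (w - x) ≠ 0 := fun h0 => by rw [h0, mul_zero] at hK; exact hK.false
  have hq : x + (1 / 2 : ℝ) • (y - x) ∈ openSegment ℝ x y := by
    rw [← lineSet_Ioo_eq_openSegment]
    exact ⟨1 / 2, ⟨by norm_num, by norm_num⟩, rfl⟩
  refine (sideComp_eq_iff hX hxy (triangle_mem_comps hX hxy hxw hyw hK0) hq hK).2 ?_
  filter_upwards [Ioo_mem_nhdsGT (show (0 : ℝ) < 1 / 2 by norm_num)] with t ht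
  simp only [triangle, mem_ofPred_eq, add_assoc, add_sub_cancel_left, cr_add_left, cr_add_right,
      cr_smul_left, cr_smul_right, cr_self, mul_zero, add_zero, zero_add,
      mul_div_assoc, div_self hK0, mul_one]
  exact ⟨by norm_num, ht.1, by linarith [ht.2]⟩

/-- Each dart counted runs along one of the three sides. If both orientations of a side counted,
convexity would put a point of the side into the open triangle. -/
theorem faceLength_triangle_le (hX : IsHardSphere X) (hxy : (bondGraph X).Adj x y)
    (hxw : (bondGraph X).Adj x w) (hyw : (bondGraph X).Adj y w) (hK : cr (y - x) (w - x) ≠ 0)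
    (hf : IsFace X (triangle x y w)) : faceLength X (triangle x y w) ≤ 3 := by
  classical
  have hT := triangle_mem_comps hX hxy hxw hyw hK
  rw [faceLength_eq hX hf]
  refine le_trans (Finset.card_le_card_of_injOn (fun a => s(a.1, a.2))
    (t := {s(x, y), s(x, w), s(y, w)}) ?_ ?_) Finset.card_le_three
  · intro a ha
    obtain ⟨ha1, ha2⟩ := Finset.mem_filter.1 (Finset.mem_coe.1 ha)
    have hadj := mem_darts.1 ha1
    have hsub := ((segment_subset_frontier_iff hX hadj hT).2 (Or.inl ha2)).trans
      (frontier_triangle_subset hK)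
    obtain ⟨q, hq⟩ := openEdgeSegment_nonempty s(a.1, a.2)
    have hq : q ∈ openSegment ℝ a.1 a.2 := hq
    have key : ∀ {z z'}, (bondGraph X).Adj z z' → q ∈ segment ℝ z z' → s(a.1, a.2) = s(z, z') := by
      intro z z' hz hqz
      by_contra hne
      exact Set.disjoint_left.1 (hX.disjoint_openSegment_segment hadj hz hne) hq hqz
    simp only [Finset.coe_insert, Finset.coe_singleton, mem_insert_iff, mem_singleton_iff]
    rcases hsub (openSegment_subset_segment ℝ _ _ hq) with (h1 | h1) | h1
    · exact Or.inl (key hxy h1)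
    · exact Or.inr (Or.inl (key hxw h1))
    · exact Or.inr (Or.inr (key hyw h1))
  · rintro ⟨z, z'⟩ ha ⟨u, u'⟩ ha' he
    obtain ⟨ha1, ha2⟩ := Finset.mem_filter.1 (Finset.mem_coe.1 ha)
    obtain ⟨-, ha2'⟩ := Finset.mem_filter.1 (Finset.mem_coe.1 ha')
    rcases Sym2.eq_iff.1 he with ⟨h1, h2⟩ | ⟨h1, h2⟩
    · exact Prod.ext h1 h2
    · exfalso
      simp only at h1 h2 ha2 ha2'
      subst h1 h2
      have hadj : (bondGraph X).Adj z z' := mem_darts.1 ha1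
      obtain ⟨q, hq⟩ := openEdgeSegment_nonempty s(z, z')
      have hq : q ∈ openSegment ℝ z z' := hq
      have hd : 0 < cr (z' - z) (pp (z' - z)) := by
        rw [cr_pp, norm_eq_one_iff.1 (norm_sub_of_adj hadj)]; exact one_pos
      have hd' : 0 < cr (z - z') (-pp (z' - z)) := by
        rw [← neg_sub, cr_neg_left, cr_neg_right, neg_neg]; exact hd
      have p1 := (leftComp_eq_iff_pointsInto hX hadj hT hq hd).1 ha2
      have p2 := (leftComp_eq_iff_pointsInto hX hadj.symm hT
        (by rw [openSegment_symm]; exact hq) hd').1 ha2'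
      obtain ⟨t, ht1, ht2⟩ := (p1.and p2).exists
      have hmid := convex_triangle x y w ht1 ht2 (show (0 : ℝ) ≤ 1 / 2 by norm_num)
        (show (0 : ℝ) ≤ 1 / 2 by norm_num) (by norm_num)
      have hqe : (1 / 2 : ℝ) • (q + t • pp (z' - z)) + (1 / 2 : ℝ) • (q + t • -pp (z' - z)) = q := by
        module
      rw [hqe] at hmid
      exact subset_of_mem_comps hT hmid (segment_subset_drawing hadj
        (openSegment_subset_segment ℝ _ _ hq))

end Triangle

/-! ### The extremal case: equilateral triangles at the boundary. -/

namespace BoundaryCycle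

variable {X : Finset Plane} {v : ℕ → Plane} {b : ℕ} {Ω : Set Plane}

/-- A direction on the positive side, within sixty degrees of the direction `(C, S)`, which itself
is at least sixty degrees away from the axis. -/
theorem rotated_sector {C S p q : ℝ} (hC0 : 0 < C) (hC : C ≤ 1 / 2) (hS : 0 < S)
    (hn : C ^ 2 + S ^ 2 = 1) (hn' : p ^ 2 + q ^ 2 = 1) (h1 : 0 < p * S - q * C)
    (h2 : 1 / 2 < p * C + q * S) : 0 < q ∧ C ≤ p := by
  have hq : 0 < q := by
    by_contra hcon
    have h3 : q * S ≤ 0 := mul_nonpos_of_nonpos_of_nonneg (not_lt.1 hcon) hS.le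
    have h4 : p ≤ 1 := by nlinarith [sq_nonneg q]
    have h5 : p * C ≤ 1 * C := mul_le_mul_of_nonneg_right h4 hC0.le
    linarith
  refine ⟨hq, ?_⟩
  have h5 : 0 < q * C := mul_pos hq hC0
  have hp : 0 < p := by
    by_contra hcon
    have := mul_nonpos_of_nonpos_of_nonneg (not_lt.1 hcon) hS.le
    linarith
  have h6 : (q * C) ^ 2 < (p * S) ^ 2 := pow_lt_pow_left₀ (by linarith) h5.le two_ne_zero
  rw [mul_pow, mul_pow, eq_sub_of_add_eq' hn', eq_sub_of_add_eq' hn] at h6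
  exact (sq_le_sq₀ hC0.le hp.le).1 (by linarith)

/-- In the extremal case every inner side of a bond at a boundary particle belongs to an equilateral
triangle of particles. -/
theorem exists_third_vertex (h : BoundaryCycle X v b) (hX : IsHardSphere X)
    (hΩ : Ω ∈ comps (drawing X)ᶜ) (hΩb : ¬ Bornology.IsBounded Ω) {σ : ℝ} (hσ : σ = 1 ∨ σ = -1)
    (heq : 3 * b ≤ (innerDarts X σ Ω).card + 6) {x y : Plane} (hxy : (bondGraph X).Adj x y)
    (hx : x ∈ boundary X) (hside : sideComp X σ x y ≠ Ω) :
    x + ((1 / 2 : ℝ) • (y - x) + (σ * hs) • pp (y - x)) ∈ X := by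
  by_contra hw
  have hσ2 : σ * σ = 1 := by rcases hσ with rfl | rfl <;> norm_num
  have hσ0 : σ ≠ 0 := by rintro rfl; norm_num at hσ2
  have hhs := hs_sq
  have hhp := hs_pos
  have ha := norm_sub_of_adj hxy
  have haa := norm_eq_one_iff.1 ha
  set a := y - x with had
  -- The bond direction turned by sixty degrees to the `σ`-side; it points to the vertex to be
  -- found.
  set c := (1 / 2 : ℝ) • a + (σ * hs) • pp a with hcd
  have hc : ‖c‖ = 1 := norm_turn ha (by
    have : (σ * hs) ^ 2 = (σ * σ) * (hs * hs) := by ring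
    rw [this, hσ2, hhs]; norm_num)
  have hac : dt a c = 1 / 2 := by
    rw [hcd, dt_add_right, dt_smul_right, dt_smul_right, dt_pp, haa]; ring
  have hcc : cr a c = σ * hs := by
    rw [hcd, cr_add_right, cr_smul_right, cr_smul_right, cr_pp, cr_self, haa]; ring
  -- With the vertex `x + c` missing, every bond on this side makes an angle of strictly more than
  -- sixty degrees with `a`.
  have hlt : ∀ z, (bondGraph X).Adj x z → 0 < σ * cr a (z - x) → dt a (z - x) < 1 / 2 := by
    intro z hz hpos
    have hyz : y ≠ z := by
      rintro rfl
      rw [← had, cr_self, mul_zero] at hpos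
      exact hpos.false
    refine lt_of_le_of_ne (hX.dt_le_half hxy hz hyz) fun he => hw ?_
    have hn := dt_sq_add_cr_sq ha (norm_sub_of_adj hz)
    rw [he] at hn
    have h1 : σ * cr a (z - x) = hs := by
      have h2 : (σ * cr a (z - x)) ^ 2 = hs ^ 2 := by
        have : (σ * cr a (z - x)) ^ 2 = (σ * σ) * cr a (z - x) ^ 2 := by ring
        rw [this, hσ2, sq hs, hhs]; linarith
      exact (sq_eq_sq₀ hpos.le hhp.le).1 h2
    have h3 : cr a (z - x) = σ * hs := by rw [← h1, ← mul_assoc, hσ2, one_mul]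
    have h4 := decomp ha (z - x)
    rw [he, h3, ← hcd] at h4
    rw [← h4, add_sub_cancel]
    exact hz.2.1
  have hdt : ∀ s : ℝ, dt a (nearDir c (s * σ)) = (√(1 + (s * σ) ^ 2))⁻¹ * (1 / 2 - s * hs) := by
    intro s
    rw [nearDir, dt_smul_right, dt_add_right, dt_smul_right, dt_pp_right, hac, hcc]
    congr 1
    linear_combination (-s * hs) * hσ2
  have hcr : ∀ s : ℝ, σ * cr a (nearDir c (s * σ)) = (√(1 + (s * σ) ^ 2))⁻¹ * (hs + s / 2) := by
    intro s
    rw [nearDir, cr_smul_right, cr_add_right, cr_smul_right, cr_pp_right, hac, hcc]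
    linear_combination ((√(1 + (s * σ) ^ 2))⁻¹ * (hs + s / 2)) * hσ2
  have hlim : Tendsto (fun s : ℝ => dt a (nearDir c (s * σ))) (𝓝[>] 0) (𝓝 (1 / 2)) := by
    have hcont : Continuous fun s : ℝ => (√(1 + (s * σ) ^ 2))⁻¹ * (1 / 2 - s * hs) :=
      Continuous.mul (Continuous.inv₀ (by fun_prop)
        (fun s => Real.sqrt_ne_zero'.2 (by positivity))) (by fun_prop)
    have h0 := hcont.tendsto 0
    simp only [zero_mul, sub_zero, ne_eq, OfNat.ofNat_ne_zero, not_false_eq_true, zero_pow,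
      add_zero, Real.sqrt_one, inv_one, one_mul] at h0
    rw [funext hdt]
    exact h0.mono_left nhdsWithin_le_nhds
  -- Turning `c` slightly further away from `a` still stays short of all these bonds, because there
  -- are only finitely many particles.
  have hev : ∀ᶠ s : ℝ in 𝓝[>] 0, ∀ z ∈ X, dt a (z - x) < 1 / 2 →
      dt a (z - x) < dt a (nearDir c (s * σ)) := by
    refine (eventually_all_finset X).2 fun z _ => ?_
    by_cases hz : dt a (z - x) < 1 / 2
    · filter_upwards [hlim.eventually (lt_mem_nhds hz)] with s hs _ using hs
    · exact Eventually.of_forall fun s h => absurd h hz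
  obtain ⟨s, hgen, hs0, hsX, hspos⟩ := ((eventually_isHexGeneric X hc hσ0).and
    ((hlim.eventually (lt_mem_nhds (show (0 : ℝ) < 1 / 2 by norm_num))).and
      (hev.and self_mem_nhdsWithin))).exists
  have hspos : 0 < s := hspos
  have hd1 := hgen.1
  set d := nearDir c (s * σ) with hdd
  have hsq : 0 < (√(1 + (s * σ) ^ 2))⁻¹ := inv_pos.2 (Real.sqrt_pos.2 (by positivity))
  have hsq1 : (√(1 + (s * σ) ^ 2))⁻¹ ≤ 1 :=
    inv_le_one_of_one_le₀ (Real.one_le_sqrt.2 (by nlinarith [sq_nonneg (s * σ)]))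
  have hS : 0 < σ * cr a d := by rw [hcr]; positivity
  have hC : dt a d ≤ 1 / 2 := by
    have h1 : 0 < 1 / 2 - s * hs := by
      have := hs0
      rw [hdt] at this
      exact pos_of_mul_pos_right this hsq.le
    rw [hdt]
    have := mul_pos hspos hhp
    nlinarith
  have hno : ∀ z, (bondGraph X).Adj x z → 0 < σ * cr a (z - x) → dt a (z - x) < dt a d :=
    fun z hz hpos => hsX z hz.2.1 (hlt z hz hpos)
  -- No bond lies between `a` and `d`, so if `d` pointed into `Ω`, the `σ`-side of the bond would be
  -- `Ω`.
  have hin : ¬ PointsInto Ω x (hexDir d 0) := by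
    intro hp
    refine hside (sideComp_eq_of_pointsInto hX hxy (e := d) hd1 hΩ hS ?_ hp)
    intro z hz α β hα hβ hze
    have hzx := norm_sub_of_adj hz
    have hsum : 1 ≤ α + β := by
      rw [← hzx, hze]
      refine (norm_add_le _ _).trans ?_
      rw [norm_smul, norm_smul, ha, hd1, mul_one, mul_one, Real.norm_eq_abs, Real.norm_eq_abs,
        abs_of_nonneg hα, abs_of_pos hβ]
    have e1 : dt a (z - x) = α + β * dt a d := by
      rw [hze, dt_add_right, dt_smul_right, dt_smul_right, ← had, haa, mul_one]
    have e2 : σ * cr a (z - x) = β * (σ * cr a d) := by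
      rw [hze, cr_add_right, cr_smul_right, cr_smul_right, ← had, cr_self]; ring
    have h1 := hno z hz (by rw [e2]; exact mul_pos hβ hS)
    rw [e1] at h1
    nlinarith
  -- Extremality supplies a bond with `d` on its `σ`-side at less than sixty degrees. As `d` is at
  -- least sixty degrees away from `a`, `rotated_sector` places this bond between `a` and `d`, where
  -- there is none.
  obtain ⟨z, hz, hz1, hz2⟩ := h.exists_bond_of_card_eq hX hΩ hΩb hσ heq hgen hx hin
  have hz1 : 0 < σ * cr (z - x) d := hz1
  have hz2 : 1 / 2 < dt (z - x) d := hz2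
  have hn := dt_sq_add_cr_sq ha (norm_sub_of_adj hz)
  have hn' := dt_sq_add_cr_sq ha hd1
  rw [cr_eq_of_unit ha] at hz1
  rw [dt_eq_of_unit ha] at hz2
  have hprod : cr a (z - x) * cr a d = (σ * cr a (z - x)) * (σ * cr a d) := by
    linear_combination (-(cr a (z - x) * cr a d)) * hσ2
  have hz1' : 0 < dt a (z - x) * (σ * cr a d) - (σ * cr a (z - x)) * dt a d := by
    linarith
  rw [hprod] at hz2
  have hnS : dt a (z - x) ^ 2 + (σ * cr a (z - x)) ^ 2 = 1 := by
    rw [← hn]; linear_combination (cr a (z - x) ^ 2) * hσ2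
  have hnS' : dt a d ^ 2 + (σ * cr a d) ^ 2 = 1 := by
    rw [← hn']; linear_combination (cr a d ^ 2) * hσ2
  have hz2' : 1 / 2 < dt a (z - x) * dt a d + (σ * cr a (z - x)) * (σ * cr a d) := hz2
  obtain ⟨hpos, hle⟩ := rotated_sector hs0 hC hS hnS' hnS hz1' hz2'
  exact absurd (hno z hz hpos) (not_lt.2 hle)

theorem faceLength_sideComp_le (h : BoundaryCycle X v b) (hX : IsHardSphere X)
    (hΩ : Ω ∈ comps (drawing X)ᶜ) (hΩb : ¬ Bornology.IsBounded Ω) {σ : ℝ} (hσ : σ = 1 ∨ σ = -1)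
    (heq : 3 * b ≤ (innerDarts X σ Ω).card + 6) {x y : Plane} (hxy : (bondGraph X).Adj x y)
    (hx : x ∈ boundary X) (hf : IsFace X (sideComp X σ x y)) :
    faceLength X (sideComp X σ x y) ≤ 3 := by
  have hside : sideComp X σ x y ≠ Ω := by
    rintro rfl
    exact hΩb hf.2.1
  have hw := h.exists_third_vertex hX hΩ hΩb hσ heq hxy hx hside
  have hσ2 : σ * σ = 1 := by rcases hσ with rfl | rfl <;> norm_num
  have hhs := hs_sq
  have ha := norm_sub_of_adj hxy
  have haa := norm_eq_one_iff.1 ha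
  set c := (1 / 2 : ℝ) • (y - x) + (σ * hs) • pp (y - x) with hcd
  have hsq : (σ * hs) ^ 2 = 3 / 4 := by
    have : (σ * hs) ^ 2 = (σ * σ) * (hs * hs) := by ring
    rw [this, hσ2, hhs]; norm_num
  have hxw : (bondGraph X).Adj x (x + c) := by
    refine ⟨hxy.1, hw, ?_⟩
    rw [dist_comm, dist_eq_norm, add_sub_cancel_left]
    exact norm_turn ha (by rw [hsq]; norm_num)
  have hyw : (bondGraph X).Adj y (x + c) := by
    refine ⟨hxy.2.1, hw, ?_⟩
    have : x + c - y = (-1 / 2 : ℝ) • (y - x) + (σ * hs) • pp (y - x) := by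
      rw [hcd]; module
    rw [dist_comm, dist_eq_norm, this]
    exact norm_turn ha (by rw [hsq]; norm_num)
  have hK : σ * cr (y - x) (x + c - x) = hs := by
    rw [add_sub_cancel_left, hcd, cr_add_right, cr_smul_right, cr_smul_right, cr_self, cr_pp, haa]
    linear_combination hs * hσ2
  have hKpos : 0 < σ * cr (y - x) (x + c - x) := by rw [hK]; exact hs_pos
  have hK0 : cr (y - x) (x + c - x) ≠ 0 := fun h0 => by
    rw [h0, mul_zero] at hKpos; exact hKpos.false
  rw [sideComp_eq_triangle hX hxy hxw hyw hKpos] at hf ⊢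
  exact faceLength_triangle_le hX hxy hxw hyw hK0 hf

end BoundaryCycle

end HardSphere

namespace HardSphere

open Set Filter Topology Metric

namespace BoundaryCycle

variable {X : Finset Plane} {v : ℕ → Plane} {b : ℕ} {Ω : Set Plane}

theorem ncard_isFace (h : BoundaryCycle X v b) (hX : IsHardSphere X)
    (hΩ : Ω ∈ comps (drawing X)ᶜ) (hΩb : ¬ Bornology.IsBounded Ω) :
    {f | IsFace X f}.ncard =
      {f | IsFace (removeBoundary X) f}.ncard + {f | IsFace X f ∧ f ⊆ outside X Ω}.ncard := by
  have hfin := finite_isFace hX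
  rw [← ncard_union_eq _ ((finite_isFace hX.removeBoundary)) (hfin.subset fun f hf => hf.1)]
  · congr 1
    ext f
    simp only [Set.mem_union, mem_ofPred_eq, h.isFace_removeBoundary_iff hX hΩ hΩb]
    tauto
  · rw [Set.disjoint_left]
    exact fun f hf hf' => ((h.isFace_removeBoundary_iff hX hΩ hΩb).1 hf).2 hf'.2

theorem faceLength_le_of_not_isFace (h : BoundaryCycle X v b) (hX : IsHardSphere X)
    (hΩ : Ω ∈ comps (drawing X)ᶜ) (hΩb : ¬ Bornology.IsBounded Ω)
    (heq : ∀ σ, 3 * b ≤ (innerDarts X σ Ω).card + 6) {f : Set Plane} (hf : IsFace X f)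
    (hnf : ¬ IsFace (removeBoundary X) f) : faceLength X f ≤ 3 := by
  obtain ⟨x, y, hxy, hx, hs⟩ := exists_dart_of_not_isFace hX hf hnf
  obtain ⟨σ, hσ, rfl⟩ : ∃ σ : ℝ, (σ = 1 ∨ σ = -1) ∧ sideComp X σ x y = f := by
    rcases hs with h1 | h1
    · exact ⟨1, Or.inl rfl, by rw [sideComp, if_pos one_pos, h1]⟩
    · exact ⟨-1, Or.inr rfl, by rw [sideComp, if_neg (by norm_num), h1]⟩
  exact h.faceLength_sideComp_le hX hΩ hΩb hσ (heq σ) hxy hx hf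

/-- Surviving faces keep their length, and each lost face has length at most three in the extremal
case, so it contributes nothing. -/
theorem defect_eq (h : BoundaryCycle X v b) (hX : IsHardSphere X)
    (hΩ : Ω ∈ comps (drawing X)ᶜ) (hΩb : ¬ Bornology.IsBounded Ω)
    (heq : ∀ σ, 3 * b ≤ (innerDarts X σ Ω).card + 6) :
    defect X = defect (removeBoundary X) := by
  classical
  have hfin := finite_isFace hX
  have hfin' := finite_isFace hX.removeBoundary
  have hsub : hfin'.toFinset ⊆ hfin.toFinset := by
    intro f hf
    rw [Finite.mem_toFinset] at hf ⊢
    exact h.isFace_of_isFace_removeBoundary hX hΩ hΩb hf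
  rw [defect, defect, finsum_mem_eq_finite_toFinset_sum _ hfin,
    finsum_mem_eq_finite_toFinset_sum _ hfin', ← Finset.sum_subset hsub]
  · refine Finset.sum_congr rfl fun f hf => ?_
    have hf' := (hfin'.mem_toFinset).1 hf
    rw [faceLength_removeBoundary hX (h.isFace_of_isFace_removeBoundary hX hΩ hΩb hf') hf']
  · intro f hf hnf
    rw [Finite.mem_toFinset] at hf hnf
    exact Nat.sub_eq_zero_of_le (h.faceLength_le_of_not_isFace hX hΩ hΩb heq hf hnf)

end BoundaryCycle

end HardSphere

theorem lemma4p2 (X : Finset HardSphere.Plane) (hX : HardSphere.IsHardSphere X)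
    (hbd : HardSphere.HasSimplyClosedBoundary X)
    (hne : (HardSphere.removeBoundary X).Nonempty) :
    HardSphere.perimeter X + HardSphere.defect X ≥
        HardSphere.perimeter (HardSphere.removeBoundary X) +
          HardSphere.defect (HardSphere.removeBoundary X) + 6 ∧
      (HardSphere.perimeter X + HardSphere.defect X =
          HardSphere.perimeter (HardSphere.removeBoundary X) +
            HardSphere.defect (HardSphere.removeBoundary X) + 6 →
        HardSphere.defect X = HardSphere.defect (HardSphere.removeBoundary X)) := by
  obtain ⟨v, b, h⟩ := hbd.exists_cycle
  obtain ⟨Ω, hΩ, hΩb⟩ := HardSphere.exists_unbounded_comp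
    (HardSphere.BoundaryCycle.isBounded_drawing X)
  have h1 := HardSphere.perimeter_add_defect hX
  have h2 := HardSphere.perimeter_add_defect hX.removeBoundary
  have h3 := h.ncard_isFace hX hΩ hΩb
  have h4 := h.ncard_lost_faces_le hX hne hΩ hΩb
  have h5 := h.card_bonds_le hX hne hΩ hΩb
  have h6 := h.card_innerDarts hX hΩ hΩb (Or.inl rfl)
  have h7 := h5 1
  -- With `e - e'` removed bonds, `h1` to `h4` give a difference of at least `3 b - (e - e')`, which
  -- is at least `6` by `h6` and `h7`. Equality makes the number of removed bonds at least `3 b -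
  -- 6`, so by `h5` the dart count is extremal for every `σ`.
  refine ⟨by omega, fun heq => h.defect_eq hX hΩ hΩb fun σ => ?_⟩
  have h8 := h5 σ
  omega
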